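/- **Setting.** Let $K/k$ be a finitely generated field extension of transcendence degree $d$. A *maximal rank* valuation on $K/k$ is a valuation $v$ on $K$, trivial on $k$ and written additively, whose value group $\Lambda=v(K^*)$ has the property that $E_v=\mathbb R\otimes\Lambda$ is a real vector space of dimension $d$. Let $S_1,S_2,\dots$ be $k$-subspaces of $K$ with $1\in S_1$, $S_mS_n\subseteq S_{m+n}$ and $\dim_k S_n\le Cn^d$ for all $n\ge 1$ and some $C\in\mathbb R$, such that the $k$-algebra $S=\bigcup_{n\ge1}S_n$ generates $K$ as a field. Put $V_n=v(S_n\smallsetminus\{0\})$, let $Ok(S)\subseteq E_v$ be the closed convex hull of $\bigcup_{n\ge1}\frac1nV_n$, and let $\mu_n$ be the counting measure on $\frac1nV_n$ normalized so that each point has mass $n^{-d}$. Let $\mu$ be Lebesgue measure on $E_v$, normalized so that $\Lambda$ has covolume $1$. For a normal integral scheme $X$ proper over $k$ (e.g. a normal projective variety), with function field $K=k(X)$ and $d=\dim X=\operatorname{tr.deg}_kK$, and an integral Weil divisor $D$ on $X$ (in particular for a Cartier divisor), put $L(X,D)=\{0\}\cup\{f\in K^*: (f)+D\ge0\}$ and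 $\operatorname{vol}(D)=d!\,\limsup_n \dim_k L(X,nD)/n^d$. If $S_n=L(X,nD)$ we write $Ok(X,D)$ for $Ok(S)$. **Theorem.** 1. In the setting above, $\Lambda\cong\mathbb Z^d$ (so that $\mu$ is defined), each $V_n$ is finite, $Ok(S)$ is compact with $\mu(Ok(S))<\infty$, and the measures $\mu_n$ converge weakly to the restriction of $\mu$ to $Ok(S)$: $\int f\,d\mu_n\to\int_{Ok(S)}f\,d\mu$ for every bounded continuous $f:E_v\to\mathbb R$. 2. Let $D$ be an effective integral Weil divisor on a normal integral scheme $X$ proper over $k$ such that $\bigcup_{n\ge1}L(X,nD)$ generates $k(X)$ as a field over $k$, and let $v$ be a maximal rank valuation on $k(X)/k$. Assume that $k$ is algebraically closed, or more generally that the residue field of $v$ is $k$. Then the spaces $S_n=L(X,nD)$ satisfy all the conditions in the setting (in particular $\dim_k L(X,nD)=O(n^d)$), $\Lambda\cong\mathbb Z^d$, and $$\mu(Ok(X,D))=\operatorname{vol}(D)/(\dim X)!.$$ 3. Let $D$ be an integral Weil divisor (not necessarily effective) on a normal integral scheme $X$ proper over $k$, $k$ any field, $d=\dim X$, such that the field generated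 over $k$ by the quotients $f/g$ with $f,g\in L(X,nD)$, $g\ne0$, $n\ge1$, has transcendence degree $d$ over $k$. Then all $L(X,nD)$, $n\ge1$, are finite-dimensional, $0<\operatorname{vol}(D)<\infty$, and the volume is a limit: $\operatorname{vol}(D)=\lim_n d!\,\dim_kL(X,nD)/n^d$. -/

import Mathlib

open Filter Topology MeasureTheory TensorProduct
open scoped ENNReal BoundedContinuousFunction Nat

universe u

/-! ### The real vector space spanned by an abelian group -/

/-- The real vector space `ℝ ⊗ Λ`. -/
def RealSpan (Λ : Type*) [AddCommGroup Λ] : Type _ := ℝ ⊗[ℤ] Λ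

namespace RealSpan

variable (Λ : Type*) [AddCommGroup Λ]

noncomputable instance : AddCommGroup (RealSpan Λ) := inferInstanceAs (AddCommGroup (ℝ ⊗[ℤ] Λ))

noncomputable instance : Module ℝ (RealSpan Λ) := inferInstanceAs (Module ℝ (ℝ ⊗[ℤ] Λ))

/-- The usual vector space topology when `ℝ ⊗ Λ` is finite-dimensional. -/
noncomputable instance : TopologicalSpace (RealSpan Λ) := moduleTopology ℝ (RealSpan Λ)

instance : IsModuleTopology ℝ (RealSpan Λ) := ⟨rfl⟩

noncomputable instance : MeasurableSpace (RealSpan Λ) := borel (RealSpan Λ)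

instance : BorelSpace (RealSpan Λ) := ⟨rfl⟩

end RealSpan

/-- The element `γ / n` of `ℝ ⊗ Λ`. -/
noncomputable def latticePoint {Λ : Type*} [AddCommGroup Λ] (n : ℕ) (γ : Λ) : RealSpan Λ :=
  ((n : ℝ)⁻¹ ⊗ₜ[ℤ] γ : ℝ ⊗[ℤ] Λ)

/-- The real basis of `ℝ ⊗ Λ` given by a `ℤ`-basis of `Λ`. -/
noncomputable def realBasis {Λ : Type*} [AddCommGroup Λ] {d : ℕ}
    (b : Module.Basis (Fin d) ℤ Λ) : Module.Basis (Fin d) ℝ (RealSpan Λ) :=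
  (Algebra.TensorProduct.basis ℝ b : Module.Basis (Fin d) ℝ (ℝ ⊗[ℤ] Λ))

/-- Lebesgue measure on `ℝ ⊗ Λ`, normalized so that `Λ` has covolume `1`: the image of Lebesgue
measure on `ℝ ^ d` under the coordinates given by a `ℤ`-basis of `Λ`. -/
noncomputable def lebesgueMeasure {Λ : Type*} [AddCommGroup Λ] {d : ℕ}
    (b : Module.Basis (Fin d) ℤ Λ) : Measure (RealSpan Λ) :=
  Measure.map (realBasis b).equivFun.symm volume

/-! ### Valuations of maximal rank and Okounkov bodies -/

section Valuations

variable {k K Γ : Type*} [Field k] [Field K] [Algebra k K]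
  [AddCommGroup Γ] [LinearOrder Γ] [IsOrderedAddMonoid Γ]

/-- The value group `v(K*)`. -/
def valueGroup (v : AddValuation K (WithTop Γ)) : AddSubgroup Γ where
  carrier := {γ | ∃ x : K, v x = (γ : WithTop Γ)}
  add_mem' := by
    rintro a b ⟨x, hx⟩ ⟨y, hy⟩
    exact ⟨x * y, by rw [AddValuation.map_mul, hx, hy, WithTop.coe_add]⟩
  zero_mem' := ⟨1, by rw [AddValuation.map_one, WithTop.coe_zero]⟩
  neg_mem' := by
    rintro a ⟨x, hx⟩
    have hx0 : x ≠ 0 := by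
      rintro rfl
      rw [AddValuation.map_zero] at hx
      exact WithTop.top_ne_coe hx
    have hi : v x⁻¹ ≠ ⊤ := by
      rw [Ne, AddValuation.top_iff]
      exact inv_ne_zero hx0
    obtain ⟨c, hc⟩ := WithTop.ne_top_iff_exists.mp hi
    refine ⟨x⁻¹, ?_⟩
    have h := AddValuation.map_mul v x x⁻¹
    rw [mul_inv_cancel₀ hx0, AddValuation.map_one, hx, ← hc, ← WithTop.coe_add,
      ← WithTop.coe_zero, WithTop.coe_inj] at h
    rw [← hc, WithTop.coe_inj]
    exact (neg_eq_of_add_eq_zero_right h.symm).symm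

variable (k) in
/-- `v` is a valuation of maximal rank on `K/k`, where `K/k` has transcendence degree `d`:
it is trivial on `k` and `ℝ ⊗ v(K*)` has dimension `d`. -/
structure IsMaximalRank (d : ℕ) (v : AddValuation K (WithTop Γ)) : Prop where
  trdeg_eq : Algebra.trdeg k K = d
  trivial_on : ∀ c : k, c ≠ 0 → v (algebraMap k K c) = 0
  rank_eq : Module.rank ℝ (RealSpan (valueGroup v)) = d

variable (k) in
/-- The residue field of `v` is `k`: every unit of the valuation ring is congruent to a constant
modulo the maximal ideal. -/
def HasResidueField (v : AddValuation K (WithTop Γ)) : Prop :=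
  ∀ x : K, v x = 0 → ∃ c : k, 0 < v (x - algebraMap k K c)

/-- The subspaces `S n`, `n ≥ 1`, of `K` are a filtration, with `1 ∈ S 1` and `dim (S n) = O(n^d)`,
of a subalgebra `⋃ S n` that generates `K` as a field. (The union is automatically a
subalgebra; `S 0` plays no role.) -/
structure IsOkounkovFiltration (d : ℕ) (S : ℕ → Submodule k K) : Prop where
  one_mem : (1 : K) ∈ S 1
  mul_le : ∀ m n : ℕ, 1 ≤ m → 1 ≤ n → S m * S n ≤ S (m + n)
  generates : IntermediateField.adjoin k (⋃ n ≥ 1, (S n : Set K)) = ⊤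
  growth : (∀ n ≥ 1, Module.Finite k (S n)) ∧
    ∃ C : ℝ, ∀ n : ℕ, 1 ≤ n → (Module.finrank k (S n) : ℝ) ≤ C * (n : ℝ) ^ d

/-- `V_n = v(S_n ∖ 0)`. -/
def valueSet (v : AddValuation K (WithTop Γ)) (S : ℕ → Submodule k K) (n : ℕ) :
    Set (valueGroup v) :=
  {γ | ∃ x ∈ S n, v x = ((γ : Γ) : WithTop Γ)}

/-- `V_n / n`, as a subset of `ℝ ⊗ v(K*)`. -/
def scaledValueSet (v : AddValuation K (WithTop Γ)) (S : ℕ → Submodule k K) (n : ℕ) :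
    Set (RealSpan (valueGroup v)) :=
  latticePoint n '' valueSet v S n

/-- The Okounkov body: the closed convex hull of `⋃ V_n / n`. -/
def okounkovBody (v : AddValuation K (WithTop Γ)) (S : ℕ → Submodule k K) :
    Set (RealSpan (valueGroup v)) :=
  closure (convexHull ℝ (⋃ n ≥ 1, scaledValueSet v S n))

/-- The measure `μ_n`: counting measure on `V_n / n`, each point having mass `n ^ (-d)`. -/
noncomputable def normalizedCount (d : ℕ) (v : AddValuation K (WithTop Γ))
    (S : ℕ → Submodule k K) (n : ℕ) : Measure (RealSpan (valueGroup v)) :=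
  ((n : ℝ≥0∞) ^ d)⁻¹ • Measure.count.restrict (scaledValueSet v S n)

end Valuations

/-! ### Divisors on normal varieties, their section spaces and their volume -/

section Divisors

open AlgebraicGeometry CategoryTheory

/-- The constants `k → Γ(X, 𝒪)` of a scheme over a field `k`. -/
noncomputable def constHom (k : Type u) [Field k] (X : Scheme.{u}) [X.Over (Spec (.of k))] :
    k →+* Γ(X, ⊤) :=
  ((Scheme.ΓSpecIso (.of k)).inv ≫ (X ↘ Spec (.of k)).appTop).hom

/-- The function field of an integral scheme over `k`, as a field extension of `k`. -/
noncomputable instance functionFieldAlgebra (k : Type u) [Field k] (X : Scheme.{u})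
    [X.Over (Spec (.of k))] [IsIntegral X] : Algebra k X.functionField :=
  ((X.presheaf.germ ⊤ (genericPoint X) trivial).hom.comp (constHom k X)).toAlgebra

/-- All local rings are integrally closed. -/
class IsNormalScheme (X : Scheme.{u}) : Prop where
  normal : ∀ x : X, IsIntegrallyClosed (X.presheaf.stalk x)

/-- Weil divisors: cycles all of whose components are points of codimension one (that is, generic
points of prime divisors). On a normal variety they include the Cartier divisors. -/
def WeilDivisor (X : Scheme.{u}) : AddSubgroup (AlgebraicCycle X ℤ) where
  carrier := {D | ∀ x : X, D x ≠ 0 → Order.coheight x = 1}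
  add_mem' := by
    intro a b ha hb x hx
    by_contra h
    have h1 : a x = 0 := by_contra fun h' => h (ha x h')
    have h2 : b x = 0 := by_contra fun h' => h (hb x h')
    apply hx
    simp [h1, h2]
  zero_mem' := by intro x hx; simp at hx
  neg_mem' := by
    intro a ha x hx
    apply ha x
    simpa using hx

theorem isDiscreteValuationRing_stalk {X : Scheme.{u}} [IsIntegral X] [IsLocallyNoetherian X]
    [IsNormalScheme X] (x : X) (hx : Order.coheight x = 1) :
    IsDiscreteValuationRing (X.presheaf.stalk x) := by
  have hn : IsIntegrallyClosed (X.presheaf.stalk x) := IsNormalScheme.normal x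
  have hd : ringKrullDim (X.presheaf.stalk x) = 1 := by
    rw [ringKrullDim_stalk_eq_coheight, hx]; rfl
  have hle : Ring.KrullDimLE 1 (X.presheaf.stalk x) := krullDimLE_of_coheight_le hx.le
  have hf : ¬ IsField (X.presheaf.stalk x) := by
    intro h
    rw [ringKrullDim_eq_zero_of_isField h] at hd
    exact zero_ne_one hd
  have hdim : Ring.DimensionLEOne (X.presheaf.stalk x) :=
    ⟨fun {p} h0 hp => (Ring.krullDimLE_one_iff_of_noZeroDivisors.mp hle) p h0 hp⟩
  have hded : IsDedekindDomain (X.presheaf.stalk x) := { }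
  exact ((IsDiscreteValuationRing.TFAE (X.presheaf.stalk x) hf).out 0 2).mpr hded

theorem ord_constant {k : Type u} [Field k] {X : Scheme.{u}} [X.Over (Spec (.of k))]
    [IsIntegral X] [IsLocallyNoetherian X] (c : k) (hc : c ≠ 0) (x : X) :
    Scheme.ord (algebraMap k X.functionField c) x = 0 := by
  have : Nonempty (⊤ : X.Opens) := ⟨⟨genericPoint X, trivial⟩⟩
  exact Scheme.ord_of_isUnit (U := ⊤) (f := constHom k X c)
    ((IsUnit.mk0 c hc).map (constHom k X)) (x := x) trivial

/-- `L(X, D)`: the rational functions `f` with `f = 0` or `(f) + D ≥ 0`, that is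
`ord_x f ≥ - D x` for every point `x` of codimension one. -/
noncomputable def sectionSpace (k : Type u) [Field k] (X : Scheme.{u}) [X.Over (Spec (.of k))]
    [IsIntegral X] [IsLocallyNoetherian X] [IsNormalScheme X] (D : WeilDivisor X) :
    Submodule k X.functionField where
  carrier := {f | f = 0 ∨
    ∀ x : X, Order.coheight x = 1 → -((D : AlgebraicCycle X ℤ) x) ≤ Scheme.ord f x}
  add_mem' := by
    intro f g hf hg
    by_cases h0 : f + g = 0
    · exact Or.inl h0
    rcases hf with rfl | hf
    · simpa using hg
    rcases hg with rfl | hg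
    · simpa using Or.inr hf
    refine Or.inr fun x hx => ?_
    have := isDiscreteValuationRing_stalk x hx
    exact (le_min (hf x hx) (hg x hx)).trans (Scheme.ord_add h0)
  zero_mem' := Or.inl rfl
  smul_mem' := by
    intro c f hf
    rcases eq_or_ne c 0 with rfl | hc
    · exact Or.inl (zero_smul k f)
    rcases eq_or_ne f 0 with rfl | h0
    · exact Or.inl (smul_zero c)
    rcases hf with hf | hf
    · exact absurd hf h0
    refine Or.inr fun x hx => ?_
    have hc' : algebraMap k X.functionField c ≠ 0 := by
      rwa [Ne, map_eq_zero]
    rw [Algebra.smul_def, Scheme.ord_mul hc' h0, ord_constant c hc x, zero_add]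
    exact hf x hx

/-- `vol(D) = d! · limsup dim L(X, nD) / n ^ d`, where `d = dim X`. -/
noncomputable def divisorVolume (k : Type u) [Field k] (X : Scheme.{u}) [X.Over (Spec (.of k))]
    [IsIntegral X] [IsLocallyNoetherian X] [IsNormalScheme X] (d : ℕ) (D : WeilDivisor X) : ℝ≥0∞ :=
  (d ! : ℝ≥0∞) *
    limsup (fun n : ℕ => (Module.finrank k (sectionSpace k X (n • D)) : ℝ≥0∞) / (n : ℝ≥0∞) ^ d) atTop

/-- The subfield of `k(X)` generated over `k` by the quotients `f / g` of elements of the same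
`L(X, nD)`, `n ≥ 1`: the field of homogeneous fractions of degree zero of `⊕ L(X, nD)`. -/
noncomputable def sectionRatioField (k : Type u) [Field k] (X : Scheme.{u})
    [X.Over (Spec (.of k))] [IsIntegral X] [IsLocallyNoetherian X] [IsNormalScheme X]
    (D : WeilDivisor X) : IntermediateField k X.functionField :=
  IntermediateField.adjoin k
    {q | ∃ n : ℕ, 1 ≤ n ∧ ∃ f ∈ sectionSpace k X (n • D), ∃ g ∈ sectionSpace k X (n • D),
      g ≠ 0 ∧ q = f / g}

end Divisors

/-! ### Semigroups of lattice points -/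

section Semigroup

/-! The problem is reduced to counting points of a semigroup of lattice points. Choose `x i` in `K`
whose values are `d` independent elements of the value group. Distinct Laurent monomials in `x` have
distinct values, so a nonzero polynomial in `x` has the value of its lowest monomial. Hence `x` is
algebraically independent, `K` is finite over `k(x)`, and `k(x)` has residue field `k`. An algebraic
equation for `u` over `k(x)` has two terms of equal value, so a bounded multiple of the value of `u`
is a value of `k(x)`. Therefore the value group is a lattice of rank `d`.

In coordinates the sets `V n` become the slices of a subsemigroup of `ℕ × ℤ ^ d` that generates `ℤ ×
ℤ ^ d`. By `IsLatticeSemigroup.eventually_mem`, such a semigroup contains all lattice points of high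
level over a compact convex set in the interior of its body. Together with lattice point counts for
convex sets, this gives equidistribution once the body is compact. Compactness follows from `#V n =
O(n ^ d)`: an unbounded convex body with interior contains compact convex sets of arbitrarily large
volume (`Convex.isBounded_of_volume_le`).

For a divisor, `#V n = O(n ^ d)` is proved without intersection theory. Algebraic Hartogs and the
valuative criterion yield one `h` such that `h ^ n * f` is integral over `k[y]` for all `f` in `L(X,
nD)`. So the minimal polynomial of `f` has coefficients in `k[y]` up to powers of `h ^ n`, which
bounds the exponents of their values below. Taking for `y` the system `x` and the systems with one
`x i` inverted confines the values to a box of side `O(n)` (`AddValuation.exists_ncard_values_le`).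

Dimensions are compared with numbers of values through leaves, spaces whose nonzero elements all
have one value. If the residue field is `k`, leaves are lines and `dim S n = #V n`. Over an
arbitrary field their dimension is at most `[K : k(x)]`. If `W` in `S m` is a leaf of the largest
dimension `l` that occurs, then `l * #V n ≤ dim S (n + m) ≤ l * #V (n + m)`, so the limit exists.
The volume statement then needs only some valuation of maximal rank, obtained from lexicographic
Hahn series, and the fact that quotients of sections give all of `K` in every degree; the latter
uses integral equations and normality. -/

/-- Write each element of `B` as `a - b` with `a`, `b` in `T` and let `s` collect the `b`'s. This
shift absorbs the bounded rounding error in `IsLatticeSemigroup.eventually_mem`. -/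
theorem AddSubsemigroup.exists_add_mem_of_finite {G : Type*} [AddCommGroup G]
    (T : AddSubsemigroup G) (hT : ∀ g : G, ∃ a ∈ T, ∃ b ∈ T, g = a - b) {B : Set G}
    (hB : B.Finite) : ∃ s ∈ T, ∀ b ∈ B, s + b ∈ T := by
  induction B, hB using Set.Finite.induction_on with
  | empty =>
    obtain ⟨a, ha, -⟩ := hT 0
    exact ⟨a, ha, by simp⟩
  | @insert g B _ _ ih =>
    obtain ⟨s, hs, h⟩ := ih
    obtain ⟨a, ha, b, hb, rfl⟩ := hT g
    refine ⟨s + b, T.add_mem hs hb, ?_⟩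
    rintro x (rfl | hx)
    · have : s + b + (a - b) = s + a := by abel
      rw [this]
      exact T.add_mem hs ha
    · rw [add_right_comm]
      exact T.add_mem (h x hx) hb

theorem AddSubsemigroup.add_sum_nsmul_mem {G ι : Type*} [AddCommGroup G]
    (T : AddSubsemigroup G) {t : G} (ht : t ∈ T) (F : Finset ι) (m : ι → ℕ) (g : ι → G)
    (hg : ∀ i ∈ F, g i ∈ T) : t + ∑ i ∈ F, m i • g i ∈ T := by
  classical
  have key : ∀ (n : ℕ) (t g : G), t ∈ T → g ∈ T → t + n • g ∈ T := by
    intro n t g ht hg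
    induction n with
    | zero => simpa
    | succ n ih =>
      rw [succ_nsmul, ← add_assoc]
      exact T.add_mem ih hg
  induction F using Finset.induction_on with
  | empty => simpa
  | insert i F hi ih =>
    rw [Finset.sum_insert hi, add_comm (m i • g i), ← add_assoc]
    exact key _ _ _ (ih fun j hj => hg j (Finset.mem_insert_of_mem hj))
      (hg i (Finset.mem_insert_self _ _))

variable {d : ℕ}

/-- The point `a / n` of `ℝ ^ d`. -/
noncomputable def scaledPoint (n : ℕ) (a : Fin d → ℤ) : Fin d → ℝ := (n : ℝ)⁻¹ • fun i => (a i : ℝ)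

/-- The sets `V n`, `n ≥ 1`, are the slices of a subsemigroup of `ℕ × ℤ ^ d` that generates the
group `ℤ × ℤ ^ d`. -/
structure IsLatticeSemigroup (V : ℕ → Set (Fin d → ℤ)) : Prop where
  add_mem : ∀ m n : ℕ, 1 ≤ m → 1 ≤ n → ∀ a ∈ V m, ∀ b ∈ V n, a + b ∈ V (m + n)
  exists_sub : ∀ (z : ℤ) (l : Fin d → ℤ), ∃ m n : ℕ, 1 ≤ m ∧ 1 ≤ n ∧ ∃ a ∈ V m, ∃ b ∈ V n,
    z = m - n ∧ l = a - b

/-- The closed convex hull of `⋃ V n / n`. -/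
def semigroupBody (V : ℕ → Set (Fin d → ℤ)) : Set (Fin d → ℝ) :=
  closure (convexHull ℝ (⋃ n ≥ 1, scaledPoint n '' V n))

theorem scaledPoint_injective {n : ℕ} (hn : 1 ≤ n) :
    Function.Injective (scaledPoint n : (Fin d → ℤ) → (Fin d → ℝ)) := by
  intro a b h
  have hn' : (n : ℝ)⁻¹ ≠ 0 := inv_ne_zero (by positivity)
  have := smul_right_injective _ hn' h
  funext i
  exact_mod_cast congrFun this i

/-- The subsemigroup of `ℤ × ℤ ^ d` with slices `V n`. -/
def slicedSemigroup (V : ℕ → Set (Fin d → ℤ))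
    (hV : ∀ m n : ℕ, 1 ≤ m → 1 ≤ n → ∀ a ∈ V m, ∀ b ∈ V n, a + b ∈ V (m + n)) :
    AddSubsemigroup (ℤ × (Fin d → ℤ)) where
  carrier := {x | ∃ n : ℕ, 1 ≤ n ∧ x.1 = n ∧ x.2 ∈ V n}
  add_mem' := by
    rintro ⟨_, a⟩ ⟨_, b⟩ ⟨m, hm, rfl, ha⟩ ⟨n, hn, rfl, hb⟩
    exact ⟨m + n, by omega, by push_cast; rfl, hV m n hm hn a ha b hb⟩

theorem mem_slicedSemigroup {V : ℕ → Set (Fin d → ℤ)}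
    (hV : ∀ m n : ℕ, 1 ≤ m → 1 ≤ n → ∀ a ∈ V m, ∀ b ∈ V n, a + b ∈ V (m + n))
    {n : ℕ} (hn : 1 ≤ n) {a : Fin d → ℤ} :
    ((n : ℤ), a) ∈ slicedSemigroup V hV ↔ a ∈ V n := by
  constructor
  · rintro ⟨m, hm, h, ha⟩
    have : n = m := Int.natCast_inj.mp h
    subst this
    exact ha
  · exact fun h => ⟨n, hn, rfl, h⟩

/-- A lattice point of the cone over finitely many lattice points differs from a natural
combination of these by an element of a fixed bounded set. -/
theorem exists_sub_sum_mem_Icc {ι : Type*} (F : Finset ι) (N : ι → ℕ) (G : ι → Fin d → ℤ)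
    (t : ι → ℝ) (ht : ∀ i ∈ F, 0 ≤ t i) (z : ℤ) (l : Fin d → ℤ)
    (hz : (z : ℝ) = ∑ i ∈ F, t i * N i) (hl : ∀ j, (l j : ℝ) = ∑ i ∈ F, t i * G i j) :
    (z, l) - ∑ i ∈ F, ⌊t i⌋₊ • ((N i : ℤ), G i) ∈
      Set.Icc (-(∑ i ∈ F, (N i : ℤ), ∑ i ∈ F, |G i|)) (∑ i ∈ F, (N i : ℤ), ∑ i ∈ F, |G i|) := by
  -- Rounding each coefficient down leaves a fractional part in `[0, 1)`, so each coordinate of the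
  -- error is at most the sum of the absolute values.
  have key : ∀ (x : ι → ℤ) (y : ℤ), (y : ℝ) = ∑ i ∈ F, t i * x i →
      |y - ∑ i ∈ F, (⌊t i⌋₊ : ℤ) * x i| ≤ ∑ i ∈ F, |x i| := by
    intro x y h
    have : ((|y - ∑ i ∈ F, (⌊t i⌋₊ : ℤ) * x i| : ℤ) : ℝ) ≤ ((∑ i ∈ F, |x i| : ℤ) : ℝ) := by
      push_cast
      rw [h, ← Finset.sum_sub_distrib]
      refine (Finset.abs_sum_le_sum_abs _ _).trans (Finset.sum_le_sum fun i hi => ?_)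
      rw [← sub_mul, abs_mul]
      refine mul_le_of_le_one_left (abs_nonneg _) ?_
      rw [abs_le]
      constructor
      · linarith [Nat.floor_le (ht i hi)]
      · linarith [Nat.lt_floor_add_one (t i)]
    exact_mod_cast this
  have h1 := abs_le.mp (key (fun i => (N i : ℤ)) z (by simpa using hz))
  have h2 := fun j => abs_le.mp (key (fun i => G i j) (l j) (hl j))
  have e1 : ∑ i ∈ F, |(N i : ℤ)| = ∑ i ∈ F, (N i : ℤ) := by simp
  rw [e1] at h1
  refine ⟨⟨?_, fun j => ?_⟩, ⟨?_, fun j => ?_⟩⟩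
  · simpa [Prod.fst_sum] using h1.1
  · simpa [Prod.snd_sum, Finset.sum_apply] using (h2 j).1
  · simpa [Prod.fst_sum] using h1.2
  · simpa [Prod.snd_sum, Finset.sum_apply] using (h2 j).2

theorem Finset.exists_finset_subset_convexHull {E : Type*} [AddCommGroup E] [Module ℝ E]
    (t : Finset E) {U : Set E} (h : (t : Set E) ⊆ convexHull ℝ U) :
    ∃ F : Finset E, (F : Set E) ⊆ U ∧ (t : Set E) ⊆ convexHull ℝ (F : Set E) := by
  classical
  induction t using Finset.induction_on with
  | empty => exact ⟨∅, by simp, by simp⟩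
  | insert x t hx ih =>
    rw [Finset.coe_insert, Set.insert_subset_iff] at h
    obtain ⟨F, hF, hF'⟩ := ih h.2
    have := h.1
    rw [convexHull_eq_union_convexHull_finite_subsets] at this
    simp only [Set.mem_iUnion] at this
    obtain ⟨F', h1, h2⟩ := this
    refine ⟨F ∪ F', by simp [hF, h1], ?_⟩
    rw [Finset.coe_insert, Set.insert_subset_iff, Finset.coe_union]
    exact ⟨convexHull_mono Set.subset_union_right h2,
      hF'.trans (convexHull_mono Set.subset_union_left)⟩

namespace IsLatticeSemigroup

variable {V : ℕ → Set (Fin d → ℤ)} (hV : IsLatticeSemigroup V)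
include hV

/-- Level difference `z = 0` forces the two elements representing a standard basis vector into the
same slice; their scaled difference is a direction of the affine span. -/
theorem affineSpan_eq_top : affineSpan ℝ (⋃ n ≥ 1, scaledPoint n '' V n) = ⊤ := by
  obtain ⟨m, n, hm, hn, a, ha, b, hb, -, -⟩ := hV.exists_sub 0 0
  have hne : (⋃ n ≥ 1, scaledPoint n '' V n).Nonempty :=
    ⟨_, Set.mem_iUnion₂_of_mem hm ⟨a, ha, rfl⟩⟩
  rw [AffineSubspace.affineSpan_eq_top_iff_vectorSpan_eq_top_of_nonempty ℝ _ _ hne, eq_top_iff,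
    ← (Pi.basisFun ℝ (Fin d)).span_eq, Submodule.span_le]
  rintro _ ⟨i, rfl⟩
  obtain ⟨m, n, hm, hn, a, ha, b, hb, h0, h1⟩ := hV.exists_sub 0 (Pi.single i 1)
  have : m = n := by omega
  subst this
  have h2 : scaledPoint m a - scaledPoint m b ∈
      vectorSpan ℝ (⋃ n ≥ 1, scaledPoint n '' V n) :=
    vsub_mem_vectorSpan ℝ (Set.mem_iUnion₂_of_mem hm ⟨a, ha, rfl⟩)
      (Set.mem_iUnion₂_of_mem hm ⟨b, hb, rfl⟩)
  have h3 : Pi.basisFun ℝ (Fin d) i = (m : ℝ) • (scaledPoint m a - scaledPoint m b) := by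
    have hm' : (m : ℝ) ≠ 0 := by positivity
    simp only [scaledPoint, ← smul_sub, smul_inv_smul₀ hm']
    funext j
    have := congrFun h1 j
    simp only [Pi.sub_apply] at this ⊢
    rw [← Int.cast_sub, ← this]
    simp [Pi.single_apply]
  rw [h3]
  exact Submodule.smul_mem _ _ h2

theorem interior_convexHull_nonempty :
    (interior (convexHull ℝ (⋃ n ≥ 1, scaledPoint n '' V n))).Nonempty :=
  interior_convexHull_nonempty_iff_affineSpan_eq_top.mpr hV.affineSpan_eq_top

/-- Passing to the closure adds no interior points, so compact parts of the interior are reached by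
hulls of finitely many actual points of the semigroup. -/
theorem interior_body : interior (semigroupBody V) =
    interior (convexHull ℝ (⋃ n ≥ 1, scaledPoint n '' V n)) :=
  (convex_convexHull ℝ _).interior_closure_eq_interior_of_nonempty_interior
    hV.interior_convexHull_nonempty

theorem interior_body_nonempty : (interior (semigroupBody V)).Nonempty :=
  hV.interior_body ▸ hV.interior_convexHull_nonempty

/-- Over a compact convex subset of the interior of the body, all lattice points of sufficiently
high level belong to the semigroup. -/
theorem eventually_mem {C : Set (Fin d → ℝ)} (hC : Convex ℝ C) (hC' : IsCompact C)
    (hCV : C ⊆ interior (semigroupBody V)) :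
    ∀ᶠ n : ℕ in atTop, ∀ a : Fin d → ℤ, scaledPoint n a ∈ C → a ∈ V n := by
  -- Enclose `C` in the interior of a polytope inside the body, then enlarge this polytope to the
  -- hull of finitely many scaled semigroup points `G u / N u`.
  obtain ⟨t, ht, ht'⟩ := hC.exists_subset_interior_convexHull_finset_of_isCompact hC'
    (mem_nhdsSet_iff_exists.mpr ⟨_, isOpen_interior, hCV, subset_rfl⟩)
  rw [hV.interior_body] at ht'
  obtain ⟨F, hFU, htF⟩ := t.exists_finset_subset_convexHull
    ((subset_convexHull ℝ _).trans (ht'.trans interior_subset))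
  have htF' : convexHull ℝ (t : Set (Fin d → ℝ)) ⊆ convexHull ℝ (F : Set (Fin d → ℝ)) :=
    convexHull_min htF (convex_convexHull ℝ _)
  have hF : ∀ u ∈ F, ∃ n : ℕ, 1 ≤ n ∧ ∃ a ∈ V n, scaledPoint n a = u := by
    intro u hu
    simpa using hFU hu
  choose! N hN G hG hNG using hF
  -- The element `(m, τ)` pushes every possible rounding error of the generators `(N u, G u)` into
  -- the semigroup.
  obtain ⟨⟨_, τ⟩, ⟨m, hm, rfl, hτ⟩, hB⟩ :=
    (slicedSemigroup V hV.add_mem).exists_add_mem_of_finite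
    (by
      rintro ⟨z, l⟩
      obtain ⟨m, n, hm, hn, a, ha, b, hb, rfl, rfl⟩ := hV.exists_sub z l
      exact ⟨(m, a), ⟨m, hm, rfl, ha⟩, (n, b), ⟨n, hn, rfl, hb⟩, rfl⟩)
    (B := Set.Icc (-(∑ i ∈ F, (N i : ℤ), ∑ i ∈ F, |G i|)) (∑ i ∈ F, (N i : ℤ), ∑ i ∈ F, |G i|))
    (by
      rw [← Set.Icc_prod_Icc]
      exact (Set.finite_Icc _ _).prod (Set.finite_Icc _ _))
  -- Subtracting `(m, τ)` from `(n, a)` moves the scaled point by at most `(m * R + ‖τ‖) / (n - m)`,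
  -- which is eventually less than the margin `δ`.
  obtain ⟨δ, hδ, hδC⟩ := hC'.exists_thickening_subset_open isOpen_interior ht
  obtain ⟨R, hR⟩ := hC'.isBounded.exists_norm_le
  set τ' : Fin d → ℝ := fun i => (τ i : ℝ) with hτ'
  have hlim : Tendsto (fun n : ℕ => ((m : ℝ) * R + ‖τ'‖) * ((n - m : ℕ) : ℝ)⁻¹) atTop
      (𝓝 (((m : ℝ) * R + ‖τ'‖) * 0)) :=
    (tendsto_inv_atTop_nhds_zero_nat.comp (tendsto_sub_atTop_nat m)).const_mul _
  rw [mul_zero] at hlim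
  filter_upwards [hlim.eventually (gt_mem_nhds hδ), eventually_gt_atTop m] with n hn hmn a ha
  have hnm : (0 : ℝ) < ((n - m : ℕ) : ℝ) := by
    rw [Nat.cast_pos]; omega
  have hn0 : (0 : ℝ) < n := by
    rw [Nat.cast_pos]; omega
  have hcast : ((n - m : ℕ) : ℝ) = n - m := by
    rw [Nat.cast_sub hmn.le]
  have hmem : scaledPoint (n - m) (a - τ) ∈ convexHull ℝ (F : Set (Fin d → ℝ)) := by
    apply htF'
    apply interior_subset
    apply hδC
    rw [Metric.mem_thickening_iff]
    refine ⟨_, ha, ?_⟩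
    have e : scaledPoint (n - m) (a - τ) - scaledPoint n a =
        ((n - m : ℕ) : ℝ)⁻¹ • ((m : ℝ) • scaledPoint n a - τ') := by
      funext i
      simp only [scaledPoint, Pi.sub_apply, Pi.smul_apply, smul_eq_mul, hτ', Int.cast_sub]
      field_simp
      rw [hcast]
      ring
    rw [dist_eq_norm, e, norm_smul, norm_inv, Real.norm_of_nonneg hnm.le, mul_comm]
    refine lt_of_le_of_lt ?_ hn
    gcongr
    refine (norm_sub_le _ _).trans ?_
    rw [norm_smul, Real.norm_natCast]
    gcongr
    exact hR _ ha
  rw [Finset.mem_convexHull'] at hmem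
  obtain ⟨w, hw0, hw1, hw⟩ := hmem
  -- Since `u = G u / N u`, a convex combination with weights `w u` at level `n - m` is a
  -- combination of the `(N u, G u)` with coefficients `(n - m) * w u / N u`.
  have hcone := exists_sub_sum_mem_Icc F N G (fun u => ((n - m : ℕ) : ℝ) * w u / N u)
    (fun u hu => div_nonneg (mul_nonneg hnm.le (hw0 u hu)) (Nat.cast_nonneg _))
    ((n - m : ℕ) : ℤ) (a - τ)
    (by
      rw [Int.cast_natCast]
      conv_lhs => rw [← mul_one ((n - m : ℕ) : ℝ), ← hw1, Finset.mul_sum]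
      refine Finset.sum_congr rfl fun u hu => ?_
      have : (N u : ℝ) ≠ 0 := by have := hN u hu; positivity
      field_simp)
    (by
      intro j
      have h1 := congrFun hw j
      simp only [Finset.sum_apply, Pi.smul_apply, smul_eq_mul, scaledPoint] at h1
      have h2 : (((a - τ) j : ℤ) : ℝ) =
          ((n - m : ℕ) : ℝ) * (((n - m : ℕ) : ℝ)⁻¹ * (((a - τ) j : ℤ) : ℝ)) := by
        field_simp
      rw [h2, ← h1, Finset.mul_sum]
      refine Finset.sum_congr rfl fun u hu => ?_
      have h3 := congrFun (hNG u hu) j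
      simp only [Pi.smul_apply, smul_eq_mul, scaledPoint] at h3
      rw [← h3]
      ring)
  have h1 := (slicedSemigroup V hV.add_mem).add_sum_nsmul_mem (hB _ hcone) F
    (fun u => ⌊((n - m : ℕ) : ℝ) * w u / N u⌋₊) (fun u => ((N u : ℤ), G u))
    (fun u hu => ⟨N u, hN u hu, rfl, hG u hu⟩)
  rw [add_assoc, sub_add_cancel] at h1
  have h2 : (((m : ℤ), τ) : ℤ × (Fin d → ℤ)) + (((n - m : ℕ) : ℤ), a - τ) = ((n : ℤ), a) := by
    ext
    · simp; omega
    · simp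
  rw [h2] at h1
  exact (mem_slicedSemigroup hV.add_mem (by omega)).mp h1

end IsLatticeSemigroup

end Semigroup

/-! ### Lattice points and Riemann sums over bounded sets with null frontier. -/

section LatticeCount

open scoped Pointwise

variable {d : ℕ}

theorem image_scaledPoint {n : ℕ} (hn : 1 ≤ n) (s : Set (Fin d → ℝ)) :
    scaledPoint n '' {a | scaledPoint n a ∈ s} =
      s ∩ ((n : ℝ)⁻¹ • (Submodule.span ℤ (Set.range (Pi.basisFun ℝ (Fin d))) :
        Set (Fin d → ℝ))) := by
  have : NeZero n := ⟨by omega⟩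
  have hn' : (n : ℝ) ≠ 0 := by positivity
  ext x
  rw [Set.mem_inter_iff, ← Submodule.coe_pointwise_smul, SetLike.mem_coe,
    BoxIntegral.unitPartition.mem_smul_span_iff]
  constructor
  · rintro ⟨a, ha, rfl⟩
    refine ⟨ha, fun i => ⟨a i, ?_⟩⟩
    simp [scaledPoint, hn']
  · rintro ⟨hx, h⟩
    choose a ha using h
    have : scaledPoint n a = x := by
      funext i
      have := ha i
      simp only [algebraMap_int_eq, eq_intCast] at this
      simp [scaledPoint, this, hn']
    exact ⟨a, by simpa [this] using hx, this⟩

theorem finite_setOf_scaledPoint_mem {n : ℕ} (hn : 1 ≤ n) {s : Set (Fin d → ℝ)}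
    (hs : Bornology.IsBounded s) : {a | scaledPoint n a ∈ s}.Finite := by
  obtain ⟨R, hR⟩ := hs.exists_norm_le
  refine (Set.finite_Icc (fun _ => -⌈R * n⌉) (fun _ => ⌈R * n⌉)).subset fun a ha => ?_
  have hn' : (0 : ℝ) < n := by positivity
  have key : ∀ i, |a i| ≤ ⌈R * n⌉ := by
    intro i
    have h1 := (norm_le_pi_norm (scaledPoint n a) i).trans (hR _ ha)
    have h2 : ((|a i| : ℤ) : ℝ) ≤ R * n := by
      simp only [scaledPoint, Pi.smul_apply, smul_eq_mul, norm_mul, norm_inv,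
        Real.norm_eq_abs, Nat.abs_cast] at h1
      rw [inv_mul_le_iff₀ hn'] at h1
      push_cast
      linarith
    exact_mod_cast h2.trans (Int.le_ceil _)
  exact ⟨fun i => (abs_le.mp (key i)).1, fun i => (abs_le.mp (key i)).2⟩

theorem tendsto_ncard_div_pow_volume {s : Set (Fin d → ℝ)} (hs₁ : Bornology.IsBounded s)
    (hs₂ : MeasurableSet s) (hs₃ : volume (frontier s) = 0) :
    Tendsto (fun n : ℕ => ({a : Fin d → ℤ | scaledPoint n a ∈ s}.ncard : ℝ) / (n : ℝ) ^ d) atTop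
      (𝓝 (volume.real s)) := by
  refine (tendsto_card_div_pow_atTop_volume s hs₁ hs₂ hs₃).congr' ?_
  filter_upwards [eventually_ge_atTop 1] with n hn
  rw [← image_scaledPoint hn, Fintype.card_fin, Nat.card_coe_set_eq,
    Set.ncard_image_of_injective _ (scaledPoint_injective hn)]

theorem tendsto_sum_div_pow_integral {s : Set (Fin d → ℝ)} (hs₁ : Bornology.IsBounded s)
    (hs₂ : MeasurableSet s) (hs₃ : volume (frontier s) = 0) {f : (Fin d → ℝ) → ℝ}
    (hf : Continuous f) :
    Tendsto (fun n : ℕ => (∑ᶠ a ∈ {a : Fin d → ℤ | scaledPoint n a ∈ s}, f (scaledPoint n a)) /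
      (n : ℝ) ^ d) atTop (𝓝 (∫ x in s, f x)) := by
  refine (tendsto_tsum_div_pow_atTop_integral s f hf hs₁ hs₂ hs₃).congr' ?_
  filter_upwards [eventually_ge_atTop 1] with n hn
  have hfin := (finite_setOf_scaledPoint_mem hn hs₁).image (scaledPoint n)
  have := hfin.to_subtype
  rw [← image_scaledPoint hn, Fintype.card_fin, tsum_eq_finsum (Set.toFinite _),
    finsum_set_coe_eq_finsum_mem, finsum_mem_image (scaledPoint_injective hn).injOn]
  rfl

end LatticeCount

/-- A convex set with an interior point whose compact convex subsets have bounded volume is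
bounded. -/
theorem Convex.isBounded_of_volume_le {d : ℕ} {B : Set (Fin d → ℝ)} (hB : Convex ℝ B)
    (hcl : IsClosed B) (hne : (interior B).Nonempty) {C : ℝ}
    (hC : ∀ D ⊆ B, Convex ℝ D → IsCompact D → volume.real D ≤ C) : Bornology.IsBounded B := by
  obtain ⟨p, hp⟩ := hne
  obtain ⟨ε, hε, hpB⟩ := Metric.nhds_basis_closedBall.mem_iff.mp (mem_interior_iff_mem_nhds.mp hp)
  set v₀ := volume.real (Metric.ball (0 : Fin d → ℝ) (ε / 4)) with hv₀
  have hv₀pos : 0 < v₀ := by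
    rw [hv₀, measureReal_def]
    exact ENNReal.toReal_pos (Metric.measure_ball_pos _ _ (by positivity)).ne'
      measure_ball_lt_top.ne
  obtain ⟨N, hN⟩ := exists_nat_gt (C / v₀)
  rw [div_lt_iff₀ hv₀pos] at hN
  by_contra hunb
  obtain ⟨q, hq, hqp⟩ : ∃ q ∈ B, (N + 1) * ε < dist q p := by
    by_contra! h
    exact hunb ((Metric.isBounded_closedBall (x := p) (r := (N + 1) * ε)).subset
      fun x hx => Metric.mem_closedBall.mpr (h x hx))
  rw [dist_eq_norm] at hqp
  set R := ‖q - p‖ with hR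
  -- The centres lie on the half of the segment nearer to `p`. There the cone with apex `q` over the
  -- `ε`-ball at `p` still has radius at least `ε / 2`, so it contains the balls of radius `ε / 4`;
  -- and consecutive centres are more than `ε / 2` apart. Thus `N` disjoint balls of volume `v₀` fit
  -- into `B`, where `C < N * v₀`.
  let c : ℕ → (Fin d → ℝ) := fun j => p + ((j : ℝ) / (2 * (N + 1))) • (q - p)
  have hs : ∀ j < N, ((j : ℝ) / (2 * (N + 1))) ≤ 1 / 2 := by
    intro j hj
    have : (j : ℝ) < N := by exact_mod_cast hj
    rw [div_le_div_iff₀ (by positivity) (by norm_num)]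
    linarith
  have hcB : ∀ j < N, Metric.ball (c j) (ε / 4) ⊆ B := by
    intro j hj x hx
    set s : ℝ := (j : ℝ) / (2 * (N + 1)) with hsdef
    have hs0 : 0 ≤ s := by positivity
    have hs1 := hs j hj
    have h1s : (0 : ℝ) < 1 - s := by linarith
    have e : x = (1 - s) • (p + (1 - s)⁻¹ • (x - c j)) + s • q := by
      rw [smul_add, smul_inv_smul₀ h1s.ne']
      simp only [c, ← hsdef]
      module
    rw [e]
    refine hB (hpB ?_) hq h1s.le hs0 (by ring)
    rw [Metric.mem_closedBall, dist_eq_norm, add_sub_cancel_left, norm_smul, norm_inv,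
      Real.norm_of_nonneg h1s.le, inv_mul_le_iff₀ h1s]
    rw [Metric.mem_ball, dist_eq_norm] at hx
    nlinarith
  have hcR : ∀ j < N, Metric.ball (c j) (ε / 4) ⊆ Metric.closedBall p (R + ε) := by
    intro j hj x hx
    have hs1 := hs j hj
    have h0 : 0 ≤ (j : ℝ) / (2 * (N + 1)) := by positivity
    rw [Metric.mem_ball, dist_eq_norm] at hx
    rw [Metric.mem_closedBall, dist_eq_norm]
    have e : x - p = (x - c j) + ((j : ℝ) / (2 * (N + 1))) • (q - p) := by
      simp only [c]; abel
    rw [e]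
    refine (norm_add_le _ _).trans ?_
    rw [norm_smul, Real.norm_of_nonneg h0, ← hR]
    have : 0 ≤ R := norm_nonneg _
    nlinarith
  have hdisj : (↑(Finset.range N) : Set ℕ).PairwiseDisjoint
      fun j => Metric.ball (c j) (ε / 4) := by
    intro i _ j _ hij
    apply Metric.ball_disjoint_ball
    have e : c i - c j = (((i : ℝ) - j) / (2 * (N + 1))) • (q - p) := by
      simp only [c]; module
    have h1 : (1 : ℝ) ≤ |(i : ℝ) - j| := by
      have : (1 : ℤ) ≤ |(i : ℤ) - j| := Int.one_le_abs (by omega)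
      exact_mod_cast this
    rw [dist_eq_norm, e, norm_smul, Real.norm_eq_abs, abs_div,
      abs_of_pos (by positivity : (0 : ℝ) < 2 * (N + 1)), ← hR, div_mul_eq_mul_div,
      le_div_iff₀ (by positivity)]
    have : 0 ≤ R := norm_nonneg _
    nlinarith
  -- Cutting `B` by a large ball containing all the small balls makes it compact.
  have hle := hC (B ∩ Metric.closedBall p (R + ε)) Set.inter_subset_left
    (hB.inter (convex_closedBall _ _)) ((isCompact_closedBall _ _).inter_left hcl)
  have hsub : (⋃ j ∈ Finset.range N, Metric.ball (c j) (ε / 4)) ⊆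
      B ∩ Metric.closedBall p (R + ε) := by
    refine Set.iUnion₂_subset fun j hj => ?_
    rw [Finset.mem_range] at hj
    exact Set.subset_inter (hcB j hj) (hcR j hj)
  have hmono := measureReal_mono (μ := volume) hsub
    (((isCompact_closedBall _ _).inter_left hcl).measure_lt_top.ne)
  rw [measureReal_biUnion_finset hdisj (fun _ _ => measurableSet_ball)] at hmono
  have : ∀ j ∈ Finset.range N, volume.real (Metric.ball (c j) (ε / 4)) = v₀ := by
    intro j _
    rw [hv₀, measureReal_def, measureReal_def, Measure.addHaar_ball_center]
  rw [Finset.sum_congr rfl this, Finset.sum_const, Finset.card_range, nsmul_eq_mul] at hmono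
  linarith

/-! ### Asymptotic distribution of the points of the semigroup. -/

namespace IsLatticeSemigroup

variable {d : ℕ} {V : ℕ → Set (Fin d → ℤ)} (hV : IsLatticeSemigroup V)
include hV

/-- Shrinking `D` towards an interior point by a factor `t < 1` puts it into the interior, where all
lattice points of high level belong to the semigroup; the volume changes only by `t ^ d`. -/
theorem eventually_le_ncard_div (hfin : ∀ n ≥ 1, (V n).Finite) {D : Set (Fin d → ℝ)}
    (hD : Convex ℝ D) (hD' : IsCompact D) (hDV : D ⊆ semigroupBody V) {c : ℝ}
    (hc : c < volume.real D) :
    ∀ᶠ n : ℕ in atTop, c ≤ ((V n).ncard : ℝ) / (n : ℝ) ^ d := by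
  obtain ⟨p, hp⟩ := hV.interior_body_nonempty
  obtain ⟨t, ht, ht0, ht1⟩ : ∃ t : ℝ, c < t ^ d * volume.real D ∧ 0 < t ∧ t < 1 := by
    have h1 : Tendsto (fun t : ℝ => t ^ d * volume.real D) (𝓝[<] 1)
        (𝓝 (1 ^ d * volume.real D)) :=
      (Continuous.tendsto (by fun_prop) 1).mono_left nhdsWithin_le_nhds
    rw [one_pow, one_mul] at h1
    have h2 : ∀ᶠ t : ℝ in 𝓝[<] 1, t ∈ Set.Ioo (0 : ℝ) 1 := Ioo_mem_nhdsLT one_pos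
    obtain ⟨t, h3, h4⟩ := ((h1.eventually (lt_mem_nhds hc)).and h2).exists
    exact ⟨t, h3, h4.1, h4.2⟩
  set K := AffineMap.homothety p t '' D with hK
  have hKconv : Convex ℝ K := hD.affine_image _
  have hKcomp : IsCompact K := hD'.image (AffineMap.homothety_continuous p t)
  have hconv : Convex ℝ (semigroupBody V) := (convex_convexHull ℝ _).closure
  have hKV : K ⊆ interior (semigroupBody V) := by
    rintro _ ⟨x, hx, rfl⟩
    refine hconv.openSegment_interior_self_subset_interior hp (hDV hx) ?_
    rw [AffineMap.homothety_eq_lineMap, openSegment_eq_image_lineMap]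
    exact ⟨t, ⟨ht0, ht1⟩, rfl⟩
  have hvol : volume.real K = t ^ d * volume.real D := by
    rw [measureReal_def, hK, Measure.addHaar_image_homothety, ENNReal.toReal_mul,
      ENNReal.toReal_ofReal (abs_nonneg _), measureReal_def]
    simp [abs_of_pos (pow_pos ht0 d)]
  have hlim := tendsto_ncard_div_pow_volume hKcomp.isBounded hKcomp.measurableSet
    (hKconv.addHaar_frontier volume)
  rw [hvol] at hlim
  filter_upwards [hlim.eventually (lt_mem_nhds ht), hV.eventually_mem hKconv hKcomp hKV,
    eventually_ge_atTop 1] with n h1 h2 hn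
  refine h1.le.trans ?_
  gcongr
  · exact hfin n hn
  · exact fun a ha => h2 a ha

theorem volume_le_of_ncard_le (hfin : ∀ n ≥ 1, (V n).Finite) {C : ℝ}
    (hC : ∀ n : ℕ, 1 ≤ n → ((V n).ncard : ℝ) ≤ C * (n : ℝ) ^ d) {D : Set (Fin d → ℝ)}
    (hDV : D ⊆ semigroupBody V) (hD : Convex ℝ D) (hD' : IsCompact D) : volume.real D ≤ C := by
  refine le_of_forall_lt fun c hc => ?_
  obtain ⟨c', hcc', hc'⟩ := exists_between hc
  obtain ⟨n, h1, h2⟩ :=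
    ((hV.eventually_le_ncard_div hfin hD hD' hDV hc').and (eventually_ge_atTop 1)).exists
  have hn : (0 : ℝ) < (n : ℝ) ^ d := by positivity
  exact hcc'.trans_le (h1.trans ((div_le_iff₀ hn).mpr (hC n h2)))

/-- A compact convex subset of volume greater than `C` would force more than `C * n ^ d` points into
some slice, so the volumes are bounded and with them the body. -/
theorem isCompact_body (hfin : ∀ n ≥ 1, (V n).Finite) {C : ℝ}
    (hC : ∀ n : ℕ, 1 ≤ n → ((V n).ncard : ℝ) ≤ C * (n : ℝ) ^ d) :
    IsCompact (semigroupBody V) := by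
  refine Metric.isCompact_of_isClosed_isBounded isClosed_closure ?_
  exact Convex.isBounded_of_volume_le (convex_convexHull ℝ _).closure isClosed_closure
    hV.interior_body_nonempty fun D h1 h2 h3 => hV.volume_le_of_ncard_le hfin hC h1 h2 h3

omit hV in
theorem scaledPoint_mem_body {n : ℕ} (hn : 1 ≤ n) {a : Fin d → ℤ} (ha : a ∈ V n) :
    scaledPoint n a ∈ semigroupBody V :=
  subset_closure (subset_convexHull ℝ _ (Set.mem_iUnion₂_of_mem hn ⟨a, ha, rfl⟩))

/-- The number of points of the semigroup at level `n` is asymptotic to `n ^ d` times the volume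
of the body. -/
theorem tendsto_ncard_div (hfin : ∀ n ≥ 1, (V n).Finite)
    (hcomp : IsCompact (semigroupBody V)) :
    Tendsto (fun n : ℕ => ((V n).ncard : ℝ) / (n : ℝ) ^ d) atTop
      (𝓝 (volume.real (semigroupBody V))) := by
  have hconv : Convex ℝ (semigroupBody V) := (convex_convexHull ℝ _).closure
  have hlim := tendsto_ncard_div_pow_volume hcomp.isBounded hcomp.measurableSet
    (hconv.addHaar_frontier volume)
  refine tendsto_order.mpr ⟨fun c hc => ?_, fun c hc => ?_⟩
  · obtain ⟨c', hcc', hc'⟩ := exists_between hc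
    filter_upwards [hV.eventually_le_ncard_div hfin hconv hcomp subset_rfl hc'] with n hn
    exact hcc'.trans_le hn
  · filter_upwards [hlim.eventually (gt_mem_nhds hc), eventually_ge_atTop 1] with n h1 hn
    refine lt_of_le_of_lt ?_ h1
    gcongr
    · exact finite_setOf_scaledPoint_mem hn hcomp.isBounded
    · exact fun a ha => scaledPoint_mem_body hn ha

theorem volume_body_pos : 0 < volume (semigroupBody V) :=
  Measure.measure_pos_of_nonempty_interior _ hV.interior_body_nonempty

/-- The points of the semigroup are equidistributed in the body. -/
theorem tendsto_sum_div (hfin : ∀ n ≥ 1, (V n).Finite)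
    (hcomp : IsCompact (semigroupBody V)) {f : (Fin d → ℝ) → ℝ} (hf : Continuous f) :
    Tendsto (fun n : ℕ => (∑ᶠ a ∈ V n, f (scaledPoint n a)) / (n : ℝ) ^ d) atTop
      (𝓝 (∫ x in semigroupBody V, f x)) := by
  have hconv : Convex ℝ (semigroupBody V) := (convex_convexHull ℝ _).closure
  have hfront := hconv.addHaar_frontier volume
  have hlim := tendsto_sum_div_pow_integral hcomp.isBounded hcomp.measurableSet hfront hf
  obtain ⟨M, hM⟩ := hcomp.exists_bound_of_continuousOn hf.continuousOn
  -- The sum over `V n` differs from the sum over all lattice points of the body by `o(n ^ d)`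
  -- terms, each bounded by `M`.
  have h0 : Tendsto (fun n : ℕ =>
      M * (({a : Fin d → ℤ | scaledPoint n a ∈ semigroupBody V}.ncard : ℝ)
      / (n : ℝ) ^ d - ((V n).ncard : ℝ) / (n : ℝ) ^ d)) atTop (𝓝 0) := by
    have := ((tendsto_ncard_div_pow_volume hcomp.isBounded hcomp.measurableSet hfront).sub
      (hV.tendsto_ncard_div hfin hcomp)).const_mul M
    simpa using this
  refine (tendsto_iff_of_dist (squeeze_zero' (Eventually.of_forall fun n => dist_nonneg)
    ?_ h0)).mp hlim
  filter_upwards [eventually_ge_atTop 1] with n hn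
  have hfin' := finite_setOf_scaledPoint_mem (d := d) hn hcomp.isBounded
  have hsub : V n ⊆ {a : Fin d → ℤ | scaledPoint n a ∈ semigroupBody V} :=
    fun a ha => scaledPoint_mem_body hn ha
  have hpos : (0 : ℝ) < (n : ℝ) ^ d := by positivity
  rw [dist_eq_norm, ← sub_div, ← sub_div, norm_div, Real.norm_of_nonneg hpos.le, ← mul_div_assoc]
  gcongr ?_ / _
  refine (congrArg norm (sub_eq_of_eq_add' (finsum_mem_add_sdiff
    (f := fun a => f (scaledPoint n a)) hsub hfin').symm)).trans_le ?_
  rw [finsum_mem_eq_finite_toFinset_sum _ hfin'.sdiff]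
  refine (norm_sum_le_of_le (n := fun _ => M) _ fun a ha => ?_).trans ?_
  · rw [Set.Finite.mem_toFinset] at ha
    exact hM _ ha.1
  · rw [Finset.sum_const, ← Set.ncard_eq_toFinset_card _ hfin'.sdiff, nsmul_eq_mul, mul_comm,
      Set.ncard_sdiff hsub (hfin n hn), Nat.cast_sub (Set.ncard_le_ncard hsub hfin')]

end IsLatticeSemigroup

/-! ### Additive valuations on a field and the group values of its elements. -/

section ValuationBasics

variable {k K Γ : Type*} [Field k] [Field K] [Algebra k K]
  [AddCommGroup Γ] [LinearOrder Γ] [IsOrderedAddMonoid Γ]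

namespace AddValuation

variable (v : AddValuation K (WithTop Γ))

/-- The value of a nonzero element, as an element of the group. -/
noncomputable def val (x : K) : Γ := (v x).untopD 0

variable {v}

theorem coe_val {x : K} (hx : x ≠ 0) : (v.val x : WithTop Γ) = v x := by
  have : v x ≠ ⊤ := (AddValuation.ne_top_iff v).mpr hx
  obtain ⟨γ, hγ⟩ := WithTop.ne_top_iff_exists.mp this
  rw [val, ← hγ, WithTop.untopD_coe]

theorem val_eq_of_eq_coe {x : K} {γ : Γ} (h : v x = γ) : v.val x = γ := by
  rw [val, h, WithTop.untopD_coe]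

theorem ne_zero_of_eq_coe {x : K} {γ : Γ} (h : v x = γ) : x ≠ 0 := by
  rintro rfl
  rw [map_zero] at h
  exact WithTop.top_ne_coe h

theorem val_one : v.val 1 = 0 := val_eq_of_eq_coe (by simp)

theorem val_mul {x y : K} (hx : x ≠ 0) (hy : y ≠ 0) : v.val (x * y) = v.val x + v.val y :=
  val_eq_of_eq_coe (by rw [map_mul, ← coe_val hx, ← coe_val hy, WithTop.coe_add])

theorem val_inv {x : K} (hx : x ≠ 0) : v.val x⁻¹ = -v.val x := by
  have := val_mul (v := v) hx (inv_ne_zero hx)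
  rw [mul_inv_cancel₀ hx, val_one] at this
  exact (neg_eq_of_add_eq_zero_right this.symm).symm

theorem val_div {x y : K} (hx : x ≠ 0) (hy : y ≠ 0) : v.val (x / y) = v.val x - v.val y := by
  rw [div_eq_mul_inv, val_mul hx (inv_ne_zero hy), val_inv hy, sub_eq_add_neg]

theorem val_pow {x : K} (hx : x ≠ 0) (n : ℕ) : v.val (x ^ n) = n • v.val x := by
  induction n with
  | zero => simp [val_one]
  | succ n ih => rw [pow_succ, val_mul (pow_ne_zero n hx) hx, ih, succ_nsmul]

theorem val_zpow {x : K} (hx : x ≠ 0) (n : ℤ) : v.val (x ^ n) = n • v.val x := by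
  cases n with
  | ofNat n => simpa using val_pow hx n
  | negSucc n =>
    rw [zpow_negSucc, val_inv (pow_ne_zero _ hx), val_pow hx, negSucc_zsmul]

theorem val_prod {ι : Type*} (s : Finset ι) {x : ι → K} (hx : ∀ i ∈ s, x i ≠ 0) :
    v.val (∏ i ∈ s, x i) = ∑ i ∈ s, v.val (x i) := by
  classical
  induction s using Finset.induction_on with
  | empty => simp [val_one]
  | insert i s hi ih =>
    rw [Finset.prod_insert hi, Finset.sum_insert hi, val_mul (hx i (Finset.mem_insert_self _ _))
      (Finset.prod_ne_zero_iff.mpr fun j hj => hx j (Finset.mem_insert_of_mem hj)),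
      ih fun j hj => hx j (Finset.mem_insert_of_mem hj)]

theorem val_mem_valueGroup (x : K) : v.val x ∈ valueGroup v := by
  -- The default value of `val` at zero is `0`, which lies in the group.
  by_cases hx : x = 0
  · rw [hx, val, map_zero, WithTop.untopD_top]
    exact zero_mem _
  · exact ⟨x, (coe_val hx).symm⟩

theorem val_lt_val {x y : K} (hx : x ≠ 0) (hy : y ≠ 0) : v.val x < v.val y ↔ v x < v y := by
  rw [← coe_val hx, ← coe_val hy, WithTop.coe_lt_coe]

theorem val_eq_val {x y : K} (hx : x ≠ 0) (hy : y ≠ 0) : v.val x = v.val y ↔ v x = v y := by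
  rw [← coe_val hx, ← coe_val hy, WithTop.coe_inj]

/-- In a vanishing sum of nonzero elements, two terms have the same value. -/
theorem exists_eq_of_sum_eq_zero {ι : Type*} {s : Finset ι} {f : ι → K} (hs : s.Nonempty)
    (hf : ∀ i ∈ s, f i ≠ 0) (h : ∑ i ∈ s, f i = 0) :
    ∃ i ∈ s, ∃ j ∈ s, i ≠ j ∧ v (f i) = v (f j) := by
  classical
  by_contra! hne
  obtain ⟨i, hi, hmin⟩ := s.exists_min_image (fun i => v (f i)) hs
  have h1 : f i = -∑ j ∈ s.erase i, f j := by
    rw [← Finset.add_sum_erase s f hi] at h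
    exact eq_neg_of_add_eq_zero_left h
  have h2 : v (f i) < v (∑ j ∈ s.erase i, f j) := by
    refine map_lt_sum' v (lt_top_iff_ne_top.mpr ((ne_top_iff v).mpr (hf i hi))) fun j hj => ?_
    rw [Finset.mem_erase] at hj
    exact lt_of_le_of_ne (hmin j hj.2) (hne i hi j hj.2 hj.1.symm)
  rw [h1, map_neg] at h2
  exact lt_irrefl _ h2

/-- `v` is trivial on the constants. -/
def TrivialOn (k : Type*) [Field k] [Algebra k K] (v : AddValuation K (WithTop Γ)) : Prop :=
  ∀ c : k, c ≠ 0 → v (algebraMap k K c) = 0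

theorem TrivialOn.le_map_smul (hk : TrivialOn k v) (c : k) (x : K) : v x ≤ v (c • x) := by
  by_cases hc : c = 0
  · simp [hc]
  · rw [Algebra.smul_def, map_mul, hk c hc, zero_add]

theorem TrivialOn.map_smul (hk : TrivialOn k v) {c : k} (hc : c ≠ 0) (x : K) :
    v (c • x) = v x := by
  rw [Algebra.smul_def, map_mul, hk c hc, zero_add]

end AddValuation

/-! ### Spaces of functions and their sets of values -/

namespace AddValuation

variable {v : AddValuation K (WithTop Γ)}

/-- The elements of `S` of value more than `γ`. -/
def gtSubmodule (hk : TrivialOn k v) (S : Submodule k K) (γ : Γ) : Submodule k K where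
  carrier := {x | x ∈ S ∧ (γ : WithTop Γ) < v x}
  add_mem' := fun hx hy => ⟨S.add_mem hx.1 hy.1, map_lt_add v hx.2 hy.2⟩
  zero_mem' := ⟨S.zero_mem, by simp⟩
  smul_mem' := fun c x hx => ⟨S.smul_mem c hx.1, hx.2.trans_le (hk.le_map_smul c x)⟩

variable (v) in
/-- The set `v(S ∖ 0)`. -/
def values (S : Submodule k K) : Set Γ := {γ | ∃ x ∈ S, v x = γ}

variable (v) in
/-- All nonzero elements of `W` have the value `γ`. -/
def IsLeaf (W : Submodule k K) (γ : Γ) : Prop := ∀ w ∈ W, w ≠ 0 → v w = γ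

/-- Induct on the number of values. A complement in `S` of the elements whose value exceeds the
minimum is a leaf of dimension at most `l`, and removing it removes exactly one value. -/
theorem rank_le_mul_card_values (hk : TrivialOn k v) {l : ℕ} (n : ℕ) :
    ∀ S : Submodule k K, (∀ W ≤ S, ∀ γ, IsLeaf v W γ → Module.rank k W ≤ l) →
      (values v S).Finite → (values v S).ncard = n → Module.rank k S ≤ (l * n : ℕ) := by
  induction n with
  | zero =>
    intro S _ hfin hcard
    rw [Set.ncard_eq_zero hfin] at hcard
    have : S = ⊥ := by
      rw [Submodule.eq_bot_iff]
      intro x hx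
      by_contra h0
      have : v.val x ∈ values v S := ⟨x, hx, (coe_val h0).symm⟩
      rw [hcard] at this
      exact this
    subst this
    simp
  | succ n ih =>
    intro S hl hfin hcard
    have hne : (values v S).Nonempty := Set.nonempty_of_ncard_ne_zero (by omega)
    obtain ⟨γ, hγ, hmin⟩ := Set.exists_min_image (values v S) id hfin hne
    obtain ⟨C, hC⟩ := Submodule.exists_isCompl (gtSubmodule hk S γ)
    have hle : gtSubmodule hk S γ ≤ S := fun x hx => hx.1
    have hleaf : IsLeaf v (C ⊓ S) γ := by
      intro w hw hw0
      have h1 : v.val w ∈ values v S := ⟨w, hw.2, (coe_val hw0).symm⟩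
      have h2 := hmin _ h1
      rw [← coe_val hw0, WithTop.coe_inj]
      by_contra hne'
      have h3 : w ∈ gtSubmodule hk S γ := by
        refine ⟨hw.2, ?_⟩
        rw [← coe_val hw0, WithTop.coe_lt_coe]
        exact lt_of_le_of_ne h2 (Ne.symm hne')
      exact hw0 (Submodule.disjoint_def.mp hC.disjoint w h3 hw.1)
    have hval : values v (gtSubmodule hk S γ) = values v S \ {γ} := by
      ext δ
      constructor
      · rintro ⟨x, hx, hxδ⟩
        refine ⟨⟨x, hx.1, hxδ⟩, ?_⟩
        rintro rfl
        have := hx.2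
        rw [hxδ] at this
        exact lt_irrefl _ this
      · rintro ⟨⟨x, hx, hxδ⟩, hne'⟩
        refine ⟨x, ⟨hx, ?_⟩, hxδ⟩
        rw [hxδ, WithTop.coe_lt_coe]
        exact lt_of_le_of_ne (hmin δ ⟨x, hx, hxδ⟩) (Ne.symm hne')
    have h1 := ih (gtSubmodule hk S γ) (fun W hW => hl W (hW.trans hle))
      (hval ▸ hfin.sdiff) (by rw [hval, Set.ncard_sdiff_singleton_of_mem hγ, hcard]; rfl)
    have h2 := hl (C ⊓ S) inf_le_right γ hleaf
    have h3 : gtSubmodule hk S γ ⊔ C ⊓ S = S := by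
      rw [← sup_inf_assoc_of_le C hle, hC.sup_eq_top, top_inf_eq]
    calc Module.rank k S = Module.rank k ↥(gtSubmodule hk S γ ⊔ C ⊓ S) := by rw [h3]
      _ ≤ _ := Submodule.rank_add_le_rank_add_rank _ _
      _ ≤ (l * n : ℕ) + l := add_le_add h1 h2
      _ = _ := by push_cast; ring

theorem finite_and_finrank_le_mul_ncard_values (hk : TrivialOn k v) {l : ℕ} {S : Submodule k K}
    (hl : ∀ W ≤ S, ∀ γ, IsLeaf v W γ → Module.rank k W ≤ l) (hfin : (values v S).Finite) :
    Module.Finite k S ∧ Module.finrank k S ≤ l * (values v S).ncard := by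
  have h := rank_le_mul_card_values hk _ S hl hfin rfl
  exact ⟨Module.rank_lt_aleph0_iff.mp (h.trans_lt (Cardinal.natCast_lt_aleph0)),
    Module.finrank_le_of_rank_le h⟩

/-- Choose `f a` in `S` of value `a`. The map sending `(w a)` to the sum of the `f a * w a` is
injective, because its nonzero terms have the pairwise distinct values `a + γ`. -/
theorem mul_card_le_finrank {S T W : Submodule k K} {γ : Γ} [Module.Finite k T]
    [Module.Finite k W] (hW : IsLeaf v W γ) (hmul : ∀ f ∈ S, ∀ w ∈ W, f * w ∈ T)
    (A : Finset Γ) (hA : ↑A ⊆ values v S) :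
    Module.finrank k W * A.card ≤ Module.finrank k T := by
  have hA' : ∀ a : A, ∃ x ∈ S, v x = (a : Γ) := fun a => hA a.2
  choose f hf hfv using hA'
  let ψ : (A → W) →ₗ[k] T := LinearMap.codRestrict T
    (∑ a : A, (LinearMap.mulLeft k (f a)) ∘ₗ W.subtype ∘ₗ LinearMap.proj a) (by
      intro w
      simp only [LinearMap.sum_apply, LinearMap.comp_apply, LinearMap.mulLeft_apply]
      exact T.sum_mem fun a _ => hmul _ (hf a) _ (w a).2)
  have hψ : ∀ w, (ψ w : K) = ∑ a : A, f a * (w a : K) := by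
    intro w
    simp [ψ, LinearMap.sum_apply]
  have hinj : Function.Injective ψ := by
    rw [← LinearMap.ker_eq_bot, LinearMap.ker_eq_bot']
    intro w hw
    classical
    by_contra hne
    have h0 : ∑ a ∈ Finset.univ.filter (fun a : A => w a ≠ 0), f a * (w a : K) = 0 := by
      rw [Finset.sum_filter_of_ne, ← hψ, hw]
      · rfl
      · intro a _ h
        contrapose! h
        simp [h]
    obtain ⟨a₀, ha₀⟩ := Function.ne_iff.mp hne
    obtain ⟨a, ha, b, hb, hab, h⟩ := exists_eq_of_sum_eq_zero (v := v) ⟨a₀, by simpa using ha₀⟩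
      (by
        intro a ha
        rw [Finset.mem_filter] at ha
        exact mul_ne_zero (ne_zero_of_eq_coe (hfv a)) (by simpa using ha.2)) h0
    rw [Finset.mem_filter] at ha hb
    rw [map_mul, map_mul, hfv, hfv, hW _ (w a).2 (by simpa using ha.2),
      hW _ (w b).2 (by simpa using hb.2), ← WithTop.coe_add, ← WithTop.coe_add, WithTop.coe_inj,
      add_left_inj] at h
    exact hab (Subtype.ext h)
  have := LinearMap.finrank_le_finrank_of_injective hinj
  rw [Module.finrank_pi_fintype, Finset.sum_const, Finset.card_univ, Fintype.card_coe,
    smul_eq_mul, mul_comm] at this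
  exact this

/-- The constants form a one-dimensional leaf that multiplies `S` into itself. -/
theorem finite_values_and_ncard_le (S : Submodule k K) [Module.Finite k S]
    (hk : TrivialOn k v) : (values v S).Finite ∧ (values v S).ncard ≤ Module.finrank k S := by
  have hleaf : IsLeaf v (k ∙ (1 : K)) (0 : Γ) := by
    intro w hw hw0
    obtain ⟨c, rfl⟩ := Submodule.mem_span_singleton.mp hw
    have hc : c ≠ 0 := by rintro rfl; simp at hw0
    rw [hk.map_smul hc, map_one, WithTop.coe_zero]
  have key : ∀ A : Finset Γ, ↑A ⊆ values v S → A.card ≤ Module.finrank k S := by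
    intro A hA
    have := mul_card_le_finrank (S := S) (T := S) hleaf (by
      intro f hf w hw
      obtain ⟨c, rfl⟩ := Submodule.mem_span_singleton.mp hw
      simpa using S.smul_mem c hf) A hA
    rwa [finrank_span_singleton one_ne_zero, one_mul] at this
  have hfin : (values v S).Finite := by
    by_contra hinf
    obtain ⟨A, hA, hcard⟩ := Set.Infinite.exists_subset_card_eq hinf (Module.finrank k S + 1)
    have := key A hA
    omega
  refine ⟨hfin, ?_⟩
  rw [Set.ncard_eq_toFinset_card _ hfin]
  exact key _ (by simp)

end AddValuation

end ValuationBasics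

/-! ### Leading monomials in elements with independent values. -/

section Monomial

variable {k K Γ : Type*} [Field k] [Field K] [Algebra k K]
  [AddCommGroup Γ] [LinearOrder Γ] [IsOrderedAddMonoid Γ]

namespace AddValuation

/-- The Laurent monomial with exponents `e`. -/
def monomialAt {ι : Type*} [Fintype ι] (x : ι → K) (e : ι → ℤ) : K := ∏ i, x i ^ e i

variable {v : AddValuation K (WithTop Γ)} {ι : Type*} [Fintype ι] {x : ι → K}

theorem monomialAt_ne_zero (hx : ∀ i, x i ≠ 0) (e : ι → ℤ) : monomialAt x e ≠ 0 :=
  Finset.prod_ne_zero_iff.mpr fun i _ => zpow_ne_zero _ (hx i)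

theorem monomialAt_zero : monomialAt x 0 = 1 := by simp [monomialAt]

theorem monomialAt_sub (hx : ∀ i, x i ≠ 0) (e e' : ι → ℤ) :
    monomialAt x (e - e') = monomialAt x e / monomialAt x e' := by
  simp only [monomialAt, Pi.sub_apply, ← Finset.prod_div_distrib]
  exact Finset.prod_congr rfl fun i _ => zpow_sub₀ (hx i) _ _

theorem val_monomialAt (hx : ∀ i, x i ≠ 0) (e : ι → ℤ) :
    v.val (monomialAt x e) = ∑ i, e i • v.val (x i) := by
  rw [monomialAt, val_prod _ fun i _ => zpow_ne_zero _ (hx i)]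
  exact Finset.sum_congr rfl fun i _ => val_zpow (hx i) _

theorem val_monomialAt_injective (hx : ∀ i, x i ≠ 0)
    (hlin : LinearIndependent ℤ fun i => v.val (x i)) {e e' : ι → ℤ}
    (h : v.val (monomialAt x e) = v.val (monomialAt x e')) : e = e' := by
  rw [val_monomialAt hx, val_monomialAt hx] at h
  funext i
  refine sub_eq_zero.mp (Fintype.linearIndependent_iff.mp hlin (fun i => e i - e' i) ?_ i)
  simp [sub_smul, h]

/-- The element `a` is the sum of `c` times a monomial and of an element of larger value. -/
def HasLeadingTerm (v : AddValuation K (WithTop Γ)) (x : ι → K) (a : K) (c : k) (e : ι → ℤ) :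
    Prop :=
  c ≠ 0 ∧ v (monomialAt x e) < v (a - c • monomialAt x e)

namespace HasLeadingTerm

theorem map_eq (hk : TrivialOn k v) {a : K} {c : k} {e : ι → ℤ} (h : HasLeadingTerm v x a c e) :
    v a = v (monomialAt x e) := by
  rw [← hk.map_smul h.1 (monomialAt x e)]
  exact map_eq_of_lt_sub v (by rw [hk.map_smul h.1]; exact h.2)

theorem ne_zero (hk : TrivialOn k v) (hx : ∀ i, x i ≠ 0) {a : K} {c : k} {e : ι → ℤ}
    (h : HasLeadingTerm v x a c e) : a ≠ 0 := by
  rw [← ne_top_iff v, h.map_eq hk, ne_top_iff]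
  exact monomialAt_ne_zero hx e

theorem val_eq (hk : TrivialOn k v) (hx : ∀ i, x i ≠ 0) {a : K} {c : k} {e : ι → ℤ}
    (h : HasLeadingTerm v x a c e) : v.val a = v.val (monomialAt x e) :=
  (val_eq_val (h.ne_zero hk hx) (monomialAt_ne_zero hx e)).mpr (h.map_eq hk)

theorem div (hk : TrivialOn k v) (hx : ∀ i, x i ≠ 0) {a b : K} {c c' : k} {e e' : ι → ℤ}
    (h : HasLeadingTerm v x a c e) (h' : HasLeadingTerm v x b c' e') :
    HasLeadingTerm v x (a / b) (c / c') (e - e') := by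
  refine ⟨div_ne_zero h.1 h'.1, ?_⟩
  have hb := h'.ne_zero hk hx
  have hm' := monomialAt_ne_zero hx e'
  have hc' : algebraMap k K c' ≠ 0 := by simpa using h'.1
  have hbm : v b = v (monomialAt x e') := h'.map_eq hk
  -- After multiplication by `b` the error is a difference of two terms, each of value greater than
  -- that of the monomial `e`; cancelling the value of `b` leaves the monomial `e - e'`.
  have e1 : (a / b - (c / c') • monomialAt x (e - e')) * b = (a - c • monomialAt x e) -
      (c / c') • (monomialAt x (e - e') * (b - c' • monomialAt x e')) := by
    rw [monomialAt_sub hx]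
    simp only [Algebra.smul_def, map_div₀]
    field_simp
    ring
  have e2 : monomialAt x e = monomialAt x (e - e') * monomialAt x e' := by
    rw [monomialAt_sub hx, div_mul_cancel₀ _ hm']
  have h1 : v (monomialAt x e) <
      v ((a / b - (c / c') • monomialAt x (e - e')) * b) := by
    rw [e1]
    refine lt_of_lt_of_le (lt_min h.2 ?_) (map_sub v _ _)
    rw [hk.map_smul (div_ne_zero h.1 h'.1), map_mul]
    conv_lhs => rw [e2, map_mul]
    have h3 := monomialAt_ne_zero hx (e - e')
    rw [← coe_val h3]
    exact WithTop.add_lt_add_left WithTop.coe_ne_top h'.2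
  rw [map_mul, e2, map_mul, hbm] at h1
  exact lt_of_add_lt_add_right h1

end HasLeadingTerm

theorem monomialAt_natCast (m : ι →₀ ℕ) : monomialAt x (fun i => (m i : ℤ)) = ∏ i, x i ^ m i := by
  simp [monomialAt]

/-- A nonzero polynomial in `x` has a leading term, with natural exponents. -/
theorem exists_hasLeadingTerm_aeval (hk : TrivialOn k v) (hx : ∀ i, x i ≠ 0)
    (hlin : LinearIndependent ℤ fun i => v.val (x i)) {p : MvPolynomial ι k} (hp : p ≠ 0) :
    ∃ (c : k) (m : ι →₀ ℕ), HasLeadingTerm v x (MvPolynomial.aeval x p) c (fun i => (m i : ℤ)) := by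
  classical
  have hne : p.support.Nonempty := by
    rwa [Finset.nonempty_iff_ne_empty, Ne, MvPolynomial.support_eq_empty]
  obtain ⟨m, hm, hmin⟩ := p.support.exists_min_image
    (fun m => v.val (monomialAt x (fun i => (m i : ℤ)))) hne
  refine ⟨p.coeff m, m, MvPolynomial.mem_support_iff.mp hm, ?_⟩
  have hmon : ∀ m : ι →₀ ℕ, monomialAt x (fun i => (m i : ℤ)) ≠ 0 :=
    fun m => monomialAt_ne_zero hx _
  have hsum : MvPolynomial.aeval x p =
      ∑ m ∈ p.support, p.coeff m • monomialAt x (fun i => (m i : ℤ)) := by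
    rw [MvPolynomial.aeval_def, MvPolynomial.eval₂_eq']
    exact Finset.sum_congr rfl fun m _ => by rw [monomialAt_natCast, Algebra.smul_def]
  rw [hsum, ← Finset.add_sum_erase _ _ hm, add_sub_cancel_left]
  refine map_lt_sum' v (lt_top_iff_ne_top.mpr ((ne_top_iff v).mpr (hmon m))) fun m' hm' => ?_
  rw [Finset.mem_erase] at hm'
  rw [hk.map_smul (MvPolynomial.mem_support_iff.mp hm'.2), ← val_lt_val (hmon m) (hmon m')]
  refine lt_of_le_of_ne (hmin m' hm'.2) fun h => hm'.1 ?_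
  have := val_monomialAt_injective hx hlin h
  ext i
  exact_mod_cast (congrFun this i).symm

/-- A nonzero polynomial in `x` has the finite value of its leading monomial, so it cannot vanish.
-/
theorem algebraicIndependent_of_linearIndependent (hk : TrivialOn k v) (hx : ∀ i, x i ≠ 0)
    (hlin : LinearIndependent ℤ fun i => v.val (x i)) : AlgebraicIndependent k x := by
  rw [algebraicIndependent_iff_injective_aeval, injective_iff_map_eq_zero]
  intro p hp
  by_contra h
  obtain ⟨c, m, hc⟩ := exists_hasLeadingTerm_aeval hk hx hlin h
  exact hc.ne_zero hk hx hp

/-- The nonzero elements of `k(x)` have leading terms. -/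
theorem exists_hasLeadingTerm (hk : TrivialOn k v) (hx : ∀ i, x i ≠ 0)
    (hlin : LinearIndependent ℤ fun i => v.val (x i)) {a : K}
    (ha : a ∈ IntermediateField.adjoin k (Set.range x)) (ha0 : a ≠ 0) :
    ∃ (c : k) (e : ι → ℤ), HasLeadingTerm v x a c e := by
  obtain ⟨p, q, rfl⟩ := (IntermediateField.mem_adjoin_range_iff k x a).mp ha
  have hp : p ≠ 0 := by rintro rfl; simp at ha0
  have hq : q ≠ 0 := by rintro rfl; simp at ha0
  obtain ⟨c, m, h⟩ := exists_hasLeadingTerm_aeval hk hx hlin hp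
  obtain ⟨c', m', h'⟩ := exists_hasLeadingTerm_aeval hk hx hlin hq
  exact ⟨_, _, h.div hk hx h'⟩

/-- The nonzero elements of `k[x]` have as values natural combinations of those of `x`. -/
theorem exists_val_eq_of_mem_adjoin (hk : TrivialOn k v) (hx : ∀ i, x i ≠ 0)
    (hlin : LinearIndependent ℤ fun i => v.val (x i)) {a : K}
    (ha : a ∈ Algebra.adjoin k (Set.range x)) (ha0 : a ≠ 0) :
    ∃ e : ι → ℤ, (∀ i, 0 ≤ e i) ∧ v.val a = ∑ i, e i • v.val (x i) := by
  rw [Algebra.adjoin_range_eq_range_aeval] at ha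
  obtain ⟨p, rfl⟩ := ha
  have hp : p ≠ 0 := by rintro rfl; simp at ha0
  obtain ⟨c, m, h⟩ := exists_hasLeadingTerm_aeval hk hx hlin hp
  exact ⟨_, fun i => Int.natCast_nonneg (m i), (h.val_eq hk hx).trans (val_monomialAt hx _)⟩

theorem exists_val_eq_of_mem_field_adjoin (hk : TrivialOn k v) (hx : ∀ i, x i ≠ 0)
    (hlin : LinearIndependent ℤ fun i => v.val (x i)) {a : K}
    (ha : a ∈ IntermediateField.adjoin k (Set.range x)) (ha0 : a ≠ 0) :
    ∃ e : ι → ℤ, v.val a = ∑ i, e i • v.val (x i) := by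
  obtain ⟨c, e, h⟩ := exists_hasLeadingTerm hk hx hlin ha ha0
  exact ⟨e, (h.val_eq hk hx).trans (val_monomialAt hx _)⟩

/-- The residue field of `k(x)` is `k`. -/
theorem exists_pos_sub_algebraMap (hk : TrivialOn k v) (hx : ∀ i, x i ≠ 0)
    (hlin : LinearIndependent ℤ fun i => v.val (x i)) {a : K}
    (ha : a ∈ IntermediateField.adjoin k (Set.range x)) (hv : 0 ≤ v a) :
    ∃ c : k, 0 < v (a - algebraMap k K c) := by
  rcases hv.lt_or_eq with h | h
  · exact ⟨0, by simpa using h⟩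
  · have ha0 : a ≠ 0 := by
      rw [← ne_top_iff v, ← h]
      exact WithTop.zero_ne_top
    obtain ⟨c, e, h1⟩ := exists_hasLeadingTerm hk hx hlin ha ha0
    have he : e = 0 := by
      apply val_monomialAt_injective (v := v) hx hlin
      rw [val_eq_val (monomialAt_ne_zero hx _) (monomialAt_ne_zero hx _), ← h1.map_eq hk, ← h,
        monomialAt_zero, map_one]
    subst he
    refine ⟨c, ?_⟩
    have := h1.2
    rwa [monomialAt_zero, map_one, Algebra.smul_def, mul_one] at this

/-- A space whose nonzero elements all have the same value has dimension at most `[K : k(x)]`. -/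
theorem rank_le_of_isLeaf (hk : TrivialOn k v) (hx : ∀ i, x i ≠ 0)
    (hlin : LinearIndependent ℤ fun i => v.val (x i))
    [FiniteDimensional (IntermediateField.adjoin k (Set.range x)) K] {W : Submodule k K} {γ : Γ}
    (hW : IsLeaf v W γ) :
    Module.rank k W ≤ Module.finrank (IntermediateField.adjoin k (Set.range x)) K := by
  refine rank_le fun s hs => ?_
  have hL : LinearIndependent (IntermediateField.adjoin k (Set.range x))
      fun i : s => ((i : W) : K) := by
    rw [Fintype.linearIndependent_iff]
    intro a ha
    by_contra! hne
    obtain ⟨i₁, hi₁⟩ := hne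
    -- Normalize a relation over `k(x)` by a coefficient of least value and replace the coefficients
    -- by their residues `c i` in `k`. The combination of the vectors with coefficients `c i` is
    -- nonzero, as `c i₀ ≠ 0`, but it has value greater than `γ`.
    obtain ⟨i₀, -, hmin⟩ := Finset.univ.exists_min_image (fun i => v (a i : K))
      ⟨i₁, Finset.mem_univ _⟩
    have ha₀ : (a i₀ : K) ≠ 0 := by
      rw [← ne_top_iff v, ← lt_top_iff_ne_top]
      refine (hmin i₁ (Finset.mem_univ _)).trans_lt (lt_top_iff_ne_top.mpr ?_)
      rw [ne_top_iff]
      simpa using hi₁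
    have hb : ∀ i, 0 ≤ v ((a i / a i₀ : IntermediateField.adjoin k (Set.range x)) : K) := by
      intro i
      by_cases hi : (a i : K) = 0
      · have : (a i / a i₀ : IntermediateField.adjoin k (Set.range x)) = 0 := by
          rw [ZeroMemClass.coe_eq_zero.mp hi, zero_div]
        rw [this]
        simp
      · have h1 := hmin i (Finset.mem_univ _)
        rw [← coe_val hi, ← coe_val ha₀, WithTop.coe_le_coe] at h1
        have h2 : (a i / a i₀ : K) ≠ 0 := div_ne_zero hi ha₀
        rw [IntermediateField.coe_div, ← coe_val h2, val_div hi ha₀, ← WithTop.coe_zero,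
          WithTop.coe_le_coe]
        exact sub_nonneg.mpr h1
    choose c hc using fun i => exists_pos_sub_algebraMap hk hx hlin
      (a i / a i₀ : IntermediateField.adjoin k (Set.range x)).2 (hb i)
    have hc₀ : c i₀ ≠ 0 := by
      intro h0
      have := hc i₀
      rw [h0, _root_.map_zero, sub_zero, IntermediateField.coe_div, div_self ha₀, map_one] at this
      exact lt_irrefl _ this
    have hy : ∑ i, c i • (i : W) ≠ 0 := by
      intro h
      exact hc₀ (Fintype.linearIndependent_iff.mp hs c h i₀)
    have hyv := hW _ (∑ i, c i • (i : W)).2 (by rwa [Ne, ZeroMemClass.coe_eq_zero])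
    have hne : ∀ i : s, ((i : W) : K) ≠ 0 := by
      intro i
      have := hs.ne_zero i
      simpa using this
    have hsum : ((∑ i, c i • (i : W) : W) : K) = -∑ i,
        (((a i / a i₀ : IntermediateField.adjoin k (Set.range x)) : K) -
          algebraMap k K (c i)) * ((i : W) : K) := by
      have h1 : ∑ i, ((a i / a i₀ : IntermediateField.adjoin k (Set.range x)) : K) *
          ((i : W) : K) = 0 := by
        have : ∑ i, (a i : K) * ((i : W) : K) = 0 := by
          simpa [Algebra.smul_def, IntermediateField.algebraMap_apply] using ha
        simp only [IntermediateField.coe_div, div_mul_eq_mul_div, ← Finset.sum_div, this,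
          zero_div]
      simp only [sub_mul, Finset.sum_sub_distrib, h1, zero_sub, neg_neg,
        AddSubmonoidClass.coe_finsetSum, Submodule.coe_smul, Algebra.smul_def]
    rw [hsum, map_neg] at hyv
    refine absurd hyv (ne_of_gt ?_)
    refine map_lt_sum' v (WithTop.coe_lt_top γ) fun i _ => ?_
    rw [map_mul, hW _ (i : W).2 (hne i)]
    calc (γ : WithTop Γ) = 0 + γ := (zero_add _).symm
      _ < _ := WithTop.add_lt_add_right WithTop.coe_ne_top (hc i)
  simpa using hL.fintype_card_le_finrank

/-- If `u` is a root of a nonzero polynomial over `k(x)`, then two of its terms have the same value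
at `u`. -/
theorem exists_coeff_val_eq {L : Type*} [Field L] [Algebra L K] {P : Polynomial L} (hP : P ≠ 0)
    {u : K} (hu : u ≠ 0) (h : Polynomial.aeval u P = 0) :
    ∃ i j, i < j ∧ j ≤ P.natDegree ∧ P.coeff i ≠ 0 ∧ P.coeff j ≠ 0 ∧
      ((j - i : ℕ) : ℤ) • v.val u =
        v.val (algebraMap L K (P.coeff i)) - v.val (algebraMap L K (P.coeff j)) := by
  have hne : ∀ i ∈ P.support, algebraMap L K (P.coeff i) * u ^ i ≠ 0 := fun i hi =>
    mul_ne_zero (by simpa using hi) (pow_ne_zero _ hu)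
  have hsum : ∑ i ∈ P.support, algebraMap L K (P.coeff i) * u ^ i = 0 := by
    rw [← h, Polynomial.aeval_def, Polynomial.eval₂_eq_sum]
    rfl
  obtain ⟨i, hi, j, hj, hij, hv⟩ := exists_eq_of_sum_eq_zero (v := v)
    (Polynomial.support_nonempty.mpr hP) hne hsum
  wlog hlt : i < j generalizing i j
  · exact this j hj i hi hij.symm hv.symm (by omega)
  refine ⟨i, j, hlt, Polynomial.le_natDegree_of_mem_supp j hj, by simpa using hi,
    by simpa using hj, ?_⟩
  have hci : algebraMap L K (P.coeff i) ≠ 0 := by simpa using hi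
  have hcj : algebraMap L K (P.coeff j) ≠ 0 := by simpa using hj
  rw [← val_eq_val (hne i hi) (hne j hj), val_mul hci (pow_ne_zero _ hu),
    val_mul hcj (pow_ne_zero _ hu), val_pow hu, val_pow hu] at hv
  rw [Nat.cast_sub hlt.le, sub_smul, natCast_zsmul, natCast_zsmul, sub_eq_sub_iff_add_eq_add,
    add_comm _ (v.val (algebraMap L K (P.coeff j))), hv.symm]

end AddValuation

end Monomial

/-! ### The value group of a valuation of maximal rank is a lattice. -/

section MaximalRank

variable {k K Γ : Type*} [Field k] [Field K] [Algebra k K]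
  [AddCommGroup Γ] [LinearOrder Γ] [IsOrderedAddMonoid Γ]

theorem RealSpan.span_range_tmul_one (Λ : Type*) [AddCommGroup Λ] :
    Submodule.span ℝ (Set.range fun γ : Λ => ((1 : ℝ) ⊗ₜ[ℤ] γ : ℝ ⊗[ℤ] Λ)) = ⊤ := by
  rw [eq_top_iff]
  rintro x -
  induction x using TensorProduct.induction_on with
  | zero => exact Submodule.zero_mem _
  | tmul r γ =>
    have : (r ⊗ₜ[ℤ] γ : ℝ ⊗[ℤ] Λ) = r • ((1 : ℝ) ⊗ₜ[ℤ] γ : ℝ ⊗[ℤ] Λ) := by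
      rw [TensorProduct.smul_tmul', smul_eq_mul, mul_one]
    rw [this]
    exact Submodule.smul_mem _ _ (Submodule.subset_span ⟨γ, rfl⟩)
  | add x y hx hy => exact Submodule.add_mem _ hx hy

/-- The tensors `1 ⊗ γ` span, so a real basis can be chosen among them; it is independent over `ℤ`,
and hence so are the elements `γ`. -/
theorem RealSpan.exists_int_linearIndependent {Λ : Type*} [AddCommGroup Λ] {d : ℕ}
    (h : Module.rank ℝ (RealSpan Λ) = d) : ∃ g : Fin d → Λ, LinearIndependent ℤ g := by
  change Module.rank ℝ (ℝ ⊗[ℤ] Λ) = d at h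
  obtain ⟨b, hb, hspan, hli⟩ := exists_linearIndependent ℝ
    (Set.range fun γ : Λ => ((1 : ℝ) ⊗ₜ[ℤ] γ : ℝ ⊗[ℤ] Λ))
  rw [RealSpan.span_range_tmul_one] at hspan
  let B : Module.Basis b ℝ (ℝ ⊗[ℤ] Λ) := .mk hli (by rw [Subtype.range_coe, hspan])
  have hcard : Cardinal.mk b = d := by rw [B.mk_eq_rank'', h]
  obtain ⟨e'⟩ := Cardinal.mk_eq_nat_iff.mp hcard
  let e := e'.symm
  choose g hg using fun i => hb (e i).2
  refine ⟨g, ?_⟩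
  have h1 : LinearIndependent ℝ fun i => (e i : ℝ ⊗[ℤ] Λ) := hli.comp e e.injective
  have h2 : LinearIndependent ℤ fun i => (e i : ℝ ⊗[ℤ] Λ) :=
    h1.restrict_scalars (fun a b hab => by simpa using hab)
  let F : Λ →ₗ[ℤ] ℝ ⊗[ℤ] Λ :=
    (TensorProduct.mk ℤ ℝ Λ 1).toAddMonoidHom.toIntLinearMap
  have h3 : (F ∘ g) = fun i => (e i : ℝ ⊗[ℤ] Λ) := funext hg
  exact LinearIndependent.of_comp F (h3 ▸ h2)

namespace AddValuation

variable {v : AddValuation K (WithTop Γ)} {d : ℕ}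

theorem isAlgebraic_of_trdeg_eq (htr : Algebra.trdeg k K = d) {x : Fin d → K}
    (hx : AlgebraicIndependent k x) :
    Algebra.IsAlgebraic (IntermediateField.adjoin k (Set.range x)) K := by
  have : IsTranscendenceBasis k x := AlgebraicIndependent.isTranscendenceBasis_of_lift_trdeg_le hx
    (by rw [htr]; exact Cardinal.natCast_lt_aleph0) (by simp [htr])
  exact this.isAlgebraic_field

theorem finiteDimensional_of_fg (hfg : (⊤ : IntermediateField k K).FG)
    (htr : Algebra.trdeg k K = d) {x : Fin d → K} (hx : AlgebraicIndependent k x) :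
    FiniteDimensional (IntermediateField.adjoin k (Set.range x)) K := by
  have halg := isAlgebraic_of_trdeg_eq htr hx
  obtain ⟨t, ht⟩ := hfg
  have h1 : IntermediateField.adjoin (IntermediateField.adjoin k (Set.range x))
      (t : Set K) = ⊤ := by
    rw [eq_top_iff]
    intro y _
    have hy : y ∈ IntermediateField.adjoin k (t : Set K) := ht ▸ IntermediateField.mem_top
    have hle : IntermediateField.adjoin k (t : Set K) ≤
        (IntermediateField.adjoin (IntermediateField.adjoin k (Set.range x))
          (t : Set K)).restrictScalars k := by
      rw [IntermediateField.adjoin_le_iff]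
      exact IntermediateField.subset_adjoin _ _
    exact hle hy
  have h2 := IntermediateField.finiteDimensional_adjoin
    (K := IntermediateField.adjoin k (Set.range x))
    (S := (t : Set K)) (fun y _ => (halg.isAlgebraic y).isIntegral)
  rw [h1] at h2
  exact (IntermediateField.topEquiv (F := IntermediateField.adjoin k (Set.range x))
    (E := K)).toLinearEquiv.finiteDimensional

/-- A multiple of each value of `K` is a value of `k(x)`. -/
theorem exists_factorial_smul_val_eq (hk : TrivialOn k v) {x : Fin d → K} (hx : ∀ i, x i ≠ 0)
    (hlin : LinearIndependent ℤ fun i => v.val (x i))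
    [FiniteDimensional (IntermediateField.adjoin k (Set.range x)) K] {u : K} (hu : u ≠ 0) :
    ∃ e : Fin d → ℤ,
      ((Module.finrank (IntermediateField.adjoin k (Set.range x)) K) ! : ℤ) • v.val u =
        ∑ i, e i • v.val (x i) := by
  set L := IntermediateField.adjoin k (Set.range x)
  have hint : IsIntegral L u := Algebra.IsIntegral.isIntegral u
  obtain ⟨i, j, hij, hj, hi0, hj0, h⟩ := exists_coeff_val_eq (v := v)
    (minpoly.ne_zero hint) hu (minpoly.aeval L u)
  -- The difference `j - i` is positive and at most the degree of the extension, so the factorial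
  -- clears it uniformly in `u`.
  have hdvd : j - i ∣ (Module.finrank L K)! :=
    Nat.dvd_factorial (by omega) ((Nat.sub_le j i).trans (hj.trans (minpoly.natDegree_le u)))
  obtain ⟨q, hq⟩ := hdvd
  obtain ⟨e, he⟩ := exists_val_eq_of_mem_field_adjoin hk hx hlin ((minpoly L u).coeff i).2
    (by simpa using hi0)
  obtain ⟨e', he'⟩ := exists_val_eq_of_mem_field_adjoin hk hx hlin ((minpoly L u).coeff j).2
    (by simpa using hj0)
  refine ⟨fun l => q * (e l - e' l), ?_⟩
  rw [hq, mul_comm, Nat.cast_mul, mul_smul, h, IntermediateField.algebraMap_apply,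
    IntermediateField.algebraMap_apply, he, he']
  simp only [mul_smul, ← Finset.smul_sum, sub_smul, Finset.sum_sub_distrib]

/-- Multiplication by `r !`, where `r` is the degree of `K` over `k(x)`, is injective in an ordered
group and maps the value group into the lattice spanned by the values of `x`. So the group is free
of rank at most `d`; the independent values of `x` give the opposite inequality. -/
theorem nonempty_basis_valueGroup_of_finiteDimensional (hk : TrivialOn k v) {x : Fin d → K}
    (hx : ∀ i, x i ≠ 0) (hlin : LinearIndependent ℤ fun i => v.val (x i))
    [FiniteDimensional (IntermediateField.adjoin k (Set.range x)) K] :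
    Nonempty (Module.Basis (Fin d) ℤ (valueGroup v)) := by
  set N := Submodule.span ℤ (Set.range fun i => v.val (x i)) with hN
  set r := Module.finrank (IntermediateField.adjoin k (Set.range x)) K
  let B : Module.Basis (Fin d) ℤ N := .span hlin
  have hmem : ∀ γ : valueGroup v, ((r ! : ℤ) • (γ : Γ)) ∈ N := by
    rintro ⟨γ, u, hu⟩
    obtain ⟨e, he⟩ := exists_factorial_smul_val_eq hk hx hlin (ne_zero_of_eq_coe hu)
    rw [val_eq_of_eq_coe hu] at he
    change (r ! : ℤ) • γ ∈ N
    rw [he]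
    exact Submodule.sum_mem _ fun i _ => Submodule.smul_mem _ _ (Submodule.subset_span ⟨i, rfl⟩)
  let F : valueGroup v →ₗ[ℤ] N :=
    { toFun := fun γ => ⟨(r ! : ℤ) • (γ : Γ), hmem γ⟩
      map_add' := fun a b => by ext; simp
      map_smul' := fun c a => by
        ext
        simp only [AddSubgroup.coe_zsmul, RingHom.id_apply, Submodule.coe_smul]
        exact smul_comm _ _ _ }
  have hF : Function.Injective F := by
    intro a b hab
    have h1 : (r ! : ℤ) • (a : Γ) = (r ! : ℤ) • (b : Γ) := congrArg Subtype.val hab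
    have hr : (r ! : ℤ) ≠ 0 := by exact_mod_cast Nat.factorial_ne_zero r
    exact Subtype.ext (zsmul_right_injective hr h1)
  obtain ⟨n, ⟨b⟩⟩ := Submodule.nonempty_basis_of_pid B (LinearMap.range F)
  let b' : Module.Basis (Fin n) ℤ (valueGroup v) := b.map (LinearEquiv.ofInjective F hF).symm
  have hfree := Module.Free.of_basis b'
  have hfinite := Module.Finite.of_basis b'
  have hfreeN := Module.Free.of_basis B
  have hfiniteN := Module.Finite.of_basis B
  have h1 : Module.finrank ℤ (valueGroup v) ≤ d := by
    have := LinearMap.finrank_le_finrank_of_injective hF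
    rwa [Module.finrank_eq_card_basis B, Fintype.card_fin] at this
  have h2 : d ≤ Module.finrank ℤ (valueGroup v) := by
    have hli : LinearIndependent ℤ fun i : Fin d =>
        (⟨v.val (x i), val_mem_valueGroup _⟩ : valueGroup v) :=
      LinearIndependent.of_comp (valueGroup v).subtype.toIntLinearMap hlin
    simpa using hli.fintype_card_le_finrank
  exact ⟨Module.finBasisOfFinrankEq ℤ _ (le_antisymm h1 h2)⟩

end AddValuation

open AddValuation

theorem IsMaximalRank.exists_linearIndependent {d : ℕ} {v : AddValuation K (WithTop Γ)}
    (h : IsMaximalRank k d v) :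
    ∃ x : Fin d → K, (∀ i, x i ≠ 0) ∧ LinearIndependent ℤ fun i => v.val (x i) := by
  obtain ⟨g, hg⟩ := RealSpan.exists_int_linearIndependent h.rank_eq
  choose x hx using fun i => (g i).2
  refine ⟨x, fun i => ne_zero_of_eq_coe (hx i), ?_⟩
  have : (fun i => v.val (x i)) = (valueGroup v).subtype.toIntLinearMap ∘ g := by
    funext i
    exact val_eq_of_eq_coe (hx i)
  rw [this]
  exact hg.map_injOn _ (valueGroup v).subtype_injective.injOn

theorem IsMaximalRank.exists_finiteDimensional {d : ℕ} {v : AddValuation K (WithTop Γ)}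
    (h : IsMaximalRank k d v) (hfg : (⊤ : IntermediateField k K).FG) :
    ∃ x : Fin d → K, (∀ i, x i ≠ 0) ∧ (LinearIndependent ℤ fun i => v.val (x i)) ∧
      FiniteDimensional (IntermediateField.adjoin k (Set.range x)) K := by
  obtain ⟨x, hx, hlin⟩ := h.exists_linearIndependent
  exact ⟨x, hx, hlin, finiteDimensional_of_fg hfg h.trdeg_eq
    (algebraicIndependent_of_linearIndependent h.trivial_on hx hlin)⟩

theorem IsMaximalRank.nonempty_basis {d : ℕ} {v : AddValuation K (WithTop Γ)}
    (h : IsMaximalRank k d v) (hfg : (⊤ : IntermediateField k K).FG) :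
    Nonempty (Module.Basis (Fin d) ℤ (valueGroup v)) := by
  obtain ⟨x, hx, hlin, hfin⟩ := h.exists_finiteDimensional hfg
  exact nonempty_basis_valueGroup_of_finiteDimensional h.trivial_on hx hlin

theorem IsMaximalRank.of_basis {d : ℕ} {v : AddValuation K (WithTop Γ)}
    (htr : Algebra.trdeg k K = d) (hk : TrivialOn k v)
    (b : Module.Basis (Fin d) ℤ (valueGroup v)) : IsMaximalRank k d v where
  trdeg_eq := htr
  trivial_on := hk
  rank_eq := by rw [rank_eq_card_basis (realBasis b), Fintype.card_fin]

end MaximalRank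

/-! ### Coordinates on the real span of a lattice -/

section Coordinates

variable {Λ : Type*} [AddCommGroup Λ] {d : ℕ} (b : Module.Basis (Fin d) ℤ Λ)

/-- The coordinates given by a `ℤ`-basis, as a homeomorphism. -/
noncomputable def coordHomeomorph : RealSpan Λ ≃ₜ (Fin d → ℝ) where
  toEquiv := (realBasis b).equivFun.toEquiv
  continuous_toFun := IsModuleTopology.continuous_of_linearMap (R := ℝ)
    (realBasis b).equivFun.toLinearMap
  continuous_invFun := by
    have : ContinuousAdd (RealSpan Λ) := IsModuleTopology.toContinuousAdd ℝ _
    have : ContinuousSMul ℝ (RealSpan Λ) := IsModuleTopology.toContinuousSMul ℝ _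
    exact IsModuleTopology.continuous_of_linearMap (R := ℝ)
      (realBasis b).equivFun.symm.toLinearMap

theorem coordHomeomorph_latticePoint (n : ℕ) (γ : Λ) :
    coordHomeomorph b (latticePoint n γ) = scaledPoint n (b.equivFun γ) := by
  funext i
  have h : (Algebra.TensorProduct.basis ℝ b).repr ((n : ℝ)⁻¹ ⊗ₜ[ℤ] γ) i =
      (n : ℝ)⁻¹ * (b.repr γ i : ℝ) := by
    rw [Algebra.TensorProduct.basis_repr_tmul]
    simp
  exact h

theorem coordHomeomorph_image_closure_convexHull (s : Set (RealSpan Λ)) :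
    coordHomeomorph b '' closure (convexHull ℝ s) =
      closure (convexHull ℝ (coordHomeomorph b '' s)) := by
  rw [Homeomorph.image_closure]
  congr 1
  exact LinearMap.image_convexHull (realBasis b).equivFun.toLinearMap s

theorem lebesgueMeasure_eq_map : lebesgueMeasure b = Measure.map (coordHomeomorph b).symm volume :=
  rfl

theorem lebesgueMeasure_apply (s : Set (RealSpan Λ)) :
    lebesgueMeasure b s = volume (coordHomeomorph b '' s) := by
  rw [lebesgueMeasure_eq_map, (coordHomeomorph b).symm.measurableEmbedding.map_apply,
    Homeomorph.preimage_symm]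

theorem setIntegral_lebesgueMeasure (s : Set (RealSpan Λ)) (f : RealSpan Λ → ℝ) :
    ∫ p in s, f p ∂(lebesgueMeasure b) =
      ∫ x in coordHomeomorph b '' s, f ((coordHomeomorph b).symm x) := by
  rw [lebesgueMeasure_eq_map, (coordHomeomorph b).symm.measurableEmbedding.setIntegral_map,
    Homeomorph.preimage_symm]

end Coordinates

/-! ### From filtrations to lattice semigroups and measures. -/

section Filtration

variable {k K Γ : Type*} [Field k] [Field K] [Algebra k K]
  [AddCommGroup Γ] [LinearOrder Γ] [IsOrderedAddMonoid Γ]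

/-- A graded family of subspaces whose homogeneous quotients fill up `K` in every degree. -/
structure IsGeneratingFiltration (S : ℕ → Submodule k K) : Prop where
  mul_mem : ∀ m n : ℕ, 1 ≤ m → 1 ≤ n → ∀ f ∈ S m, ∀ g ∈ S n, f * g ∈ S (m + n)
  exists_div : ∀ (z : ℤ) (u : K), u ≠ 0 → ∃ m n : ℕ, 1 ≤ m ∧ 1 ≤ n ∧ z = m - n ∧
    ∃ f ∈ S m, ∃ g ∈ S n, f ≠ 0 ∧ g ≠ 0 ∧ u = f / g

variable {d : ℕ} {v : AddValuation K (WithTop Γ)} {S : ℕ → Submodule k K}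
  (b : Module.Basis (Fin d) ℤ (valueGroup v))

open AddValuation

theorem image_val_valueSet (n : ℕ) : Subtype.val '' valueSet v S n = values v (S n) := by
  ext γ
  constructor
  · rintro ⟨γ, h, rfl⟩
    exact h
  · rintro ⟨x, hx, hv⟩
    exact ⟨⟨γ, x, hv⟩, ⟨x, hx, hv⟩, rfl⟩

theorem valueSet_finite_iff (n : ℕ) : (valueSet v S n).Finite ↔ (values v (S n)).Finite := by
  rw [← image_val_valueSet, Set.finite_image_iff Subtype.val_injective.injOn]

theorem ncard_valueSet (n : ℕ) : (valueSet v S n).ncard = (values v (S n)).ncard := by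
  rw [← image_val_valueSet, Set.ncard_image_of_injective _ Subtype.val_injective]

/-- The sets `V n` in coordinates. -/
def coordValueSet (S : ℕ → Submodule k K) (n : ℕ) : Set (Fin d → ℤ) :=
  b.equivFun '' valueSet v S n

theorem image_scaledValueSet (n : ℕ) :
    coordHomeomorph b '' scaledValueSet v S n = scaledPoint n '' coordValueSet b S n := by
  simp only [scaledValueSet, coordValueSet, Set.image_image, coordHomeomorph_latticePoint]

theorem image_okounkovBody :
    coordHomeomorph b '' okounkovBody v S = semigroupBody (coordValueSet b S) := by
  rw [okounkovBody, coordHomeomorph_image_closure_convexHull, semigroupBody]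
  simp only [Set.image_iUnion, image_scaledValueSet]

/-- Products give sums of values. For the group condition, write an element of prescribed value as a
quotient of elements whose degrees have the prescribed difference. -/
theorem IsGeneratingFiltration.isLatticeSemigroup (hS : IsGeneratingFiltration S) :
    IsLatticeSemigroup (coordValueSet b S) where
  add_mem := by
    rintro m n hm hn _ ⟨α, ⟨f, hf, hα⟩, rfl⟩ _ ⟨β, ⟨g, hg, hβ⟩, rfl⟩
    refine ⟨α + β, ⟨f * g, hS.mul_mem m n hm hn f hf g hg, ?_⟩, _root_.map_add _ _ _⟩
    rw [AddValuation.map_mul, hα, hβ, AddSubgroup.coe_add, WithTop.coe_add]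
  exists_sub := by
    intro z l
    obtain ⟨u, hu⟩ := (b.equivFun.symm l).2
    obtain ⟨m, n, hm, hn, hz, f, hf, g, hg, hf0, hg0, rfl⟩ :=
      hS.exists_div z u (ne_zero_of_eq_coe hu)
    refine ⟨m, n, hm, hn, _, ⟨⟨_, val_mem_valueGroup f⟩, ⟨f, hf, (coe_val hf0).symm⟩, rfl⟩,
      _, ⟨⟨_, val_mem_valueGroup g⟩, ⟨g, hg, (coe_val hg0).symm⟩, rfl⟩, hz, ?_⟩
    rw [← _root_.map_sub b.equivFun]
    apply b.equivFun.symm.injective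
    rw [LinearEquiv.symm_apply_apply]
    ext
    rw [AddSubgroupClass.coe_sub, ← val_div hf0 hg0]
    exact (val_eq_of_eq_coe hu).symm

theorem finite_coordValueSet {n : ℕ} (h : (valueSet v S n).Finite) :
    (coordValueSet b S n).Finite := h.image _

theorem ncard_coordValueSet (n : ℕ) : (coordValueSet b S n).ncard = (valueSet v S n).ncard :=
  Set.ncard_image_of_injective _ b.equivFun.injective

namespace IsGeneratingFiltration

variable (hS : IsGeneratingFiltration S)
include hS

include b in
theorem isCompact_okounkovBody (hfin : ∀ n ≥ 1, (valueSet v S n).Finite) {C : ℝ}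
    (hC : ∀ n : ℕ, 1 ≤ n → ((valueSet v S n).ncard : ℝ) ≤ C * (n : ℝ) ^ d) :
    IsCompact (okounkovBody v S) := by
  have h := (hS.isLatticeSemigroup b).isCompact_body
    (fun n hn => finite_coordValueSet b (hfin n hn))
    (fun n hn => by rw [ncard_coordValueSet]; exact hC n hn)
  rwa [← image_okounkovBody, Homeomorph.isCompact_image] at h

theorem lebesgueMeasure_okounkovBody_pos : 0 < lebesgueMeasure b (okounkovBody v S) := by
  rw [lebesgueMeasure_apply, image_okounkovBody]
  exact (hS.isLatticeSemigroup b).volume_body_pos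

omit hS in
theorem lebesgueMeasure_okounkovBody_lt_top (hcomp : IsCompact (okounkovBody v S)) :
    lebesgueMeasure b (okounkovBody v S) < ⊤ := by
  rw [lebesgueMeasure_apply]
  exact ((coordHomeomorph b).isCompact_image.mpr hcomp).measure_lt_top

variable (hfin : ∀ n ≥ 1, (valueSet v S n).Finite) (hcomp : IsCompact (okounkovBody v S))
include hfin hcomp

theorem tendsto_ncard_div : Tendsto (fun n : ℕ => ((valueSet v S n).ncard : ℝ) / (n : ℝ) ^ d)
    atTop (𝓝 (lebesgueMeasure b (okounkovBody v S)).toReal) := by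
  have h := (hS.isLatticeSemigroup b).tendsto_ncard_div
    (fun n hn => finite_coordValueSet b (hfin n hn))
    (by rwa [← image_okounkovBody, Homeomorph.isCompact_image])
  simp only [ncard_coordValueSet] at h
  rwa [lebesgueMeasure_apply, image_okounkovBody]

theorem tendsto_integral (f : RealSpan (valueGroup v) →ᵇ ℝ) :
    Tendsto (fun n : ℕ => ∫ p, f p ∂(normalizedCount d v S n)) atTop
      (𝓝 (∫ p in okounkovBody v S, f p ∂(lebesgueMeasure b))) := by
  have h := (hS.isLatticeSemigroup b).tendsto_sum_div
    (fun n hn => finite_coordValueSet b (hfin n hn))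
    (by rwa [← image_okounkovBody, Homeomorph.isCompact_image])
    (f.continuous.comp (coordHomeomorph b).symm.continuous)
  rw [setIntegral_lebesgueMeasure, image_okounkovBody]
  refine h.congr' ?_
  filter_upwards [eventually_ge_atTop 1] with n hn
  have hA : (scaledValueSet v S n).Finite := (hfin n hn).image _
  have : T2Space (RealSpan (valueGroup v)) := (coordHomeomorph b).symm.t2Space
  have hfm : IsFiniteMeasure (Measure.count.restrict (scaledValueSet v S n)) := by
    refine ⟨?_⟩
    rw [Measure.restrict_apply_univ, Measure.count_apply_finite _ hA]
    exact ENNReal.natCast_lt_top _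
  have hint : Integrable f (Measure.count.restrict (scaledValueSet v S n)) := f.integrable _
  have h1 : ∫ p in scaledValueSet v S n, f p ∂Measure.count =
      ∑ᶠ p ∈ scaledValueSet v S n, f p := by
    rw [finsum_mem_eq_finite_toFinset_sum _ hA]
    have h2 := setIntegral_finset (μ := Measure.count) (f := f) hA.toFinset
      (by rwa [IntegrableOn, Set.Finite.coe_toFinset])
    rw [Set.Finite.coe_toFinset] at h2
    rw [h2]
    simp [measureReal_def]
  have hinj : Function.Injective (latticePoint n : valueGroup v → RealSpan (valueGroup v)) := by
    intro x y hxy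
    have := congrArg (coordHomeomorph b) hxy
    rw [coordHomeomorph_latticePoint, coordHomeomorph_latticePoint] at this
    exact b.equivFun.injective (scaledPoint_injective hn this)
  rw [normalizedCount, integral_smul_measure, h1, scaledValueSet, finsum_mem_image hinj.injOn,
    coordValueSet, finsum_mem_image b.equivFun.injective.injOn, smul_eq_mul, div_eq_inv_mul]
  congr 1
  · simp
  · refine finsum_mem_congr rfl fun γ _ => ?_
    rw [← coordHomeomorph_latticePoint, Function.comp_apply, Homeomorph.symm_apply_apply]

end IsGeneratingFiltration

namespace IsOkounkovFiltration

variable {d : ℕ} {v : AddValuation K (WithTop Γ)} {S : ℕ → Submodule k K}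
  (hS : IsOkounkovFiltration d S)
include hS

theorem le_succ {m n : ℕ} (hm : 1 ≤ m) (hmn : m ≤ n) : S m ≤ S n := by
  induction n, hmn using Nat.le_induction with
  | base => exact le_rfl
  | succ n hmn ih =>
    intro x hx
    have := hS.mul_le n 1 (hm.trans hmn) le_rfl (Submodule.mul_mem_mul (ih hx) hS.one_mem)
    rwa [mul_one] at this

theorem exists_mem_of_mem_adjoin {x : K} (hx : x ∈ Algebra.adjoin k (⋃ n ≥ 1, (S n : Set K))) :
    ∃ n ≥ 1, x ∈ S n := by
  induction hx using Algebra.adjoin_induction with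
  | mem x hx => simpa using hx
  | algebraMap c =>
    refine ⟨1, le_rfl, ?_⟩
    rw [Algebra.algebraMap_eq_smul_one]
    exact (S 1).smul_mem c hS.one_mem
  | add x y _ _ hx hy =>
    obtain ⟨m, hm, hx⟩ := hx
    obtain ⟨n, hn, hy⟩ := hy
    exact ⟨max m n, le_max_of_le_left hm, (S _).add_mem (hS.le_succ hm (le_max_left _ _) hx)
      (hS.le_succ hn (le_max_right _ _) hy)⟩
  | mul x y _ _ hx hy =>
    obtain ⟨m, hm, hx⟩ := hx
    obtain ⟨n, hn, hy⟩ := hy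
    exact ⟨m + n, by omega, hS.mul_le m n hm hn (Submodule.mul_mem_mul hx hy)⟩

/-- Every `u` is a quotient of elements of the union. As `1 ∈ S 1`, the spaces increase, so the
degrees of numerator and denominator can be raised to any prescribed difference. -/
theorem isGeneratingFiltration : IsGeneratingFiltration S where
  mul_mem := fun m n hm hn f hf g hg => hS.mul_le m n hm hn (Submodule.mul_mem_mul hf hg)
  exists_div := by
    intro z u hu
    have : u ∈ IntermediateField.adjoin k (⋃ n ≥ 1, (S n : Set K)) :=
      hS.generates ▸ IntermediateField.mem_top
    obtain ⟨f, hf, g, hg, rfl⟩ := IntermediateField.mem_adjoin_iff_div.mp this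
    obtain ⟨m, hm, hf⟩ := hS.exists_mem_of_mem_adjoin hf
    obtain ⟨n, hn, hg⟩ := hS.exists_mem_of_mem_adjoin hg
    obtain ⟨hf0, hg0⟩ := div_ne_zero_iff.mp hu
    -- The positive and negative parts of `z` adjust a common degree.
    refine ⟨max m n + z.toNat, max m n + (-z).toNat, by omega, by omega, by omega,
      f, hS.le_succ hm (by omega) hf, g, hS.le_succ hn (by omega) hg, hf0, hg0, rfl⟩

end IsOkounkovFiltration

/-- The growth condition bounds the number of values, since `#V n ≤ dim S n`; this makes the body
compact, and the rest is equidistribution of semigroup points in coordinates. -/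
theorem okounkovBody_of_filtered_algebra {d : ℕ} {v : AddValuation K (WithTop Γ)}
    {S : ℕ → Submodule k K} (hfg : (⊤ : IntermediateField k K).FG) (hv : IsMaximalRank k d v)
    (hS : IsOkounkovFiltration d S) :
    Nonempty (Module.Basis (Fin d) ℤ (valueGroup v)) ∧
    (∀ n ≥ 1, (valueSet v S n).Finite) ∧
    IsCompact (okounkovBody v S) ∧
    ∀ b : Module.Basis (Fin d) ℤ (valueGroup v),
      lebesgueMeasure b (okounkovBody v S) < ⊤ ∧
      ∀ f : RealSpan (valueGroup v) →ᵇ ℝ,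
        Tendsto (fun n : ℕ => ∫ p, f p ∂(normalizedCount d v S n)) atTop
          (𝓝 (∫ p in okounkovBody v S, f p ∂(lebesgueMeasure b))) := by
  have hb := hv.nonempty_basis hfg
  have key : ∀ n ≥ 1, (valueSet v S n).Finite ∧
      (valueSet v S n).ncard ≤ Module.finrank k (S n) := by
    intro n hn
    have := hS.growth.1 n hn
    rw [valueSet_finite_iff, ncard_valueSet]
    exact finite_values_and_ncard_le (S n) hv.trivial_on
  have hfin : ∀ n ≥ 1, (valueSet v S n).Finite := fun n hn => (key n hn).1
  obtain ⟨C, hC⟩ := hS.growth.2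
  have hcomp : IsCompact (okounkovBody v S) := by
    obtain ⟨b⟩ := hb
    refine hS.isGeneratingFiltration.isCompact_okounkovBody b hfin (C := C) fun n hn => ?_
    exact (Nat.cast_le.mpr (key n hn).2).trans (hC n hn)
  exact ⟨hb, hfin, hcomp, fun b =>
    ⟨IsGeneratingFiltration.lebesgueMeasure_okounkovBody_lt_top b hcomp,
      hS.isGeneratingFiltration.tendsto_integral b hfin hcomp⟩⟩

end Filtration

/-! ### Existence of valuations of maximal rank. -/

section Existence

variable {k K : Type*} [Field k] [Field K] [Algebra k K]

/-- The valuation ring of an additive valuation. -/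
def AddValuation.integers {Γ : Type*} [AddCommGroup Γ] [LinearOrder Γ] [IsOrderedAddMonoid Γ]
    (v : AddValuation K (WithTop Γ)) : ValuationSubring K where
  carrier := {x | 0 ≤ v x}
  mul_mem' := fun {x y} hx hy => by
    simp only [Set.mem_ofPred_eq, AddValuation.map_mul] at *
    exact add_nonneg hx hy
  one_mem' := by simp
  add_mem' := fun hx hy => AddValuation.map_le_add v hx hy
  zero_mem' := by simp
  neg_mem' := fun {x} hx => by simpa using hx
  mem_or_inv_mem' := fun x => by
    by_cases hx : x = 0
    · left; simp [hx]
    · simp only [Set.mem_ofPred_eq]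
      rw [← AddValuation.coe_val hx, ← AddValuation.coe_val (inv_ne_zero hx),
        AddValuation.val_inv hx, ← WithTop.coe_zero, WithTop.coe_le_coe, WithTop.coe_le_coe,
        Left.nonneg_neg_iff]
      exact le_total _ _

section OfValuation

variable {Γ₀ : Type*} [LinearOrderedCommGroupWithZero Γ₀] (w : Valuation K Γ₀)

open Classical in
/-- The values of a multiplicative valuation, written additively. -/
noncomputable def Valuation.addFun (x : K) : WithTop (Additive Γ₀ˣ)ᵒᵈ :=
  if h : x = 0 then ⊤ else
    ((OrderDual.toDual (Additive.ofMul (Units.mk0 (w x) ((Valuation.ne_zero_iff w).mpr h))) :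
      (Additive Γ₀ˣ)ᵒᵈ) : WithTop (Additive Γ₀ˣ)ᵒᵈ)

theorem Valuation.addFun_of_ne_zero {x : K} (h : x ≠ 0) : w.addFun x =
    ((OrderDual.toDual (Additive.ofMul (Units.mk0 (w x) ((Valuation.ne_zero_iff w).mpr h))) :
      (Additive Γ₀ˣ)ᵒᵈ) : WithTop (Additive Γ₀ˣ)ᵒᵈ) := dif_neg h

theorem Valuation.addFun_le_iff {x y : K} : w.addFun x ≤ w.addFun y ↔ w y ≤ w x := by
  by_cases hy : y = 0
  · simp [hy, Valuation.addFun]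
  by_cases hx : x = 0
  · subst hx
    rw [w.addFun_of_ne_zero hy, Valuation.addFun, dif_pos rfl]
    simp [hy]
  rw [w.addFun_of_ne_zero hy, w.addFun_of_ne_zero hx, WithTop.coe_le_coe,
    OrderDual.toDual_le_toDual, Additive.ofMul_le, ← Units.val_le_val]
  rfl

/-- A multiplicative valuation written additively. -/
noncomputable def Valuation.toAdd : AddValuation K (WithTop (Additive Γ₀ˣ)ᵒᵈ) :=
  AddValuation.of w.addFun (dif_pos rfl)
    (by
      rw [w.addFun_of_ne_zero one_ne_zero]
      norm_cast
      rw [← toDual_zero, ← ofMul_one]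
      congr 2
      ext
      simp)
    (fun x y => by
      rw [min_le_iff, w.addFun_le_iff, w.addFun_le_iff]
      exact w.map_add' x y)
    (fun x y => by
      by_cases hx : x = 0
      · simp [hx, Valuation.addFun]
      by_cases hy : y = 0
      · simp [hy, Valuation.addFun]
      rw [w.addFun_of_ne_zero hx, w.addFun_of_ne_zero hy, w.addFun_of_ne_zero (mul_ne_zero hx hy),
        ← WithTop.coe_add, WithTop.coe_inj, ← toDual_add, ← ofMul_mul]
      congr 2
      ext
      simp)

theorem Valuation.toAdd_eq_zero_iff {x : K} : w.toAdd x = 0 ↔ w x = 1 := by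
  have h : ∀ x, w.toAdd x = w.addFun x := fun x => rfl
  rw [← AddValuation.map_one w.toAdd, h, h, le_antisymm_iff, w.addFun_le_iff, w.addFun_le_iff,
    map_one, le_antisymm_iff, and_comm]

end OfValuation

open AddValuation

/-- A field extension embedded in a field with a valuation has a valuation ring dominating
the valuation ring of the subfield. -/
theorem exists_valuationSubring_dominating {L H Γ : Type*} [Field L] [Field H] [AddCommGroup Γ]
    [LinearOrder Γ] [IsOrderedAddMonoid Γ] (v : AddValuation H (WithTop Γ)) (θ : L →+* H)
    (ψ : L →+* K) : ∃ W : ValuationSubring K,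
      ∀ a : L, a ≠ 0 → (W.valuation (ψ a) = 1 ↔ v (θ a) = 0) := by
  -- The pullback of `v` to `L` has a valuation ring, hence a local ring, which is dominated by a
  -- valuation ring of `K`. Domination is what makes units of `W` come from units below.
  obtain ⟨W, hW, hloc⟩ := IsLocalRing.exists_factor_valuationRing
    (ψ.comp (v.integers.comap θ).subtype)
  have key : ∀ a : L, a ≠ 0 → (0 ≤ v (θ a)) → (W.valuation (ψ a) = 1 ↔ v (θ a) = 0) := by
    intro a ha h0
    have hθ : θ a ≠ 0 := (map_ne_zero θ).mpr ha
    set r : v.integers.comap θ := ⟨a, h0⟩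
    have h1 : W.valuation (ψ a) = 1 ↔
        IsUnit ((ψ.comp (v.integers.comap θ).subtype).codRestrict W.toSubring hW r) :=
      (W.valuation_eq_one_iff ⟨ψ a, hW r⟩).symm
    rw [h1]
    constructor
    · intro h
      have h2 := hloc.map_nonunit r h
      obtain ⟨s, hs⟩ := h2.exists_right_inv
      have h3 : a * (s : L) = 1 := congrArg Subtype.val hs
      have h4 : v (θ a) + v (θ s) = 0 := by
        rw [← AddValuation.map_mul, ← _root_.map_mul, h3, _root_.map_one, AddValuation.map_one]
      exact (add_eq_zero_iff_of_nonneg h0 s.2).mp h4 |>.1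
    · intro h
      have hinv : 0 ≤ v (θ a⁻¹) := by
        rw [map_inv₀, ← coe_val (inv_ne_zero hθ), val_inv hθ, val_eq_of_eq_coe (v := v) (γ := 0) h]
        simp
      have : IsUnit r := IsUnit.of_mul_eq_one ⟨a⁻¹, hinv⟩ (Subtype.ext (mul_inv_cancel₀ ha))
      exact this.map _
  refine ⟨W, fun a ha => ?_⟩
  have hθ : θ a ≠ 0 := (map_ne_zero θ).mpr ha
  rcases le_total 0 (v (θ a)) with h | h
  · exact key a ha h
  · have hvi : v (θ a⁻¹) = ((-v.val (θ a) : Γ) : WithTop Γ) := by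
      rw [map_inv₀, ← coe_val (inv_ne_zero hθ), val_inv hθ]
    have hv : v (θ a) = ((v.val (θ a) : Γ) : WithTop Γ) := (coe_val hθ).symm
    have h1 := key a⁻¹ (inv_ne_zero ha) (by
      rw [hv, ← WithTop.coe_zero, WithTop.coe_le_coe] at h
      rw [hvi, ← WithTop.coe_zero, WithTop.coe_le_coe]
      exact neg_nonneg.mpr h)
    rw [map_inv₀, map_inv₀, inv_eq_one, hvi, ← WithTop.coe_zero, WithTop.coe_inj,
      neg_eq_zero] at h1
    rw [h1, hv, ← WithTop.coe_zero, WithTop.coe_inj]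

theorem HahnSeries.linearIndependent_single (k : Type*) [Field k] (d : ℕ) :
    LinearIndependent ℤ fun i : Fin d => (HahnSeries.addVal (Lex (Fin d → ℤ)) k).val
      (HahnSeries.single (toLex (Pi.single i 1)) 1) := by
  have h : ∀ i : Fin d, (HahnSeries.addVal (Lex (Fin d → ℤ)) k).val
      (HahnSeries.single (toLex (Pi.single i 1)) 1) = toLex (Pi.single i 1) := by
    intro i
    apply val_eq_of_eq_coe
    rw [HahnSeries.addVal_apply, HahnSeries.orderTop_single one_ne_zero]
  simp only [h]
  have := (Pi.basisFun ℤ (Fin d)).linearIndependent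
  rw [Fintype.linearIndependent_iff] at this ⊢
  simp only [Pi.basisFun_apply] at this
  exact this

theorem HahnSeries.trivialOn_addVal (k : Type*) [Field k] (d : ℕ) :
    TrivialOn k (HahnSeries.addVal (Lex (Fin d → ℤ)) k) := by
  intro c hc
  rw [HahnSeries.addVal_apply, HahnSeries.algebraMap_apply, HahnSeries.C_apply,
    HahnSeries.orderTop_single (by simpa using hc)]
  rfl

/-- Map a transcendence basis `x` to the monomials in Hahn series with lexicographically ordered
exponents `ℤ ^ d`, pull the valuation back to `k(x)` and dominate its ring in `K`. The new valuation
only has to preserve whether a value is zero: an integral relation between the values of `x` says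
that a Laurent monomial has value zero. -/
theorem exists_isMaximalRank {k K : Type*} [Field k] [Field K] [Algebra k K] {d : ℕ}
    (hfg : (⊤ : IntermediateField k K).FG) (htr : Algebra.trdeg k K = d) :
    ∃ W : ValuationSubring K, IsMaximalRank k d W.valuation.toAdd := by
  obtain ⟨s, hs⟩ := exists_isTranscendenceBasis k K
  have hcard : Cardinal.mk s = d := by rw [hs.cardinalMk_eq_trdeg, htr]
  obtain ⟨e⟩ := Cardinal.mk_eq_nat_iff.mp hcard
  set x : Fin d → K := fun i => e.symm i
  have hx : AlgebraicIndependent k x := hs.1.comp _ e.symm.injective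
  have hx0 : ∀ i, x i ≠ 0 := fun i => hx.ne_zero i
  set v := HahnSeries.addVal (Lex (Fin d → ℤ)) k
  set y : Fin d → HahnSeries (Lex (Fin d → ℤ)) k :=
    fun i => HahnSeries.single (toLex (Pi.single i 1)) 1
  have hy0 : ∀ i, y i ≠ 0 := fun i => HahnSeries.single_ne_zero one_ne_zero
  have hvk := HahnSeries.trivialOn_addVal k d
  have hylin := HahnSeries.linearIndependent_single k d
  have hy : AlgebraicIndependent k y := algebraicIndependent_of_linearIndependent hvk hy0 hylin
  have hinj_y : Function.Injective (MvPolynomial.aeval (R := k) y).toRingHom :=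
    algebraicIndependent_iff_injective_aeval.mp hy
  let θ : FractionRing (MvPolynomial (Fin d) k) →+* HahnSeries (Lex (Fin d → ℤ)) k :=
    IsFractionRing.lift hinj_y
  have hinj_x : Function.Injective (MvPolynomial.aeval (R := k) x).toRingHom :=
    algebraicIndependent_iff_injective_aeval.mp hx
  let ψ : FractionRing (MvPolynomial (Fin d) k) →+* K := IsFractionRing.lift hinj_x
  have hθ : ∀ p, θ (algebraMap _ _ p) = MvPolynomial.aeval y p :=
    fun p => IsFractionRing.lift_algebraMap _ p
  have hψ : ∀ p, ψ (algebraMap _ _ p) = MvPolynomial.aeval x p :=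
    fun p => IsFractionRing.lift_algebraMap _ p
  obtain ⟨W, hW⟩ := exists_valuationSubring_dominating v θ ψ
  set X : Fin d → FractionRing (MvPolynomial (Fin d) k) :=
    fun i => algebraMap (MvPolynomial (Fin d) k) _ (MvPolynomial.X i)
  have hθX : ∀ n : Fin d → ℤ, θ (monomialAt X n) = monomialAt y n := by
    intro n
    simp [monomialAt, map_prod, map_zpow₀, X, hθ]
  have hψX : ∀ n : Fin d → ℤ, ψ (monomialAt X n) = monomialAt x n := by
    intro n
    simp [monomialAt, map_prod, map_zpow₀, X, hψ]
  have hk : TrivialOn k W.valuation.toAdd := by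
    intro c hc
    rw [Valuation.toAdd_eq_zero_iff]
    have h1 : ψ (algebraMap (MvPolynomial (Fin d) k) _ (MvPolynomial.C c)) =
        algebraMap k K c := by simp [hψ]
    have h2 : θ (algebraMap (MvPolynomial (Fin d) k) _ (MvPolynomial.C c)) = algebraMap k _ c := by
      rw [hθ, MvPolynomial.aeval_C]
    rw [← h1, hW, h2]
    · exact hvk c hc
    · intro h0
      rw [h0, _root_.map_zero] at h1
      exact hc (by simpa using h1.symm)
  have hlin : LinearIndependent ℤ fun i => W.valuation.toAdd.val (x i) := by
    rw [Fintype.linearIndependent_iff]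
    intro n hn
    have h1 : W.valuation.toAdd (monomialAt x n) = 0 := by
      rw [← coe_val (monomialAt_ne_zero hx0 n), val_monomialAt hx0, hn, WithTop.coe_zero]
    have hX0 : monomialAt X n ≠ 0 := by
      intro h0
      have := hθX n
      rw [h0, _root_.map_zero] at this
      exact monomialAt_ne_zero hy0 n this.symm
    rw [Valuation.toAdd_eq_zero_iff, ← hψX, hW _ hX0, hθX, ← WithTop.coe_zero] at h1
    have h2 := val_eq_of_eq_coe h1
    rw [val_monomialAt hy0] at h2
    exact Fintype.linearIndependent_iff.mp hylin n h2
  have hfd := finiteDimensional_of_fg hfg htr hx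
  obtain ⟨b⟩ := nonempty_basis_valueGroup_of_finiteDimensional hk hx0 hlin
  exact ⟨W, IsMaximalRank.of_basis htr hk b⟩

end Existence

/-! ### Growth of the number of values of functions with bounded denominators. -/

section Growth

variable {k K : Type*} [Field k] [Field K] [Algebra k K]

/-- The coefficients of the minimal polynomial over the fraction field of an integrally closed
domain of an element `f` such that `h f` is integral. -/
theorem coeff_minpoly_mul_pow_mem {L : IntermediateField k K} {R : Subalgebra k K}
    [IsIntegrallyClosed R] (hRL : ∀ a ∈ R, a ∈ L)
    (hfrac : ∀ a ∈ L, ∃ p ∈ R, ∃ q ∈ R, a = p / q) {h f : K} (hR : h ∈ R) (h0 : h ≠ 0)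
    (hint : IsIntegral R (h * f)) (hf : IsIntegral L f) (j : ℕ) :
    ((minpoly L f).coeff j : K) * h ^ ((minpoly L f).natDegree - j) ∈ R := by
  let i : R →+* L := R.val.toRingHom.codRestrict L fun a => hRL a a.2
  let : Algebra R L := i.toAlgebra
  have : IsScalarTower R L K := IsScalarTower.of_algebraMap_eq fun _ => rfl
  have : FaithfulSMul R L := by
    rw [faithfulSMul_iff_algebraMap_injective]
    intro a b hab
    exact Subtype.ext (congrArg (fun c : L => (c : K)) hab)
  have : IsFractionRing R L := IsFractionRing.of_field R L fun z => by
    obtain ⟨p, hp, q, hq, hz⟩ := hfrac z z.2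
    exact ⟨⟨p, hp⟩, ⟨q, hq⟩, Subtype.ext hz⟩
  -- The minimal polynomial of `h * f` is that of `f` with its roots scaled by `h`. As `h * f` is
  -- integral over the integrally closed `R`, the scaled coefficients lie in `R`.
  have h1 : minpoly L ((⟨h, hRL h hR⟩ : L) • f) = (minpoly L f).scaleRoots ⟨h, hRL h hR⟩ :=
    IsIntegrallyClosed.minpoly_smul (by simpa [Subtype.ext_iff] using h0) hf
  have h2 : (⟨h, hRL h hR⟩ : L) • f = h * f := rfl
  rw [h2, minpoly.isIntegrallyClosed_eq_field_fractions' L hint] at h1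
  have h3 := congrArg (fun P : Polynomial L => (P.coeff j : K)) h1
  simp only [Polynomial.coeff_map, Polynomial.coeff_scaleRoots, MulMemClass.coe_mul,
    SubmonoidClass.coe_pow] at h3
  rw [← h3]
  exact ((minpoly R (h * f)).coeff j).2

/-- The algebra is a polynomial ring, hence factorial. -/
theorem AlgebraicIndependent.isIntegrallyClosed_adjoin {ι : Type*} {x : ι → K}
    (hx : AlgebraicIndependent k x) : IsIntegrallyClosed (Algebra.adjoin k (Set.range x)) := by
  have : UniqueFactorizationMonoid (Algebra.adjoin k (Set.range x)) :=
    hx.aevalEquiv.toMulEquiv.uniqueFactorizationMonoid inferInstance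
  infer_instance

theorem IntermediateField.exists_div_of_mem_adjoin {s : Set K} {a : K}
    (ha : a ∈ IntermediateField.adjoin k s) :
    ∃ p ∈ Algebra.adjoin k s, ∃ q ∈ Algebra.adjoin k s, a = p / q :=
  IntermediateField.mem_adjoin_iff_div.mp ha

/-- A family of sets in `K` is of bounded denominators if over each subalgebra over which `K` is
algebraic some `h ≠ 0` makes `h ^ n f` integral for all `f` in the `n`-th set. -/
def HasBoundedDenominators (k : Type*) [Field k] [Algebra k K] (F : ℕ → Set K) : Prop :=
  ∀ R : Subalgebra k K, Algebra.IsAlgebraic R K → ∃ h ∈ R, h ≠ 0 ∧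
    ∀ n : ℕ, 1 ≤ n → ∀ f ∈ F n, IsIntegral R (h ^ n * f)

namespace AddValuation

variable {Γ : Type*} [AddCommGroup Γ] [LinearOrder Γ] [IsOrderedAddMonoid Γ]
  {v : AddValuation K (WithTop Γ)} {d : ℕ} {x : Fin d → K}

/-- The coefficients of the minimal polynomials have values bounded below with respect to a
coordinate system `y` of the field `k(x)`. -/
theorem exists_val_coeff_minpoly_bound (hk : TrivialOn k v) (htr : Algebra.trdeg k K = d)
    {F : ℕ → Set K} (hF : HasBoundedDenominators k F) {y : Fin d → K} (hy : ∀ i, y i ≠ 0)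
    (hlin : LinearIndependent ℤ fun i => v.val (y i)) (L : IntermediateField k K)
    (hL : L = IntermediateField.adjoin k (Set.range y)) [FiniteDimensional L K] :
    ∃ B : ℤ, 0 ≤ B ∧ ∀ n : ℕ, 1 ≤ n → ∀ f ∈ F n, ∀ j, ((minpoly L f).coeff j : K) ≠ 0 →
      ∃ e : Fin d → ℤ, (∀ i, -(n * B) ≤ e i) ∧
        v.val ((minpoly L f).coeff j : K) = ∑ i, e i • v.val (y i) := by
  have hind := algebraicIndependent_of_linearIndependent hk hy hlin
  have hbasis : IsTranscendenceBasis k y :=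
    AlgebraicIndependent.isTranscendenceBasis_of_lift_trdeg_le hind
      (by rw [htr]; exact Cardinal.natCast_lt_aleph0) (by simp [htr])
  have hic := hind.isIntegrallyClosed_adjoin
  obtain ⟨h, hR, h0, hint⟩ := hF (Algebra.adjoin k (Set.range y)) hbasis.isAlgebraic
  obtain ⟨a, ha0, ha⟩ := exists_val_eq_of_mem_adjoin hk hy hlin hR h0
  have hRL : ∀ a ∈ Algebra.adjoin k (Set.range y), a ∈ L := fun a ha =>
    hL ▸ IntermediateField.algebra_adjoin_le_adjoin k _ ha
  -- The exponents of a coefficient drop below zero only through a power of `h ^ n`, whose exponent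
  -- `D - j` is at most the degree; `a` are the exponents of the value of `h`.
  refine ⟨Module.finrank L K * ∑ i, a i, mul_nonneg (Int.natCast_nonneg _)
    (Finset.sum_nonneg fun i _ => ha0 i), fun n hn f hf j hj => ?_⟩
  have hfint : IsIntegral L f := Algebra.IsIntegral.isIntegral f
  set D := (minpoly L f).natDegree with hD
  have hmem := coeff_minpoly_mul_pow_mem hRL
    (fun a ha => IntermediateField.exists_div_of_mem_adjoin (hL ▸ ha))
    (pow_mem hR n) (pow_ne_zero n h0) (hint n hn f hf) hfint j
  have hp0 : (h ^ n) ^ (D - j) ≠ 0 := pow_ne_zero _ (pow_ne_zero _ h0)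
  obtain ⟨e, he0, he⟩ := exists_val_eq_of_mem_adjoin hk hy hlin hmem (mul_ne_zero hj hp0)
  refine ⟨fun i => e i - (n * (D - j : ℕ) : ℕ) * a i, fun i => ?_, ?_⟩
  · have h1 : ((D - j : ℕ) : ℤ) * a i ≤ Module.finrank L K * ∑ i, a i := by
      have h2 : D - j ≤ Module.finrank L K := (Nat.sub_le _ _).trans (minpoly.natDegree_le f)
      have h3 : a i ≤ ∑ i, a i := Finset.single_le_sum (fun i _ => ha0 i) (Finset.mem_univ i)
      exact mul_le_mul (by exact_mod_cast h2) h3 (ha0 i) (Int.natCast_nonneg _)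
    have h4 := mul_le_mul_of_nonneg_left h1 (Int.natCast_nonneg n)
    have := he0 i
    push_cast
    rw [mul_assoc]
    linarith
  · rw [val_mul hj hp0, ← pow_mul, val_pow h0, ha] at he
    rw [eq_sub_of_add_eq he]
    simp only [sub_smul, Finset.sum_sub_distrib, mul_smul, Finset.smul_sum, natCast_zsmul]

/-- The basis with one element inverted. -/
theorem linearIndependent_update_inv (hx : ∀ i, x i ≠ 0)
    (hlin : LinearIndependent ℤ fun i => v.val (x i)) (i : Fin d) :
    (∀ j, Function.update x i (x i)⁻¹ j ≠ 0) ∧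
      (LinearIndependent ℤ fun j => v.val (Function.update x i (x i)⁻¹ j)) ∧
      (∀ j, v.val (Function.update x i (x i)⁻¹ j) = (if j = i then -1 else 1 : ℤ) • v.val (x j)) ∧
      IntermediateField.adjoin k (Set.range x) =
        IntermediateField.adjoin k (Set.range (Function.update x i (x i)⁻¹)) := by
  have hval : ∀ j, v.val (Function.update x i (x i)⁻¹ j) =
      (if j = i then -1 else 1 : ℤ) • v.val (x j) := by
    intro j
    by_cases h : j = i
    · subst h; simp [val_inv (hx j)]
    · simp [h]
  refine ⟨fun j => ?_, ?_, hval, ?_⟩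
  · by_cases h : j = i
    · subst h; simpa using hx j
    · simpa [h] using hx j
  · simp only [hval]
    rw [Fintype.linearIndependent_iff] at hlin ⊢
    intro c hc j
    have := hlin (fun j => c j * (if j = i then -1 else 1)) (by simpa only [mul_smul] using hc) j
    by_cases h : j = i <;> simpa [h] using this
  · apply le_antisymm
    · rw [IntermediateField.adjoin_le_iff]
      rintro _ ⟨j, rfl⟩
      have hmem : Function.update x i (x i)⁻¹ j ∈ IntermediateField.adjoin k
          (Set.range (Function.update x i (x i)⁻¹)) :=
        IntermediateField.subset_adjoin _ _ ⟨j, rfl⟩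
      by_cases h : j = i
      · subst h
        simpa using inv_mem hmem
      · simpa [h] using hmem
    · rw [IntermediateField.adjoin_le_iff]
      rintro _ ⟨j, rfl⟩
      have hmem : x j ∈ IntermediateField.adjoin k (Set.range x) :=
        IntermediateField.subset_adjoin _ _ ⟨j, rfl⟩
      by_cases h : j = i
      · subst h
        simpa using hmem
      · simpa [h] using hmem

/-- The exponents of the minimal polynomial coefficients are bounded below by a multiple of `-n`.
Inverting one `x i` turns the lower bound for its exponent into an upper one. The value of `f`,
times `r !`, is an integral multiple of a difference of two coefficient values, so it lies in a box
of side `O(n)`. -/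
theorem exists_ncard_values_le (hk : TrivialOn k v) (htr : Algebra.trdeg k K = d)
    (hx : ∀ i, x i ≠ 0) (hlin : LinearIndependent ℤ fun i => v.val (x i))
    [FiniteDimensional (IntermediateField.adjoin k (Set.range x)) K]
    {F : ℕ → Submodule k K} (hF : HasBoundedDenominators k fun n => (F n : Set K)) :
    ∃ C : ℕ, ∀ n : ℕ, 1 ≤ n → (values v (F n)).Finite ∧ (values v (F n)).ncard ≤ C * n ^ d := by
  set L := IntermediateField.adjoin k (Set.range x) with hL
  set r := Module.finrank L K
  obtain ⟨B, hB0, hB⟩ := exists_val_coeff_minpoly_bound hk htr hF hx hlin L hL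
  choose B' hB'0 hB' using fun i =>
    exists_val_coeff_minpoly_bound hk htr hF (linearIndependent_update_inv (k := k) hx hlin i).1
      (linearIndependent_update_inv (k := k) hx hlin i).2.1 L
      (linearIndependent_update_inv hx hlin i).2.2.2
  set M := B + ∑ i, B' i with hM
  have hM0 : 0 ≤ M := add_nonneg hB0 (Finset.sum_nonneg fun i _ => hB'0 i)
  have hBM : B ≤ M := le_add_of_nonneg_right (Finset.sum_nonneg fun i _ => hB'0 i)
  have hB'M : ∀ i, B' i ≤ M := fun i => (Finset.single_le_sum (fun i _ => hB'0 i)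
    (Finset.mem_univ i)).trans (le_add_of_nonneg_left hB0)
  have hinj : ∀ e e' : Fin d → ℤ, ∑ i, e i • v.val (x i) = ∑ i, e' i • v.val (x i) → e = e' := by
    intro e e' h
    apply val_monomialAt_injective hx hlin
    rwa [val_monomialAt hx, val_monomialAt hx]
  have key : ∀ n : ℕ, 1 ≤ n → ∀ f ∈ F n, ∀ j, ((minpoly L f).coeff j : K) ≠ 0 →
      ∃ e : Fin d → ℤ, (∀ i, |e i| ≤ n * M) ∧
        v.val ((minpoly L f).coeff j : K) = ∑ i, e i • v.val (x i) := by
    intro n hn f hf j hj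
    obtain ⟨e, he0, he⟩ := hB n hn f hf j hj
    refine ⟨e, fun i => ?_, he⟩
    obtain ⟨e', he0', he'⟩ := hB' i n hn f hf j hj
    simp only [(linearIndependent_update_inv (k := k) hx hlin i).2.2.1, smul_smul] at he'
    have hee := hinj _ _ (he.symm.trans he')
    have h1 : e i = -e' i := by simpa using congrFun hee i
    have hn0 : (0 : ℤ) ≤ n := Int.natCast_nonneg n
    have h2 := mul_le_mul_of_nonneg_left hBM hn0
    have h3 := mul_le_mul_of_nonneg_left (hB'M i) hn0
    rw [abs_le]
    constructor
    · linarith [he0 i]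
    · linarith [he0' i]
  -- A difference of two coefficient exponents is at most `2 * n * M` in absolute value, and the
  -- cofactor `q` is at most `r !`.
  set Q : ℤ := 2 * r ! * M with hQ
  have hQ0 : 0 ≤ Q := by positivity
  have hsub : ∀ n : ℕ, 1 ≤ n → (fun γ : Γ => (r ! : ℤ) • γ) '' values v (F n) ⊆
      (fun e : Fin d → ℤ => ∑ i, e i • v.val (x i)) ''
        Set.Icc (fun _ => -(n * Q)) (fun _ => n * Q) := by
    rintro n hn _ ⟨γ, ⟨f, hf, hv⟩, rfl⟩
    have hf0 := ne_zero_of_eq_coe hv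
    have hint : IsIntegral L f := Algebra.IsIntegral.isIntegral f
    obtain ⟨i, j, hij, hj, hi0, hj0, h⟩ := exists_coeff_val_eq (v := v)
      (minpoly.ne_zero hint) hf0 (minpoly.aeval L f)
    obtain ⟨q, hq⟩ : j - i ∣ r ! :=
      Nat.dvd_factorial (by omega) ((Nat.sub_le j i).trans (hj.trans (minpoly.natDegree_le f)))
    obtain ⟨e, hel, he⟩ := key n hn f hf i (by simpa using hi0)
    obtain ⟨e', hel', he'⟩ := key n hn f hf j (by simpa using hj0)
    have hqr : (q : ℤ) ≤ r ! := by
      have : q ≤ r ! := by rw [hq]; exact Nat.le_mul_of_pos_left q (by omega)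
      exact_mod_cast this
    have hbd : ∀ l, |(q : ℤ) * (e l - e' l)| ≤ n * Q := by
      intro l
      rw [abs_mul, abs_of_nonneg (Int.natCast_nonneg q)]
      calc (q : ℤ) * |e l - e' l| ≤ r ! * (n * M + n * M) := by
            refine mul_le_mul hqr ?_ (abs_nonneg _) (Int.natCast_nonneg _)
            exact (abs_sub _ _).trans (add_le_add (hel l) (hel' l))
        _ = n * Q := by rw [hQ]; ring
    refine ⟨fun l => q * (e l - e' l), ⟨fun l => (abs_le.mp (hbd l)).1,
      fun l => (abs_le.mp (hbd l)).2⟩, ?_⟩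
    have hγ : v.val f = γ := val_eq_of_eq_coe hv
    simp only
    rw [← hγ, hq, mul_comm, Nat.cast_mul, mul_smul, h, IntermediateField.algebraMap_apply,
      IntermediateField.algebraMap_apply, he, he']
    simp only [mul_smul, ← Finset.smul_sum, sub_smul, Finset.sum_sub_distrib]
  have hr : (r ! : ℤ) ≠ 0 := by exact_mod_cast Nat.factorial_ne_zero r
  have hsmul : Function.Injective fun γ : Γ => (r ! : ℤ) • γ := zsmul_right_injective hr
  refine ⟨(2 * Q.toNat + 1) ^ d, fun n hn => ?_⟩
  have hfinI : (Set.Icc (fun _ : Fin d => -(n * Q)) (fun _ => n * Q)).Finite := Set.finite_Icc _ _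
  have hfin := ((hfinI.image _).subset (hsub n hn))
  refine ⟨(Set.finite_image_iff hsmul.injOn).mp hfin, ?_⟩
  rw [← Set.ncard_image_of_injective _ hsmul]
  refine (Set.ncard_le_ncard (hsub n hn) (hfinI.image _)).trans
    ((Set.ncard_image_le hfinI).trans ?_)
  rw [← Finset.coe_Icc, Set.ncard_coe_finset, Pi.card_Icc, Finset.prod_const, Finset.card_univ,
    Fintype.card_fin, Int.card_Icc, ← mul_pow]
  refine Nat.pow_le_pow_left ?_ d
  obtain ⟨N, hN⟩ := Int.eq_ofNat_of_zero_le hQ0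
  rw [hN, Int.toNat_natCast]
  have h1 : (n : ℤ) * N + 1 - -(n * N) = ((2 * N * n + 1 : ℕ) : ℤ) := by push_cast; ring
  rw [h1, Int.toNat_natCast]
  nlinarith

end AddValuation

end Growth

/-! ### Rational functions without poles in codimension one -/

section Hartogs

open IsLocalRing

/-- If a normal noetherian local domain has an element of its fraction field outside of it that
is multiplied into it by the maximal ideal, then it is a discrete valuation ring. -/
theorem isDiscreteValuationRing_of_maximalIdeal_smul {A K : Type*} [CommRing A] [IsDomain A]
    [IsLocalRing A] [IsNoetherianRing A] [IsIntegrallyClosed A] [Field K] [Algebra A K]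
    [IsFractionRing A K] {f : K} (hf : f ∉ (algebraMap A K).range)
    (h : ∀ m ∈ maximalIdeal A, algebraMap A K m * f ∈ (algebraMap A K).range) :
    IsDiscreteValuationRing A := by
  have hinj := IsFractionRing.injective A K
  have hfield : ¬ IsField A := by
    intro hA
    let := hA.toField
    exact hf (((IsFractionRing.surjective_iff_isField (R := A) (K := K)).mpr hA) f)
  have hbot : maximalIdeal A ≠ ⊥ := by
    rwa [Ne, ← IsLocalRing.isField_iff_maximalIdeal_eq]
  refine ((IsDiscreteValuationRing.TFAE A hfield).out 0 4).mpr ?_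
  -- If `f` maps the maximal ideal into itself, it stabilizes a nonzero finitely generated module
  -- and is integral, contradicting normality. Otherwise some `m * f` is a unit, and then `m`
  -- generates the maximal ideal.
  by_cases hc : ∀ m ∈ maximalIdeal A, ∃ m' ∈ maximalIdeal A, algebraMap A K m' =
      algebraMap A K m * f
  · exfalso
    let N : Submodule A K := Submodule.map (Algebra.linearMap A K) (maximalIdeal A)
    have hN : N ≠ ⊥ := by
      intro h0
      refine hbot ?_
      refine (Submodule.eq_bot_iff _).mpr fun x hx => ?_
      have := (Submodule.eq_bot_iff _).mp h0 _ (Submodule.mem_map_of_mem hx)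
      rwa [Algebra.linearMap_apply, map_eq_zero_iff _ hinj] at this
    have hint : IsIntegral A f := by
      refine isIntegral_of_smul_mem_submodule N hN ((IsNoetherian.noetherian _).map _) f ?_
      rintro _ ⟨m, hm, rfl⟩
      obtain ⟨m', hm', e⟩ := hc m hm
      refine ⟨m', hm', ?_⟩
      rw [Algebra.linearMap_apply, Algebra.linearMap_apply, e, smul_eq_mul, mul_comm]
    exact hf (IsIntegrallyClosed.isIntegral_iff.mp hint)
  · push Not at hc
    obtain ⟨m, hm, hc⟩ := hc
    obtain ⟨u, hu⟩ := h m hm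
    have hunit : IsUnit u := by
      by_contra h'
      exact hc u h' hu
    obtain ⟨w, rfl⟩ := hunit
    refine ⟨m, le_antisymm (fun a ha => ?_) ?_⟩
    · obtain ⟨b, hb⟩ := h a ha
      refine Ideal.mem_span_singleton'.mpr ⟨b * (↑w⁻¹ : A), hinj ?_⟩
      have hw : algebraMap A K (w : A) * algebraMap A K (↑w⁻¹ : A) = 1 := by
        rw [← map_mul, Units.mul_inv, map_one]
      rw [map_mul, map_mul, hb]
      calc _ = algebraMap A K a * (algebraMap A K m * f * algebraMap A K (↑w⁻¹ : A)) := by ring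
        _ = _ := by rw [← hu, hw, mul_one]
    · exact (Ideal.span_singleton_le_iff_mem _).mpr hm

/-- Algebraic Hartogs: an element of the fraction field of a noetherian domain `B` outside of `B`
is not contained in the localization of `B` at some prime ideal, which is a discrete valuation
ring if it is integrally closed. -/
theorem exists_isPrime_notMem_localization {B K : Type*} [CommRing B] [IsDomain B]
    [IsNoetherianRing B] [Field K] [Algebra B K] {f : K}
    (hf : f ∉ (algebraMap B K).range) :
    ∃ (P : Ideal B) (_ : P.IsPrime), ∀ (A : Type*) [CommRing A] [IsDomain A] [IsLocalRing A]
      [IsIntegrallyClosed A] [Algebra B A] [Algebra A K] [IsScalarTower B A K]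
      [IsFractionRing A K] [IsLocalization.AtPrime A P],
      IsDiscreteValuationRing A ∧ f ∉ (algebraMap A K).range := by
  let N : Submodule B K := LinearMap.range (Algebra.linearMap _ _)
  have hf0 : N.mkQ f ≠ 0 := by
    rw [Ne, Submodule.mkQ_apply, Submodule.Quotient.mk_eq_zero]
    rintro ⟨a, ha⟩
    exact hf ⟨a, ha⟩
  -- `P` is an associated prime of `K / B` containing the annihilator of `f`, and it is the
  -- annihilator of some `y`. Elements outside `P` carry neither `f` nor `y` into `B`, so neither
  -- lies in `A`; but the maximal ideal of `A` multiplies `y` into `A`.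
  obtain ⟨P, hP, hle⟩ := exists_le_isAssociatedPrime_of_isNoetherianRing B _ hf0
  obtain ⟨hPp, y', hy'⟩ := isAssociatedPrime_iff.mp hP
  obtain ⟨y, rfl⟩ := N.mkQ_surjective y'
  have hmem : ∀ (g : K) (a : B), a ∈ (⊥ : Submodule B _).colon {N.mkQ g} ↔
      ∃ b : B, algebraMap _ K b = algebraMap _ K a * g := by
    intro g a
    rw [Submodule.mem_colon_singleton, Submodule.mem_bot, ← map_smul, Submodule.mkQ_apply,
      Submodule.Quotient.mk_eq_zero, Algebra.smul_def]
    rfl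
  refine ⟨P, hPp, fun A => ?_⟩
  intros
  have : IsNoetherianRing A := IsLocalization.isNoetherianRing P.primeCompl A inferInstance
  have key : ∀ g : K, g ∈ (algebraMap A K).range →
      ∃ s : B, s ∉ P ∧ s ∈ (⊥ : Submodule B _).colon {N.mkQ g} := by
    rintro _ ⟨a, rfl⟩
    obtain ⟨⟨b, s⟩, hs⟩ := IsLocalization.surj P.primeCompl a
    refine ⟨s, s.2, (hmem _ _).mpr ⟨b, ?_⟩⟩
    rw [IsScalarTower.algebraMap_apply B A K, IsScalarTower.algebraMap_apply B A K,
      ← hs, map_mul, mul_comm]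
  have hy : y ∉ (algebraMap A K).range := by
    intro h'
    obtain ⟨s, hs, hs'⟩ := key y h'
    exact hs (hy' ▸ hs')
  refine ⟨isDiscreteValuationRing_of_maximalIdeal_smul hy fun m hm => ?_, fun h' => ?_⟩
  · obtain ⟨⟨b, s⟩, hs⟩ := IsLocalization.surj P.primeCompl m
    have hb : b ∈ P := by
      rw [← IsLocalization.AtPrime.to_map_mem_maximal_iff A P, ← hs]
      exact Ideal.mul_mem_right _ _ hm
    rw [hy', hmem] at hb
    obtain ⟨c, hc⟩ := hb
    obtain ⟨w, hw⟩ := IsLocalization.map_units A s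
    have hw1 : algebraMap A K (w : A) * algebraMap A K (↑w⁻¹ : A) = 1 := by
      rw [← map_mul, Units.mul_inv, map_one]
    refine ⟨algebraMap _ A c * (↑w⁻¹ : A), ?_⟩
    rw [map_mul, ← IsScalarTower.algebraMap_apply, hc, IsScalarTower.algebraMap_apply B A K, ← hs,
      map_mul]
    simp only [← hw]
    calc _ = algebraMap A K m * y * (algebraMap A K (w : A) * algebraMap A K (↑w⁻¹ : A)) := by
          ring
      _ = _ := by rw [hw1, mul_one]
  · obtain ⟨s, hs, hs'⟩ := key f h'
    exact hs (hle hs')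

end Hartogs

/-! ### Orders of rational functions on normal schemes. -/

section Schemes

open AlgebraicGeometry CategoryTheory

variable {X : Scheme.{u}} [IsIntegral X] [IsLocallyNoetherian X]

namespace AlgebraicGeometry.Scheme

theorem ord_algebraMap_nonneg (x : X) {a : X.presheaf.stalk x} (ha : a ≠ 0) :
    0 ≤ ord (algebraMap (X.presheaf.stalk x) X.functionField a) x := by
  by_cases hx : Order.coheight x = 1
  · have : Ring.KrullDimLE 1 (X.presheaf.stalk x) := krullDimLE_of_coheight_le hx.le
    rw [le_ord_iff hx ((map_ne_zero_iff _ (IsFractionRing.injective _ _)).mpr ha)]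
    exact Ring.ordFrac_ge_one_of_ne_zero ha
  · rw [ord_eq_zero_of_coheight_neq_one hx]

theorem ord_one (x : X) : ord (1 : X.functionField) x = 0 := by
  have h := ord_mul (x := x) (one_ne_zero (α := X.functionField)) one_ne_zero
  rw [mul_one] at h
  omega

theorem ord_pow {x : X} {f : X.functionField} (hf : f ≠ 0) (n : ℕ) :
    ord (f ^ n) x = n * ord f x := by
  induction n with
  | zero => rw [pow_zero, ord_one, Nat.cast_zero, zero_mul]
  | succ n ih => rw [pow_succ, ord_mul (pow_ne_zero n hf) hf, ih]; push_cast; ring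

theorem ord_inv {x : X} {f : X.functionField} (hf : f ≠ 0) : ord f⁻¹ x = -ord f x := by
  have h := ord_mul (x := x) hf (inv_ne_zero hf)
  rw [mul_inv_cancel₀ hf, ord_one] at h
  omega

variable [IsNormalScheme X]

theorem mem_range_of_ord_nonneg {x : X} (hx : Order.coheight x = 1) {f : X.functionField}
    (h : 0 ≤ ord f x) : f ∈ (algebraMap (X.presheaf.stalk x) X.functionField).range := by
  rcases eq_or_ne f 0 with rfl | hf
  · exact zero_mem _
  have := isDiscreteValuationRing_stalk x hx
  have : Ring.KrullDimLE 1 (X.presheaf.stalk x) := krullDimLE_of_coheight_le hx.le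
  rw [le_ord_iff hx hf] at h
  have h1 : 1 ≤ Ring.ordFrac (X.presheaf.stalk x) f := h
  rw [Ring.ordFrac_eq_valuation_inv] at h1
  have h2 : (IsDiscreteValuationRing.maximalIdeal (X.presheaf.stalk x)).valuation
      X.functionField f ≤ 1 := by
    by_contra h3
    push Not at h3
    exact absurd h1 (not_le.mpr (inv_lt_one_of_one_lt₀ h3))
  exact IsDiscreteValuationRing.exists_lift_of_le_one h2

/-- If the order were zero, the inverse would also be regular and `a` would be a unit. -/
theorem one_le_ord_algebraMap {x : X} (hx : Order.coheight x = 1) {a : X.presheaf.stalk x}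
    (ha : a ≠ 0) (ham : a ∈ IsLocalRing.maximalIdeal (X.presheaf.stalk x)) :
    1 ≤ ord (algebraMap (X.presheaf.stalk x) X.functionField a) x := by
  have := isDiscreteValuationRing_stalk x hx
  have hinj := IsFractionRing.injective (X.presheaf.stalk x) X.functionField
  have ha' := (map_ne_zero_iff _ hinj).mpr ha
  by_contra h
  have h0 : ord (algebraMap (X.presheaf.stalk x) X.functionField a) x = 0 := by
    have := ord_algebraMap_nonneg x ha
    omega
  obtain ⟨b, hb⟩ := mem_range_of_ord_nonneg hx
    (f := (algebraMap (X.presheaf.stalk x) X.functionField a)⁻¹) (by rw [ord_inv ha', h0]; simp)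
  refine (IsLocalRing.mem_maximalIdeal a).mp ham (IsUnit.of_mul_eq_one b (hinj ?_))
  rw [map_mul, hb, mul_inv_cancel₀ ha', map_one]

/-- Algebraic Hartogs: on a normal locally noetherian integral scheme a rational function that is
regular at the points of codimension one of an affine open set is regular there. -/
theorem mem_range_germToFunctionField {U : X.Opens} (hU : IsAffineOpen U) [Nonempty U]
    {f : X.functionField} (h : ∀ x ∈ U, Order.coheight x = 1 → 0 ≤ ord f x) :
    f ∈ (algebraMap Γ(X, U) X.functionField).range := by
  have : IsFractionRing Γ(X, U) X.functionField :=
    functionField_isFractionRing_of_isAffineOpen X U hU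
  have hnoeth : IsNoetherianRing Γ(X, U) := IsLocallyNoetherian.component_noetherian ⟨U, hU⟩
  by_contra hf
  obtain ⟨P, hP, hA⟩ := exists_isPrime_notMem_localization hf
  -- The bad prime is a point of `U`. Its stalk is a discrete valuation ring, so the point has
  -- codimension one, where `f` is regular by assumption.
  let p : PrimeSpectrum Γ(X, U) := ⟨P, hP⟩
  let x : U := ⟨hU.fromSpec p, (hU.isoSpec.inv p).2⟩
  have hxp : hU.primeIdealOf x = p :=
    hU.fromSpec.isOpenEmbedding.injective (hU.fromSpec_primeIdealOf x)
  let := X.presheaf.algebra_section_stalk x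
  have := functionField_isScalarTower X U x
  have hloc := hU.isLocalization_stalk x
  rw [hxp] at hloc
  have : IsIntegrallyClosed (X.presheaf.stalk (x : X)) := IsNormalScheme.normal _
  have : IsLocalization.AtPrime (X.presheaf.stalk (x : X)) P := hloc
  obtain ⟨hdvr, hfA⟩ := hA (X.presheaf.stalk (x : X))
  have hx1 : Order.coheight (x : X) = 1 := by
    have h1 := ringKrullDim_stalk_eq_coheight (x : X)
    rw [IsDiscreteValuationRing.ringKrullDim_eq_one] at h1
    exact_mod_cast h1.symm
  exact hfA (mem_range_of_ord_nonneg hx1 (h x x.2 hx1))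

end AlgebraicGeometry.Scheme

end Schemes

/-! ### Centres of valuation rings and denominators of sections of divisors. -/

section ProperSchemes

open AlgebraicGeometry CategoryTheory

/-- The stalk at a point of codimension one is not a field, and it is a localization of the sections
over `U`: clear the denominator of a nonzero element of its maximal ideal. -/
theorem exists_germ_mem_maximalIdeal {X : Scheme.{u}} {U : X.Opens} (hU : IsAffineOpen U) {x : X}
    (hx : x ∈ U) (hx1 : Order.coheight x = 1) :
    ∃ b : Γ(X, U), b ≠ 0 ∧
      X.presheaf.germ U x hx b ∈ IsLocalRing.maximalIdeal (X.presheaf.stalk x) := by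
  let y : U := ⟨x, hx⟩
  let := X.presheaf.algebra_section_stalk y
  have hloc : IsLocalization.AtPrime (X.presheaf.stalk x) (hU.primeIdealOf y).asIdeal :=
    hU.isLocalization_stalk y
  have hbot : IsLocalRing.maximalIdeal (X.presheaf.stalk x) ≠ ⊥ := by
    rw [Ne, ← IsLocalRing.isField_iff_maximalIdeal_eq]
    intro h
    have h1 := ringKrullDim_stalk_eq_coheight x
    rw [ringKrullDim_eq_zero_of_isField h, hx1] at h1
    exact zero_ne_one h1
  obtain ⟨m, hm, hm0⟩ := Submodule.exists_mem_ne_zero_of_ne_bot hbot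
  obtain ⟨⟨b, s⟩, hs⟩ := IsLocalization.surj (hU.primeIdealOf y).asIdeal.primeCompl m
  refine ⟨b, ?_, ?_⟩
  · rintro rfl
    rw [map_zero] at hs
    exact hm0 ((IsLocalization.map_units _ s).mul_left_eq_zero.mp hs)
  · change algebraMap Γ(X, U) (X.presheaf.stalk x) b ∈ _
    rw [← hs]
    exact Ideal.mul_mem_right _ _ hm

theorem finite_support_weilDivisor {X : Scheme.{u}} [CompactSpace X] (D : WeilDivisor X) :
    {x : X | (D : AlgebraicCycle X ℤ) x ≠ 0}.Finite := by
  have h := (Function.locallyFinsupp.locallyFiniteSupport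
    (D : AlgebraicCycle X ℤ)).finite_inter_support_of_isCompact isCompact_univ
  rwa [Set.univ_inter] at h

theorem nsmul_weilDivisor_apply {X : Scheme.{u}} (D : WeilDivisor X) (n : ℕ) (x : X) :
    ((n • D : WeilDivisor X) : AlgebraicCycle X ℤ) x = n * (D : AlgebraicCycle X ℤ) x := by
  rw [AddSubgroup.coe_nsmul, Function.locallyFinsuppWithin.coe_nsmul, Pi.smul_apply, nsmul_eq_mul]

variable {k : Type u} [Field k] {X : Scheme.{u}} [X.Over (Spec (.of k))] [IsIntegral X]

/-- Valuative criterion: a valuation ring of the function field of a proper integral scheme that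
contains the constants has a centre. -/
theorem exists_range_stalk_le_valuationSubring [UniversallyClosed (X ↘ Spec (.of k))]
    (W : ValuationSubring X.functionField)
    (hW : ∀ c : k, algebraMap k X.functionField c ∈ W) :
    ∃ x : X, ∀ a : X.presheaf.stalk x, algebraMap (X.presheaf.stalk x) X.functionField a ∈ W := by
  let i : k →+* W := (algebraMap k X.functionField).codRestrict W.toSubring hW
  have hsq : CommSq (X.fromSpecStalk (genericPoint X))
      (Spec.map (CommRingCat.ofHom (algebraMap W X.functionField))) (X ↘ Spec (.of k))
      (Spec.map (CommRingCat.ofHom i)) := by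
    constructor
    have h0 : X ↘ Spec (.of k) = X.toSpecΓ ≫ Spec.map (CommRingCat.ofHom (constHom k X)) := by
      rw [constHom, CommRingCat.ofHom_hom, Spec.map_comp, ← Scheme.toSpecΓ_naturality_assoc,
        toSpecΓ_SpecMap_ΓSpecIso_inv, Category.comp_id]
    have h1 : CommRingCat.ofHom (constHom k X) ≫ X.presheaf.germ ⊤ (genericPoint X) trivial =
        CommRingCat.ofHom i ≫ CommRingCat.ofHom (algebraMap W X.functionField) := rfl
    have h2 := congrArg Spec.map h1
    rw [Spec.map_comp, Spec.map_comp] at h2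
    rw [h0, Scheme.fromSpecStalk_toSpecΓ_assoc]
    exact h2
  have hex : ValuativeCriterion.Existence (X ↘ Spec (.of k)) := by
    have h : UniversallyClosed (X ↘ Spec (.of k)) := inferInstance
    rw [UniversallyClosed.eq_valuativeCriterion] at h
    exact h.1
  obtain ⟨l, hl, -⟩ := (hex { R := W, K := X.functionField, commSq := hsq, .. }).exists_lift
  dsimp only at hl
  refine ⟨l (IsLocalRing.closedPoint W), fun a => ?_⟩
  -- The lift restricts to the generic point of `X`, so the induced map from the stalk to `W` is
  -- compatible with the embeddings into the function field.
  have h2 : Scheme.stalkClosedPointTo l ≫ CommRingCat.ofHom (algebraMap W X.functionField) =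
      X.presheaf.stalkSpecializes ((genericPoint_spec X).specializes trivial) := by
    apply Spec.map_injective
    rw [← cancel_mono (X.fromSpecStalk _), Scheme.SpecMap_stalkSpecializes_fromSpecStalk,
      Spec.map_comp, Category.assoc, Scheme.Spec_stalkClosedPointTo_fromSpecStalk, hl]
  have h3 : algebraMap (X.presheaf.stalk _) X.functionField a =
      algebraMap W X.functionField ((Scheme.stalkClosedPointTo l).hom a) := by
    rw [RingHom.algebraMap_toAlgebra, ← h2]
    rfl
  rw [h3]
  exact ((Scheme.stalkClosedPointTo l).hom a).2

/-- It is the fraction field of the finitely generated coordinate ring of an affine open set. -/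
theorem functionField_fg [LocallyOfFiniteType (X ↘ Spec (.of k))] :
    (⊤ : IntermediateField k X.functionField).FG := by
  obtain ⟨U, hU, hxU⟩ : ∃ U : X.Opens, IsAffineOpen U ∧ genericPoint X ∈ U := by
    obtain ⟨_, ⟨A, hA, rfl⟩, hxA, -⟩ :=
      X.isBasis_affineOpens.exists_subset_of_mem_open (Set.mem_univ (genericPoint X)) isOpen_univ
    exact ⟨A, hA, hxA⟩
  have : Nonempty U := ⟨⟨_, hxU⟩⟩
  have hfin := (X ↘ Spec (.of k)).finiteType_appLE (isAffineOpen_top _) hU le_top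
  let i : k →+* Γ(X, U) := ((X ↘ Spec (.of k)).appLE ⊤ U le_top).hom.comp
    (Scheme.ΓSpecIso (.of k)).inv.hom
  have hi : i.FiniteType := hfin.comp (RingHom.FiniteType.of_surjective _
    (Scheme.ΓSpecIso (.of k)).symm.commRingCatIsoToRingEquiv.surjective)
  let : Algebra k Γ(X, U) := i.toAlgebra
  have : Algebra.FiniteType k Γ(X, U) := hi
  have : IsFractionRing Γ(X, U) X.functionField :=
    functionField_isFractionRing_of_isAffineOpen X U hU
  have : IsScalarTower k Γ(X, U) X.functionField := by
    refine IsScalarTower.of_algebraMap_eq fun c => ?_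
    change X.presheaf.germ ⊤ _ _ _ = X.presheaf.germ U _ _ (X.presheaf.map _ _)
    rw [X.presheaf.germ_res_apply]
    rfl
  have : Algebra.EssFiniteType Γ(X, U) X.functionField :=
    .of_isLocalization _ (nonZeroDivisors Γ(X, U))
  have : Algebra.EssFiniteType k X.functionField := .comp k Γ(X, U) _
  exact IntermediateField.fg_top k _

variable [IsLocallyNoetherian X]

theorem ord_germToFunctionField_nonneg {U : X.Opens} [Nonempty U] {x : X} (hx : x ∈ U)
    {b : Γ(X, U)} (hb : b ≠ 0) : 0 ≤ Scheme.ord (X.germToFunctionField U b) x := by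
  rw [← Scheme.algebraMap_germ_eq_germToFunctionField X hx]
  exact Scheme.ord_algebraMap_nonneg x
    ((map_ne_zero_iff _ (germ_injective_of_isIntegral X x hx)).mpr hb)

variable [IsNormalScheme X]

/-- A local equation for a multiple of the positive part of a Weil divisor. -/
theorem exists_le_ord_germToFunctionField [CompactSpace X] (D : WeilDivisor X) {U : X.Opens}
    (hU : IsAffineOpen U) [Nonempty U] :
    ∃ a : Γ(X, U), a ≠ 0 ∧ ∀ x ∈ U, Order.coheight x = 1 →
      (D : AlgebraicCycle X ℤ) x ≤ Scheme.ord (X.germToFunctionField U a) x := by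
  classical
  have hb : ∀ x : X, ∃ b : Γ(X, U), b ≠ 0 ∧ ∀ hx : x ∈ U, Order.coheight x = 1 →
      1 ≤ Scheme.ord (X.germToFunctionField U b) x := by
    intro x
    by_cases h : x ∈ U ∧ Order.coheight x = 1
    · obtain ⟨b, hb0, hb⟩ := exists_germ_mem_maximalIdeal hU h.1 h.2
      refine ⟨b, hb0, fun hx hx1 => ?_⟩
      rw [← Scheme.algebraMap_germ_eq_germToFunctionField X hx]
      exact Scheme.one_le_ord_algebraMap hx1
        ((map_ne_zero_iff _ (germ_injective_of_isIntegral X x hx)).mpr hb0) hb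
    · exact ⟨1, one_ne_zero, fun hx hx1 => absurd ⟨hx, hx1⟩ h⟩
  choose b hb0 hb using hb
  set s := (finite_support_weilDivisor D).toFinset with hs
  set e : X → ℕ := fun x => ((D : AlgebraicCycle X ℤ) x).toNat
  -- Each point of the support contributes a function vanishing there to the power of its
  -- multiplicity; `toNat` gives exponent zero at the negative multiplicities.
  refine ⟨∏ y ∈ s, b y ^ e y, Finset.prod_ne_zero_iff.mpr fun y _ => pow_ne_zero _ (hb0 y),
    fun x hx hx1 => ?_⟩
  have hrest : ∀ t : Finset X, 0 ≤ Scheme.ord (X.germToFunctionField U (∏ y ∈ t, b y ^ e y)) x :=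
    fun t => ord_germToFunctionField_nonneg hx
      (Finset.prod_ne_zero_iff.mpr fun y _ => pow_ne_zero _ (hb0 y))
  by_cases hxs : x ∈ s
  · have hinj := Scheme.germToFunctionField_injective X U
    rw [← Finset.mul_prod_erase s _ hxs, map_mul, map_pow, Scheme.ord_mul, Scheme.ord_pow]
    · have h1 := hb x hx hx1
      have h2 := hrest (s.erase x)
      have h3 : (D : AlgebraicCycle X ℤ) x ≤ e x := Int.self_le_toNat _
      have h4 : (e x : ℤ) * 1 ≤ e x * Scheme.ord (X.germToFunctionField U (b x)) x :=
        mul_le_mul_of_nonneg_left h1 (Int.natCast_nonneg _)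
      linarith
    · exact (map_ne_zero_iff _ hinj).mpr (hb0 x)
    · exact pow_ne_zero _ ((map_ne_zero_iff _ hinj).mpr (hb0 x))
    · exact (map_ne_zero_iff _ hinj).mpr
        (Finset.prod_ne_zero_iff.mpr fun y _ => pow_ne_zero _ (hb0 y))
  · have h0 : (D : AlgebraicCycle X ℤ) x = 0 := by
      by_contra h
      exact hxs ((finite_support_weilDivisor D).mem_toFinset.mpr h)
    rw [h0]
    exact hrest s

theorem mem_sectionSpace {D : WeilDivisor X} {f : X.functionField} (hf : f ≠ 0) :
    f ∈ sectionSpace k X D ↔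
      ∀ x : X, Order.coheight x = 1 → -((D : AlgebraicCycle X ℤ) x) ≤ Scheme.ord f x :=
  ⟨fun h => h.resolve_left hf, Or.inr⟩

/-- On an affine open set the sections of the multiples of a divisor have a common denominator. -/
theorem exists_pow_mul_mem_range [CompactSpace X] (D : WeilDivisor X) {U : X.Opens}
    (hU : IsAffineOpen U) [Nonempty U] :
    ∃ a : X.functionField, a ≠ 0 ∧ ∀ n : ℕ, ∀ f ∈ sectionSpace k X (n • D),
      a ^ n * f ∈ (algebraMap Γ(X, U) X.functionField).range := by
  obtain ⟨a, ha0, ha⟩ := exists_le_ord_germToFunctionField D hU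
  have ha0' : X.germToFunctionField U a ≠ 0 :=
    (map_ne_zero_iff _ (Scheme.germToFunctionField_injective X U)).mpr ha0
  refine ⟨X.germToFunctionField U a, ha0', fun n f hf => ?_⟩
  rcases eq_or_ne f 0 with rfl | hf0
  · rw [mul_zero]
    exact zero_mem _
  refine Scheme.mem_range_germToFunctionField hU fun x hx hx1 => ?_
  rw [Scheme.ord_mul (pow_ne_zero n ha0') hf0, Scheme.ord_pow ha0']
  have h1 := (mem_sectionSpace hf0).mp hf x hx1
  rw [nsmul_weilDivisor_apply] at h1
  have h2 := mul_le_mul_of_nonneg_left (ha x hx hx1) (Int.natCast_nonneg n)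
  linarith

/-- On each set `U x` of a finite affine cover the sections have a common denominator `a x`. Choose
`h` with all `h / a x` integral over `R`. Integrality of `h ^ n * f` is tested on valuation rings:
by properness such a ring has a centre in some `U x`, and it contains both `(h / a x) ^ n` and the
regular function `a x ^ n * f`. -/
theorem hasBoundedDenominators_sectionSpace [IsProper (X ↘ Spec (.of k))] (D : WeilDivisor X) :
    HasBoundedDenominators k
      fun n => (sectionSpace k X (n • D) : Set X.functionField) := by
  intro R hR
  have : CompactSpace X := QuasiCompact.compactSpace_of_compactSpace (X ↘ Spec (.of k))
  have hU : ∀ x : X, ∃ U : X.Opens, IsAffineOpen U ∧ x ∈ U := fun x => by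
    obtain ⟨_, ⟨A, hA, rfl⟩, hxA, -⟩ :=
      X.isBasis_affineOpens.exists_subset_of_mem_open (Set.mem_univ x) isOpen_univ
    exact ⟨A, hA, hxA⟩
  choose U hU hxU using hU
  have hne : ∀ x, Nonempty (U x) := fun x => ⟨⟨x, hxU x⟩⟩
  choose a ha0 ha using fun x => exists_pow_mul_mem_range (k := k) D (hU x)
  obtain ⟨t, ht⟩ := isCompact_univ.elim_finite_subcover (fun x => (U x : Set X))
    (fun x => (U x).isOpen) fun x _ => Set.mem_iUnion.mpr ⟨x, hxU x⟩
  classical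
  obtain ⟨h, h0, hint⟩ := Algebra.IsAlgebraic.exists_integral_multiples (R := R)
    (A := X.functionField) (t.image fun x => (a x)⁻¹)
  refine ⟨h, h.2, fun h' => h0 (Subtype.ext h'), fun n hn f hf => ?_⟩
  let C : Subring X.functionField := (integralClosure R X.functionField).toSubring
  have : IsIntegrallyClosedIn C X.functionField :=
    inferInstanceAs (IsIntegrallyClosedIn (integralClosure R X.functionField) _)
  by_contra hcon
  obtain ⟨V, hCV, hV⟩ := Subring.exists_le_valuationSubring_of_isIntegrallyClosedIn
    (R := C) (x := (h : X.functionField) ^ n * f) hcon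
  refine hV ?_
  have hRV : ∀ r ∈ R, r ∈ V := fun r hr =>
    hCV (isIntegral_algebraMap (R := R) (A := X.functionField) (x := ⟨r, hr⟩))
  obtain ⟨y, hy⟩ := exists_range_stalk_le_valuationSubring V
    fun c => hRV _ (R.algebraMap_mem c)
  obtain ⟨x, hxt, hyx⟩ := Set.mem_iUnion₂.mp (ht (Set.mem_univ y))
  obtain ⟨b, hb⟩ := ha x n f hf
  have h1 : (h : X.functionField) * (a x)⁻¹ ∈ V :=
    hCV (hint _ (Finset.mem_image_of_mem _ hxt))
  have h2 : a x ^ n * f ∈ V := by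
    rw [← hb]
    change X.germToFunctionField (U x) b ∈ V
    rw [← Scheme.algebraMap_germ_eq_germToFunctionField X hyx]
    exact hy _
  have h3 : (h : X.functionField) ^ n * f = (h * (a x)⁻¹) ^ n * (a x ^ n * f) := by
    rw [mul_pow, inv_pow, mul_assoc, inv_mul_cancel_left₀ (pow_ne_zero n (ha0 x))]
  rw [h3]
  exact V.mul_mem _ _ (V.pow_mem h1 n) h2

end ProperSchemes

/-! ### Valuations with residue field `k` -/

section ResidueField

variable {k K Γ : Type*} [Field k] [Field K] [Algebra k K]
  [AddCommGroup Γ] [LinearOrder Γ] [IsOrderedAddMonoid Γ] {v : AddValuation K (WithTop Γ)}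

/-- For `x` and `w` in a leaf the quotient `x / w` is congruent to a constant `c`, so `x - c • w`
has value greater than `γ` and must vanish. -/
theorem HasResidueField.rank_le_one_of_isLeaf (h : HasResidueField k v) {W : Submodule k K} {γ : Γ}
    (hW : AddValuation.IsLeaf v W γ) : Module.rank k W ≤ 1 := by
  rw [rank_submodule_le_one_iff']
  by_cases h0 : W = ⊥
  · exact ⟨0, by rw [h0]; exact bot_le⟩
  obtain ⟨w, hw, hw0⟩ := Submodule.exists_mem_ne_zero_of_ne_bot h0
  refine ⟨w, fun x hx => ?_⟩
  rcases eq_or_ne x 0 with rfl | hx0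
  · exact zero_mem _
  have hvw := hW w hw hw0
  have hvx := hW x hx hx0
  have h1 : v (x / w) = 0 := by
    have h2 : v x = v (x / w) + v w := by rw [← AddValuation.map_mul, div_mul_cancel₀ _ hw0]
    rw [hvx, hvw] at h2
    have h3 : v (x / w) ≠ ⊤ := by
      intro h; rw [h, top_add] at h2; exact WithTop.coe_ne_top h2
    obtain ⟨δ, hδ⟩ := WithTop.ne_top_iff_exists.mp h3
    rw [← hδ, ← WithTop.coe_add, WithTop.coe_inj] at h2
    rw [← hδ, right_eq_add.mp h2, WithTop.coe_zero]
  obtain ⟨c, hc⟩ := h _ h1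
  rw [Submodule.mem_span_singleton]
  refine ⟨c, ?_⟩
  by_contra hne
  have h4 : x - c • w ∈ W := W.sub_mem hx (W.smul_mem c hw)
  have h5 := hW _ h4 (sub_ne_zero.mpr (Ne.symm hne))
  have h6 : x - c • w = (x / w - algebraMap k K c) * w := by
    rw [sub_mul, div_mul_cancel₀ _ hw0, Algebra.smul_def]
  rw [h6, AddValuation.map_mul, hvw] at h5
  have h7 : (0 : WithTop Γ) + γ < v (x / w - algebraMap k K c) + γ :=
    WithTop.add_lt_add_right WithTop.coe_ne_top hc
  rw [h5, zero_add] at h7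
  exact lt_irrefl _ h7

/-- If no constant is congruent to `x`, all linear polynomials in `x` have value zero, and hence all
nonzero polynomials do. Then `k[x]` is an infinite-dimensional leaf. -/
theorem hasResidueField_of_isAlgClosed [IsAlgClosed k] (hk : AddValuation.TrivialOn k v) {l : ℕ}
    (hl : ∀ (W : Submodule k K) (γ : Γ), AddValuation.IsLeaf v W γ → Module.rank k W ≤ l) :
    HasResidueField k v := by
  intro x hx
  by_contra! hcon
  have hc : ∀ c : k, v (x - algebraMap k K c) = 0 := by
    intro c
    refine le_antisymm (hcon c) ?_
    have h := AddValuation.map_sub v x (algebraMap k K c)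
    refine le_trans (le_min hx.ge ?_) h
    rcases eq_or_ne c 0 with rfl | h0
    · simp
    · exact (hk c h0).ge
  have hp : ∀ p : Polynomial k, p ≠ 0 → v (Polynomial.aeval x p) = 0 := by
    intro p hp
    rw [(IsAlgClosed.splits p).eq_prod_roots]
    rw [map_mul, Polynomial.aeval_C, AddValuation.map_mul,
      hk _ (Polynomial.leadingCoeff_ne_zero.mpr hp), zero_add]
    generalize p.roots = s
    induction s using Multiset.induction with
    | empty => simp
    | cons a s ih =>
      rw [Multiset.map_cons, Multiset.prod_cons, map_mul, AddValuation.map_mul, ih, add_zero,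
        map_sub, Polynomial.aeval_X, Polynomial.aeval_C, hc]
  have hinj : Function.Injective (Polynomial.aeval (R := k) x).toLinearMap := by
    rw [← LinearMap.ker_eq_bot, LinearMap.ker_eq_bot']
    intro p h0
    by_contra h
    have := hp p h
    rw [show Polynomial.aeval x p = 0 from h0, AddValuation.map_zero] at this
    exact WithTop.top_ne_zero this
  have hleaf : AddValuation.IsLeaf v (LinearMap.range (Polynomial.aeval (R := k) x).toLinearMap)
      (0 : Γ) := by
    rintro _ ⟨p, rfl⟩ h0
    refine hp p ?_
    rintro rfl
    exact h0 (_root_.map_zero _)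
  have h1 := hl _ _ hleaf
  have hfin := Module.rank_lt_aleph0_iff.mp (h1.trans_lt (Cardinal.natCast_lt_aleph0))
  exact Polynomial.not_finite (R := k)
    (Module.Finite.equiv (LinearEquiv.ofInjective _ hinj).symm)

theorem IsMaximalRank.exists_rank_le_of_isLeaf {d : ℕ}
    (hfg : (⊤ : IntermediateField k K).FG) (hv : IsMaximalRank k d v) :
    ∃ l : ℕ, ∀ (W : Submodule k K) (γ : Γ), AddValuation.IsLeaf v W γ → Module.rank k W ≤ l := by
  obtain ⟨x, hx, hlin, hfin⟩ := hv.exists_finiteDimensional hfg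
  exact ⟨_, fun W γ hW => AddValuation.rank_le_of_isLeaf hv.trivial_on hx hlin hW⟩

end ResidueField

theorem tendsto_ennreal_natCast_div_pow {a : ℕ → ℕ} {d : ℕ} {L : ℝ}
    (h : Tendsto (fun n : ℕ => (a n : ℝ) / (n : ℝ) ^ d) atTop (𝓝 L)) :
    Tendsto (fun n : ℕ => (a n : ℝ≥0∞) / (n : ℝ≥0∞) ^ d) atTop (𝓝 (ENNReal.ofReal L)) := by
  refine (ENNReal.tendsto_ofReal h).congr' ?_
  filter_upwards [eventually_ge_atTop 1] with n hn
  have hn' : (0 : ℝ) < (n : ℝ) ^ d := by positivity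
  rw [ENNReal.ofReal_div_of_pos hn', ENNReal.ofReal_pow (Nat.cast_nonneg n),
    ENNReal.ofReal_natCast, ENNReal.ofReal_natCast]

/-! ### The Okounkov body of an effective divisor. -/

section EffectiveDivisors

open AlgebraicGeometry CategoryTheory

variable {k : Type u} [Field k] {X : Scheme.{u}} [X.Over (Spec (.of k))] [IsIntegral X]
  [IsLocallyNoetherian X] [IsNormalScheme X]

theorem mul_mem_sectionSpace {D E : WeilDivisor X} {f g : X.functionField}
    (hf : f ∈ sectionSpace k X D) (hg : g ∈ sectionSpace k X E) :
    f * g ∈ sectionSpace k X (D + E) := by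
  rcases eq_or_ne f 0 with rfl | hf0
  · rw [zero_mul]; exact zero_mem _
  rcases eq_or_ne g 0 with rfl | hg0
  · rw [mul_zero]; exact zero_mem _
  refine (mem_sectionSpace (mul_ne_zero hf0 hg0)).mpr fun x hx => ?_
  have h1 := (mem_sectionSpace hf0).mp hf x hx
  have h2 := (mem_sectionSpace hg0).mp hg x hx
  have h3 : ((D + E : WeilDivisor X) : AlgebraicCycle X ℤ) x =
      (D : AlgebraicCycle X ℤ) x + (E : AlgebraicCycle X ℤ) x := rfl
  rw [Scheme.ord_mul hf0 hg0, h3]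
  linarith

theorem one_mem_sectionSpace {D : WeilDivisor X} (hD : 0 ≤ (D : AlgebraicCycle X ℤ)) :
    (1 : X.functionField) ∈ sectionSpace k X D := by
  refine (mem_sectionSpace one_ne_zero).mpr fun x hx => ?_
  rw [Scheme.ord_one]
  have h : 0 ≤ (D : AlgebraicCycle X ℤ) x := hD x
  linarith

variable [IsProper (X ↘ Spec (.of k))] {Γ : Type*} [AddCommGroup Γ] [LinearOrder Γ]
  [IsOrderedAddMonoid Γ] {d : ℕ} {v : AddValuation X.functionField (WithTop Γ)}

theorem IsMaximalRank.exists_ncard_valueSet_sectionSpace_le (hv : IsMaximalRank k d v)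
    (D : WeilDivisor X) :
    ∃ C : ℕ, ∀ n : ℕ, 1 ≤ n → (valueSet v (fun n => sectionSpace k X (n • D)) n).Finite ∧
      (valueSet v (fun n => sectionSpace k X (n • D)) n).ncard ≤ C * n ^ d := by
  obtain ⟨x, hx, hlin, hfin⟩ := hv.exists_finiteDimensional functionField_fg
  simp only [valueSet_finite_iff, ncard_valueSet]
  exact AddValuation.exists_ncard_values_le hv.trivial_on hv.trdeg_eq hx hlin
    (hasBoundedDenominators_sectionSpace D)

theorem IsMaximalRank.finite_and_finrank_sectionSpace_le (hv : IsMaximalRank k d v)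
    (D : WeilDivisor X) {l : ℕ}
    (hl : ∀ (W : Submodule k X.functionField) (γ : Γ), AddValuation.IsLeaf v W γ →
      Module.rank k W ≤ l) {n : ℕ} (hn : 1 ≤ n) :
    Module.Finite k (sectionSpace k X (n • D)) ∧
      Module.finrank k (sectionSpace k X (n • D)) ≤
        l * (valueSet v (fun n => sectionSpace k X (n • D)) n).ncard := by
  obtain ⟨C, hC⟩ := hv.exists_ncard_valueSet_sectionSpace_le D
  have h := (hC n hn).1
  rw [valueSet_finite_iff] at h
  rw [ncard_valueSet]
  exact AddValuation.finite_and_finrank_le_mul_ncard_values hv.trivial_on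
    (fun W _ γ hW => hl W γ hW) h

/-- Leaves are lines, so the dimension of `L(X, nD)` equals its number of values, whose quotient by
`n ^ d` tends to the volume of the body. The bound on values also supplies the growth condition. -/
theorem okounkovBody_of_effective_divisor {D : WeilDivisor X} (hv : IsMaximalRank k d v)
    (hres : IsAlgClosed k ∨ HasResidueField k v) (hD : 0 ≤ (D : AlgebraicCycle X ℤ))
    (hgen : IntermediateField.adjoin k
      (⋃ n ≥ 1, (sectionSpace k X (n • D) : Set X.functionField)) = ⊤) :
    IsOkounkovFiltration d (fun n => sectionSpace k X (n • D)) ∧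
    Nonempty (Module.Basis (Fin d) ℤ (valueGroup v)) ∧
    ∀ b : Module.Basis (Fin d) ℤ (valueGroup v),
      lebesgueMeasure b (okounkovBody v (fun n => sectionSpace k X (n • D))) =
        divisorVolume k X d D / (d ! : ℝ≥0∞) := by
  obtain ⟨l, hl⟩ := hv.exists_rank_le_of_isLeaf functionField_fg
  have hres' : HasResidueField k v := by
    rcases hres with h | h
    · exact hasResidueField_of_isAlgClosed hv.trivial_on hl
    · exact h
  obtain ⟨C, hC⟩ := hv.exists_ncard_valueSet_sectionSpace_le D
  have hrank : ∀ n : ℕ, 1 ≤ n → Module.Finite k (sectionSpace k X (n • D)) ∧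
      Module.finrank k (sectionSpace k X (n • D)) =
        (valueSet v (fun n => sectionSpace k X (n • D)) n).ncard := by
    intro n hn
    obtain ⟨h1, h2⟩ := hv.finite_and_finrank_sectionSpace_le D (l := 1)
      (fun W γ hW => by rw [Nat.cast_one]; exact hres'.rank_le_one_of_isLeaf hW) hn
    refine ⟨h1, le_antisymm (by rwa [one_mul] at h2) ?_⟩
    rw [ncard_valueSet]
    exact (AddValuation.finite_values_and_ncard_le _ hv.trivial_on).2
  have hS : IsOkounkovFiltration d (fun n => sectionSpace k X (n • D)) := {
    one_mem := one_mem_sectionSpace (by rwa [one_smul])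
    mul_le := fun m n _ _ => Submodule.mul_le.mpr fun f hf g hg => by
      rw [add_smul]
      exact mul_mem_sectionSpace hf hg
    generates := hgen
    growth := ⟨fun n hn => (hrank n hn).1, C, fun n hn => by
      rw [(hrank n hn).2]
      exact_mod_cast (hC n hn).2⟩ }
  obtain ⟨hb, hfin, hcomp, h⟩ := okounkovBody_of_filtered_algebra functionField_fg hv hS
  refine ⟨hS, hb, fun b => ?_⟩
  have hlim := tendsto_ennreal_natCast_div_pow
    (hS.isGeneratingFiltration.tendsto_ncard_div b hfin hcomp)
  rw [ENNReal.ofReal_toReal (h b).1.ne] at hlim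
  have hlim' : Tendsto (fun n : ℕ => (Module.finrank k (sectionSpace k X (n • D)) : ℝ≥0∞) /
      (n : ℝ≥0∞) ^ d) atTop
      (𝓝 (lebesgueMeasure b (okounkovBody v (fun n => sectionSpace k X (n • D))))) := by
    refine hlim.congr' ?_
    filter_upwards [eventually_ge_atTop 1] with n hn
    rw [(hrank n hn).2]
  rw [divisorVolume, hlim'.limsup_eq, mul_comm, ENNReal.mul_div_cancel_right
    (by exact_mod_cast Nat.factorial_ne_zero d) (ENNReal.natCast_ne_top _)]

end EffectiveDivisors

/-! ### The growth of a generating filtration -/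

section FiltrationGrowth

variable {k K Γ : Type*} [Field k] [Field K] [Algebra k K]
  [AddCommGroup Γ] [LinearOrder Γ] [IsOrderedAddMonoid Γ] {v : AddValuation K (WithTop Γ)}

theorem AddValuation.TrivialOn.isLeaf_span_singleton (hk : AddValuation.TrivialOn k v) {w : K}
    (hw : w ≠ 0) : AddValuation.IsLeaf v (k ∙ w) (v.val w) := by
  intro x hx hx0
  obtain ⟨c, rfl⟩ := Submodule.mem_span_singleton.mp hx
  have hc : c ≠ 0 := by rintro rfl; exact hx0 (zero_smul _ _)
  rw [hk.map_smul hc, AddValuation.coe_val hw]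

/-- A leaf of the largest possible dimension among those contained in the `S n`. -/
theorem exists_isLeaf_forall_rank_le {l₀ : ℕ}
    (hl : ∀ (W : Submodule k K) (γ : Γ), AddValuation.IsLeaf v W γ → Module.rank k W ≤ l₀)
    (S : ℕ → Submodule k K) :
    ∃ m ≥ 1, ∃ W ≤ S m, ∃ γ : Γ, AddValuation.IsLeaf v W γ ∧ Module.Finite k W ∧
      ∀ n ≥ 1, ∀ W' ≤ S n, ∀ γ : Γ, AddValuation.IsLeaf v W' γ →
        Module.rank k W' ≤ (Module.finrank k W : ℕ) := by
  have hfin : ∀ (W : Submodule k K) (γ : Γ), AddValuation.IsLeaf v W γ → Module.Finite k W :=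
    fun W γ hW => Module.rank_lt_aleph0_iff.mp ((hl W γ hW).trans_lt (Cardinal.natCast_lt_aleph0))
  let A : Set ℕ := {l | ∃ m ≥ 1, ∃ W ≤ S m, ∃ γ : Γ, AddValuation.IsLeaf v W γ ∧
    Module.finrank k W = l}
  have hA : BddAbove A := by
    refine ⟨l₀, ?_⟩
    rintro _ ⟨m, -, W, -, γ, hW, rfl⟩
    exact Module.finrank_le_of_rank_le (hl W γ hW)
  -- The zero space is vacuously a leaf.
  have hne : A.Nonempty := ⟨_, 1, le_rfl, ⊥, bot_le, 0, fun w hw hw0 =>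
    absurd ((Submodule.mem_bot k).mp hw) hw0, rfl⟩
  obtain ⟨m, hm, W, hWS, γ, hW, hWl⟩ := Nat.sSup_mem hne hA
  refine ⟨m, hm, W, hWS, γ, hW, hfin W γ hW, fun n hn W' hW'S γ' hW' => ?_⟩
  have := hfin W' γ' hW'
  rw [← Module.finrank_eq_rank, hWl]
  exact_mod_cast le_csSup hA ⟨n, hn, W', hW'S, γ', hW', rfl⟩

variable {d : ℕ} {S : ℕ → Submodule k K}

/-- Multiplying elements of distinct values in `S n` by a leaf of maximal dimension `l` in `S m`
gives `l * #V n ≤ dim S (n + m)`, while maximality gives `dim S (n + m) ≤ l * #V (n + m)`. A shift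
by `m` does not affect the limit. -/
theorem IsGeneratingFiltration.exists_tendsto_finrank_div (hS : IsGeneratingFiltration S)
    (hfg : (⊤ : IntermediateField k K).FG) (hv : IsMaximalRank k d v) {C : ℝ}
    (hC : ∀ n : ℕ, 1 ≤ n → (valueSet v S n).Finite ∧
      ((valueSet v S n).ncard : ℝ) ≤ C * (n : ℝ) ^ d) :
    (∀ n ≥ 1, Module.Finite k (S n)) ∧ ∃ L : ℝ, 0 < L ∧
      Tendsto (fun n : ℕ => (Module.finrank k (S n) : ℝ) / (n : ℝ) ^ d) atTop (𝓝 L) := by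
  obtain ⟨b⟩ := hv.nonempty_basis hfg
  obtain ⟨l₀, hl₀⟩ := hv.exists_rank_le_of_isLeaf hfg
  obtain ⟨m, hm, W, hWS, γ, hW, hWfin, hl⟩ := exists_isLeaf_forall_rank_le hl₀ S
  set l := Module.finrank k W
  have hfin : ∀ n ≥ 1, (valueSet v S n).Finite := fun n hn => (hC n hn).1
  have hcomp : IsCompact (okounkovBody v S) :=
    hS.isCompact_okounkovBody b hfin fun n hn => (hC n hn).2
  have hup : ∀ n ≥ 1, Module.Finite k (S n) ∧
      Module.finrank k (S n) ≤ l * (valueSet v S n).ncard := fun n hn => by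
    rw [ncard_valueSet]
    exact AddValuation.finite_and_finrank_le_mul_ncard_values hv.trivial_on (hl n hn)
      ((valueSet_finite_iff n).mp (hfin n hn))
  have hlow : ∀ n ≥ 1, l * (valueSet v S n).ncard ≤ Module.finrank k (S (n + m)) := by
    intro n hn
    have := (hup (n + m) (by omega)).1
    have hval := (valueSet_finite_iff n).mp (hfin n hn)
    rw [ncard_valueSet, Set.ncard_eq_toFinset_card _ hval]
    exact AddValuation.mul_card_le_finrank hW
      (fun f hf w hw => hS.mul_mem n m hn hm f hf w (hWS hw)) _ (by simp)
  -- A line spanned by a nonzero element of some `S n` is a leaf; thus the limit is positive.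
  have hl1 : 1 ≤ l := by
    obtain ⟨n, -, hn, -, -, f, hf, -, -, hf0, -⟩ := hS.exists_div 0 1 one_ne_zero
    have h1 := hl n hn (k ∙ f) ((Submodule.span_singleton_le_iff_mem _ _).mpr hf) _
      (AddValuation.TrivialOn.isLeaf_span_singleton hv.trivial_on hf0)
    have h2 := Module.finrank_le_of_rank_le h1
    rwa [finrank_span_singleton hf0] at h2
  have hlim := hS.tendsto_ncard_div b hfin hcomp
  have hTpos : 0 < (lebesgueMeasure b (okounkovBody v S)).toReal :=
    ENNReal.toReal_pos (hS.lebesgueMeasure_okounkovBody_pos b).ne'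
      (IsGeneratingFiltration.lebesgueMeasure_okounkovBody_lt_top b hcomp).ne
  set T := (lebesgueMeasure b (okounkovBody v S)).toReal
  refine ⟨fun n hn => (hup n hn).1, l * T, mul_pos (by exact_mod_cast hl1) hTpos, ?_⟩
  rw [← tendsto_add_atTop_iff_nat m]
  have hright : Tendsto (fun n : ℕ => (l : ℝ) * (((valueSet v S (n + m)).ncard : ℝ) /
      ((n + m : ℕ) : ℝ) ^ d)) atTop (𝓝 (l * T)) :=
    ((tendsto_add_atTop_iff_nat m).mpr hlim).const_mul _
  have hq : Tendsto (fun n : ℕ => (n : ℝ) / ((n + m : ℕ) : ℝ)) atTop (𝓝 1) := by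
    have h := tendsto_natCast_div_add_atTop (𝕜 := ℝ) (m : ℝ)
    refine h.congr fun n => by push_cast; rfl
  have hleft : Tendsto (fun n : ℕ => (l : ℝ) * (((valueSet v S n).ncard : ℝ) / (n : ℝ) ^ d *
      ((n : ℝ) / ((n + m : ℕ) : ℝ)) ^ d)) atTop (𝓝 (l * T)) := by
    have h := (hlim.mul (hq.pow d)).const_mul (l : ℝ)
    rwa [one_pow, mul_one] at h
  refine tendsto_of_tendsto_of_tendsto_of_le_of_le' hleft hright ?_ ?_
  · filter_upwards [eventually_ge_atTop 1] with n hn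
    have hn' : (n : ℝ) ^ d ≠ 0 := by positivity
    rw [div_pow, div_mul_div_cancel₀ hn', ← mul_div_assoc]
    refine div_le_div_of_nonneg_right ?_ (by positivity)
    exact_mod_cast hlow n hn
  · filter_upwards with n
    rw [← mul_div_assoc]
    refine div_le_div_of_nonneg_right ?_ (by positivity)
    exact_mod_cast (hup (n + m) (by omega)).2

end FiltrationGrowth

/-! ### The volume of a divisor -/

section Volume

open AlgebraicGeometry CategoryTheory

section Order

theorem ord_neg {X : Scheme.{u}} [IsIntegral X] [IsLocallyNoetherian X] (x : X)
    (f : X.functionField) :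
    Scheme.ord (-f) x = Scheme.ord f x := by
  rcases eq_or_ne f 0 with rfl | hf
  · rw [neg_zero]
  have h1 : Scheme.ord (-f * -f) x = Scheme.ord (f * f) x := by rw [neg_mul_neg]
  rw [Scheme.ord_mul (neg_ne_zero.mpr hf) (neg_ne_zero.mpr hf), Scheme.ord_mul hf hf] at h1
  omega

variable {X : Scheme.{u}} [IsIntegral X] [IsLocallyNoetherian X] [IsNormalScheme X]

/-- The rational functions of order at least `c` at a point `x` of codimension one. -/
def ordGE (x : X) (hx : Order.coheight x = 1) (c : ℤ) : AddSubmonoid X.functionField where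
  carrier := {f | f = 0 ∨ c ≤ Scheme.ord f x}
  zero_mem' := Or.inl rfl
  add_mem' := by
    intro f g hf hg
    by_cases h0 : f + g = 0
    · exact Or.inl h0
    rcases hf with rfl | hf
    · simpa using hg
    rcases hg with rfl | hg
    · simpa using Or.inr hf
    have := isDiscreteValuationRing_stalk x hx
    exact Or.inr ((le_min hf hg).trans (Scheme.ord_add h0))

/-- If the coefficients of an equation for `g` have order at least `c`, then so does the product
of `g` with the leading coefficient. -/
theorem le_ord_leadingCoeff_mul {x : X} (hx : Order.coheight x = 1) {c : ℤ}
    {p : Polynomial X.functionField} (hp : p ≠ 0) {g : X.functionField} (hg : g ≠ 0)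
    (hpg : p.eval g = 0) (hc : ∀ i, p.coeff i ∈ ordGE x hx c) :
    c ≤ Scheme.ord (p.leadingCoeff * g) x := by
  have hlc := Polynomial.leadingCoeff_ne_zero.mpr hp
  set a := p.leadingCoeff with ha
  have hac : c ≤ Scheme.ord a x := (hc p.natDegree).resolve_left hlc
  -- If the product had order less than `c`, then `g` would have negative order, as the leading
  -- coefficient has order at least `c`. The leading term of the equation would then have strictly
  -- smaller order than every other term.
  by_contra! hlt
  rw [Scheme.ord_mul hlc hg] at hlt
  set r := p.natDegree with hr
  have hsum : a * g ^ r = -∑ i ∈ Finset.range r, p.coeff i * g ^ i := by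
    rw [Polynomial.eval_eq_sum_range, Finset.sum_range_succ] at hpg
    exact eq_neg_of_add_eq_zero_right hpg
  have hne : a * g ^ r ≠ 0 := mul_ne_zero hlc (pow_ne_zero r hg)
  have hmem : ∑ i ∈ Finset.range r, p.coeff i * g ^ i ∈
      ordGE x hx (Scheme.ord (a * g ^ r) x + 1) := by
    refine sum_mem fun i hi => ?_
    have hir := Finset.mem_range.mp hi
    rcases eq_or_ne (p.coeff i) 0 with h0 | h0
    · rw [h0, zero_mul]; exact zero_mem _
    refine Or.inr ?_
    rw [Scheme.ord_mul h0 (pow_ne_zero i hg), Scheme.ord_mul hlc (pow_ne_zero r hg),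
      Scheme.ord_pow hg, Scheme.ord_pow hg]
    have h1 := (hc i).resolve_left h0
    obtain ⟨j, hj⟩ := Nat.exists_eq_add_of_lt hir
    rw [hj]
    have h2 : (0 : ℤ) ≤ j * (-Scheme.ord g x) := by
      refine mul_nonneg (Int.natCast_nonneg j) ?_
      linarith
    push_cast
    nlinarith
  rcases hmem with h0 | h0
  · rw [h0, neg_zero] at hsum
    exact hne hsum
  · rw [hsum, ord_neg] at h0
    omega

theorem exists_ord_pos {x : X} (hx : Order.coheight x = 1) :
    ∃ t : X.functionField, t ≠ 0 ∧ 1 ≤ Scheme.ord t x := by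
  have := isDiscreteValuationRing_stalk x hx
  obtain ⟨t, ht⟩ := IsDiscreteValuationRing.exists_irreducible (X.presheaf.stalk x)
  exact ⟨_, (map_ne_zero_iff _ (IsFractionRing.injective _ _)).mpr ht.ne_zero,
    Scheme.one_le_ord_algebraMap hx ht.ne_zero ((IsLocalRing.mem_maximalIdeal _).mpr ht.not_isUnit)⟩

end Order

variable {k : Type u} [Field k] {X : Scheme.{u}} [X.Over (Spec (.of k))] [IsIntegral X]
  [IsLocallyNoetherian X] [IsNormalScheme X] {D : WeilDivisor X} {d : ℕ}

theorem pow_mem_sectionSpace {m : ℕ} {h : X.functionField}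
    (hh : h ∈ sectionSpace k X (m • D)) (j : ℕ) :
    h ^ j ∈ sectionSpace k X ((m * j) • D) := by
  induction j with
  | zero =>
    rw [pow_zero, mul_zero, zero_smul]
    exact one_mem_sectionSpace le_rfl
  | succ j ih =>
    rw [pow_succ, mul_add, mul_one, add_smul]
    exact mul_mem_sectionSpace ih hh

/-- If the function field is algebraic over `k`, then there are no points of codimension one. -/
theorem coheight_ne_one_of_isAlgebraic [Algebra.IsAlgebraic k X.functionField] (x : X) :
    Order.coheight x ≠ 1 := by
  intro hx
  obtain ⟨t, ht, h1⟩ := exists_ord_pos hx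
  -- A function integral over the constants has nonnegative order, whereas `t⁻¹` has a pole.
  have hint : IsIntegral k t⁻¹ := Algebra.IsIntegral.isIntegral _
  have hmon := minpoly.monic hint
  have h := le_ord_leadingCoeff_mul hx (c := 0)
    (p := (minpoly k t⁻¹).map (algebraMap k X.functionField)) (hmon.map _).ne_zero
    (inv_ne_zero ht) (by rw [Polynomial.eval_map_algebraMap, minpoly.aeval]) fun i => by
      rw [Polynomial.coeff_map]
      exact Or.inr (by
        rcases eq_or_ne ((minpoly k t⁻¹).coeff i) 0 with h0 | h0
        · rw [h0, _root_.map_zero, Scheme.ord_zero]; rfl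
        · rw [ord_constant _ h0])
  rw [(hmon.map _).leadingCoeff, one_mul, Scheme.ord_inv ht] at h
  omega

/-- If all the spaces vanish, the field of ratios is `k`, so `d = 0`. Then there are no points of
codimension one and `1` is a section after all. -/
theorem exists_sectionSpace_ne_zero (htr : Algebra.trdeg k X.functionField = d)
    (hrat : Algebra.trdeg k (sectionRatioField k X D) = d) :
    ∃ n : ℕ, n ≥ 1 ∧ ∃ f ∈ sectionSpace k X (n • D), f ≠ 0 := by
  by_contra! hcon
  have hbot : sectionRatioField k X D = ⊥ := by
    rw [sectionRatioField, eq_bot_iff, IntermediateField.adjoin_le_iff]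
    rintro _ ⟨n, hn, f, -, g, hg, hg0, -⟩
    exact absurd (hcon n hn g hg) hg0
  have hd : (d : Cardinal) = 0 := by
    rw [← hrat, hbot]
    exact trdeg_eq_zero
  rw [hd] at htr
  have : Algebra.IsAlgebraic k X.functionField := trdeg_eq_zero_iff.mp htr
  refine one_ne_zero (hcon 1 le_rfl (1 : X.functionField) ?_)
  exact (mem_sectionSpace one_ne_zero).mpr fun x hx =>
    absurd hx (coheight_ne_one_of_isAlgebraic (k := k) x)

/-- The quotients of sections of equal degree already form a field; a nonzero section is needed to
write the constants as such quotients. -/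
theorem exists_eq_div_of_mem_sectionRatioField
    (hne : ∃ n : ℕ, n ≥ 1 ∧ ∃ f ∈ sectionSpace k X (n • D), f ≠ 0) {q : X.functionField}
    (hq : q ∈ sectionRatioField k X D) :
    ∃ n : ℕ, 1 ≤ n ∧ ∃ f ∈ sectionSpace k X (n • D), ∃ g ∈ sectionSpace k X (n • D),
      g ≠ 0 ∧ q = f / g := by
  induction hq using IntermediateField.adjoin_induction with
  | mem q hq => exact hq
  | algebraMap c =>
    obtain ⟨n, hn, g, hg, hg0⟩ := hne
    refine ⟨n, hn, c • g, Submodule.smul_mem _ c hg, g, hg, hg0, ?_⟩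
    rw [Algebra.smul_def, mul_div_cancel_right₀ _ hg0]
  | add x y _ _ hx hy =>
    obtain ⟨m, hm, f, hf, g, hg, hg0, rfl⟩ := hx
    obtain ⟨n, hn, f', hf', g', hg', hg0', rfl⟩ := hy
    refine ⟨m + n, by omega, f * g' + g * f', ?_, g * g', ?_, mul_ne_zero hg0 hg0',
      div_add_div _ _ hg0 hg0'⟩
    · rw [add_smul]
      exact add_mem (mul_mem_sectionSpace hf hg') (mul_mem_sectionSpace hg hf')
    · rw [add_smul]
      exact mul_mem_sectionSpace hg hg'
  | inv x _ hx =>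
    obtain ⟨n, hn, f, hf, g, hg, hg0, rfl⟩ := hx
    rcases eq_or_ne f 0 with rfl | hf0
    · exact ⟨n, hn, 0, zero_mem _, g, hg, hg0, by simp⟩
    · exact ⟨n, hn, g, hg, f, hf, hf0, inv_div _ _⟩
  | mul x y _ _ hx hy =>
    obtain ⟨m, hm, f, hf, g, hg, hg0, rfl⟩ := hx
    obtain ⟨n, hn, f', hf', g', hg', hg0', rfl⟩ := hy
    refine ⟨m + n, by omega, f * f', ?_, g * g', ?_, mul_ne_zero hg0 hg0',
      div_mul_div_comm _ _ _ _⟩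
    · rw [add_smul]
      exact mul_mem_sectionSpace hf hf'
    · rw [add_smul]
      exact mul_mem_sectionSpace hg hg'

theorem exists_common_denominator (hne : ∃ n : ℕ, n ≥ 1 ∧ ∃ f ∈ sectionSpace k X (n • D), f ≠ 0)
    (s : Finset X.functionField) (hs : ∀ q ∈ s, q ∈ sectionRatioField k X D) :
    ∃ m : ℕ, m ≥ 1 ∧ ∃ A ∈ sectionSpace k X (m • D), A ≠ 0 ∧
      ∀ q ∈ s, A * q ∈ sectionSpace k X (m • D) := by
  classical
  induction s using Finset.induction_on with
  | empty =>
    obtain ⟨n, hn, f, hf, hf0⟩ := hne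
    exact ⟨n, hn, f, hf, hf0, by simp⟩
  | insert q s _ ih =>
    obtain ⟨m, hm, A, hA, hA0, hAs⟩ := ih fun q hq => hs q (Finset.mem_insert_of_mem hq)
    obtain ⟨n, hn, f, hf, g, hg, hg0, hq⟩ :=
      exists_eq_div_of_mem_sectionRatioField hne (hs q (Finset.mem_insert_self _ _))
    refine ⟨m + n, by omega, A * g, ?_, mul_ne_zero hA0 hg0, fun q' hq' => ?_⟩
    · rw [add_smul]; exact mul_mem_sectionSpace hA hg
    rw [add_smul]
    rcases Finset.mem_insert.mp hq' with rfl | hq'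
    · have : A * g * q' = A * f := by rw [hq]; field_simp
      rw [this]
      exact mul_mem_sectionSpace hA hf
    · rw [mul_right_comm]
      exact mul_mem_sectionSpace (hAs q' hq') hg

/-- Every rational function is a quotient of sections of the same multiple of `D`. -/
theorem exists_mul_mem_sectionSpace (htr : Algebra.trdeg k X.functionField = d)
    (hrat : Algebra.trdeg k (sectionRatioField k X D) = d) (g : X.functionField) :
    ∃ m : ℕ, m ≥ 1 ∧ ∃ A ∈ sectionSpace k X (m • D), A ≠ 0 ∧ A * g ∈ sectionSpace k X (m • D) := by
  classical
  have hne := exists_sectionSpace_ne_zero htr hrat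
  have halg : Algebra.IsAlgebraic (sectionRatioField k X D) X.functionField := by
    have h := trdeg_add_eq k (sectionRatioField k X D) (A := X.functionField)
    rw [hrat, htr] at h
    exact trdeg_eq_zero_iff.mp (Cardinal.eq_of_add_eq_add_left (h.trans (add_zero _).symm)
      Cardinal.natCast_lt_aleph0)
  rcases eq_or_ne g 0 with rfl | hg0
  · obtain ⟨n, hn, f, hf, hf0⟩ := hne
    exact ⟨n, hn, f, hf, hf0, by rw [mul_zero]; exact zero_mem _⟩
  -- Clear the denominators of the minimal polynomial of `g` over the field of ratios by a section
  -- `A` of `m • D`. The result has coefficients in `L(X, mD)` and leading coefficient `A`, so the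
  -- order estimate for leading coefficients shows that `A * g` is a section too.
  set P := (minpoly (sectionRatioField k X D) g).map
    (algebraMap (sectionRatioField k X D) X.functionField) with hP
  have hmon : P.Monic := (minpoly.monic (Algebra.IsIntegral.isIntegral g)).map _
  obtain ⟨m, hm, A, hA, hA0, hAs⟩ := exists_common_denominator hne P.coeffs (by
    intro q hq
    obtain ⟨i, -, rfl⟩ := Polynomial.mem_coeffs_iff.mp hq
    rw [hP, Polynomial.coeff_map]
    exact Subtype.prop _)
  refine ⟨m, hm, A, hA, hA0, (mem_sectionSpace (mul_ne_zero hA0 hg0)).mpr fun x hx => ?_⟩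
  have hlc : (Polynomial.C A * P).leadingCoeff = A := by
    rw [Polynomial.leadingCoeff_mul_monic hmon, Polynomial.leadingCoeff_C]
  have h := le_ord_leadingCoeff_mul hx (c := -((m • D : WeilDivisor X) : AlgebraicCycle X ℤ) x)
    (p := Polynomial.C A * P) (g := g) (mul_ne_zero (Polynomial.C_ne_zero.mpr hA0) hmon.ne_zero)
    hg0 (by rw [Polynomial.eval_mul, hP, Polynomial.eval_map_algebraMap, minpoly.aeval, mul_zero])
    fun i => by
      rw [Polynomial.coeff_C_mul]
      by_cases hi : P.coeff i = 0
      · rw [hi, mul_zero]; exact zero_mem _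
      · exact (hAs _ (Polynomial.coeff_mem_coeffs hi)).imp_right fun h => h x hx
  rwa [hlc] at h

/-- Some nonzero function is a section of two consecutive multiples of `D`. -/
theorem exists_mem_sectionSpace_succ [CompactSpace X] (htr : Algebra.trdeg k X.functionField = d)
    (hrat : Algebra.trdeg k (sectionRatioField k X D) = d) :
    ∃ m : ℕ, m ≥ 1 ∧ ∃ h ∈ sectionSpace k X (m • D), h ≠ 0 ∧
      h ∈ sectionSpace k X ((m + 1) • D) := by
  classical
  -- Look for a section that vanishes to excess order `|D x|` on the support of `D`. The excess pays
  -- for adding one more copy of `D`, whatever its sign.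
  have key : ∀ t : Finset X, ∃ m : ℕ, m ≥ 1 ∧ ∃ h ∈ sectionSpace k X (m • D), h ≠ 0 ∧
      ∀ x ∈ t, Order.coheight x = 1 →
        -(m * (D : AlgebraicCycle X ℤ) x) + |(D : AlgebraicCycle X ℤ) x| ≤ Scheme.ord h x := by
    intro t
    induction t using Finset.induction_on with
    | empty =>
      obtain ⟨n, hn, f, hf, hf0⟩ := exists_sectionSpace_ne_zero htr hrat
      exact ⟨n, hn, f, hf, hf0, by simp⟩
    | insert x t _ ih =>
      obtain ⟨m, hm, h, hh, h0, ht⟩ := ih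
      by_cases hx : Order.coheight x = 1
      swap
      · refine ⟨m, hm, h, hh, h0, fun y hy hy1 => ?_⟩
        rcases Finset.mem_insert.mp hy with rfl | hy
        · exact absurd hy1 hx
        · exact ht y hy hy1
      obtain ⟨π, hπ0, hπ⟩ := exists_ord_pos hx
      set e := ((D : AlgebraicCycle X ℤ) x).natAbs with he
      -- Both `A` and `A * π ^ e` are sections of `n • D`. At `x` the second gains the required
      -- order from `π`; at the points treated before it is enough that it is a section.
      obtain ⟨n, hn, A, hA, hA0, hAw⟩ := exists_mul_mem_sectionSpace htr hrat (π ^ e)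
      have hw0 : π ^ e ≠ 0 := pow_ne_zero e hπ0
      have hAw0 := mul_ne_zero hA0 hw0
      refine ⟨m + n, by omega, h * (A * π ^ e), ?_, mul_ne_zero h0 hAw0, fun y hy hy1 => ?_⟩
      · rw [add_smul]; exact mul_mem_sectionSpace hh hAw
      have h1 := (mem_sectionSpace h0).mp hh y hy1
      have h2 := (mem_sectionSpace hAw0).mp hAw y hy1
      have h3 := (mem_sectionSpace hA0).mp hA y hy1
      rw [nsmul_weilDivisor_apply] at h1 h2 h3
      rw [Scheme.ord_mul h0 hAw0]
      push_cast
      rcases Finset.mem_insert.mp hy with rfl | hy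
      · have h4 : |(D : AlgebraicCycle X ℤ) y| ≤ Scheme.ord (π ^ e) y := by
          rw [Scheme.ord_pow hπ0, he, Int.natCast_natAbs]
          exact le_mul_of_one_le_right (abs_nonneg _) hπ
        rw [Scheme.ord_mul hA0 hw0]
        linarith
      · have := ht y hy hy1
        linarith
  obtain ⟨m, hm, h, hh, h0, ht⟩ := key (finite_support_weilDivisor D).toFinset
  refine ⟨m, hm, h, hh, h0, (mem_sectionSpace h0).mpr fun x hx => ?_⟩
  rw [nsmul_weilDivisor_apply]
  by_cases hxD : (D : AlgebraicCycle X ℤ) x = 0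
  · have := (mem_sectionSpace h0).mp hh x hx
    rw [nsmul_weilDivisor_apply] at this
    rw [hxD] at this ⊢
    simpa using this
  · have h1 := ht x ((finite_support_weilDivisor D).mem_toFinset.mpr hxD) hx
    have h2 := neg_abs_le ((D : AlgebraicCycle X ℤ) x)
    push_cast
    linarith

theorem isGeneratingFiltration_sectionSpace [CompactSpace X]
    (htr : Algebra.trdeg k X.functionField = d)
    (hrat : Algebra.trdeg k (sectionRatioField k X D) = d) :
    IsGeneratingFiltration (fun n => sectionSpace k X (n • D)) where
  mul_mem := fun m n _ _ f hf g hg => by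
    rw [add_smul]
    exact mul_mem_sectionSpace hf hg
  exists_div := by
    intro z u hu
    obtain ⟨M, hM, h, hh, h0, hh'⟩ := exists_mem_sectionSpace_succ htr hrat
    obtain ⟨m, hm, A, hA, hA0, hAu⟩ := exists_mul_mem_sectionSpace htr hrat u
    have hj := fun i j : ℕ => mul_mem_sectionSpace (pow_mem_sectionSpace hh' i)
      (pow_mem_sectionSpace hh j)
    simp only [← add_smul] at hj
    set a := z.toNat
    set b := (-z).toNat
    have hz : z = a - b := by omega
    -- The function `h ^ (a + b)` is a section both in degree `(M + 1) * a + M * b` and in degree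
    -- `(M + 1) * b + M * a`. These degrees differ by `a - b = z`, so it shifts the degree without
    -- changing the quotient.
    refine ⟨m + ((M + 1) * a + M * b), m + ((M + 1) * b + M * a), by omega, by omega, ?_,
      A * u * (h ^ a * h ^ b), ?_, A * (h ^ b * h ^ a), ?_, by positivity, by positivity, ?_⟩
    · rw [hz]; push_cast; ring
    · rw [add_smul]; exact mul_mem_sectionSpace hAu (hj a b)
    · rw [add_smul]; exact mul_mem_sectionSpace hA (hj b a)
    · field_simp

/-- The dimensions do not involve a valuation, so any valuation of maximal rank, with whatever
residue field, can be used to compute their asymptotics. -/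
theorem volume_of_divisor [IsProper (X ↘ Spec (.of k))] (D : WeilDivisor X)
    (htr : Algebra.trdeg k X.functionField = d)
    (hrat : Algebra.trdeg k (sectionRatioField k X D) = d) :
    (∀ n ≥ 1, Module.Finite k (sectionSpace k X (n • D))) ∧
    0 < divisorVolume k X d D ∧ divisorVolume k X d D < ⊤ ∧
    Tendsto (fun n : ℕ => (d ! : ℝ≥0∞) *
        ((Module.finrank k (sectionSpace k X (n • D)) : ℝ≥0∞) / (n : ℝ≥0∞) ^ d)) atTop
      (𝓝 (divisorVolume k X d D)) := by
  have : CompactSpace X := QuasiCompact.compactSpace_of_compactSpace (X ↘ Spec (.of k))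
  obtain ⟨W, hv⟩ := exists_isMaximalRank (functionField_fg (k := k) (X := X)) htr
  obtain ⟨C, hC⟩ := hv.exists_ncard_valueSet_sectionSpace_le D
  obtain ⟨hfin, L, hL, hlim⟩ := (isGeneratingFiltration_sectionSpace htr
    hrat).exists_tendsto_finrank_div functionField_fg hv (C := C)
    fun n hn => ⟨(hC n hn).1, by exact_mod_cast (hC n hn).2⟩
  have hlim' := tendsto_ennreal_natCast_div_pow hlim
  have hvol : divisorVolume k X d D = (d ! : ℝ≥0∞) * ENNReal.ofReal L := by
    rw [divisorVolume, hlim'.limsup_eq]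
  have hd0 : (d ! : ℝ≥0∞) ≠ 0 := by exact_mod_cast Nat.factorial_ne_zero d
  rw [hvol]
  refine ⟨hfin, ?_, ENNReal.mul_lt_top (ENNReal.natCast_lt_top _) ENNReal.ofReal_lt_top,
    ENNReal.Tendsto.const_mul hlim' (Or.inr (ENNReal.natCast_ne_top _))⟩
  exact ENNReal.mul_pos hd0 (ENNReal.ofReal_pos.mpr hL).ne'

end Volume

theorem mainTheorem11 :
    -- Okounkov bodies of filtered subalgebras of a function field
    (∀ (k K Γ : Type*) [Field k] [Field K] [Algebra k K]
        [AddCommGroup Γ] [LinearOrder Γ] [IsOrderedAddMonoid Γ]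
        (d : ℕ) (v : AddValuation K (WithTop Γ)) (S : ℕ → Submodule k K),
        (⊤ : IntermediateField k K).FG → IsMaximalRank k d v → IsOkounkovFiltration d S →
        Nonempty (Module.Basis (Fin d) ℤ (valueGroup v)) ∧
        (∀ n ≥ 1, (valueSet v S n).Finite) ∧
        IsCompact (okounkovBody v S) ∧
        ∀ b : Module.Basis (Fin d) ℤ (valueGroup v),
          lebesgueMeasure b (okounkovBody v S) < ⊤ ∧
          ∀ f : RealSpan (valueGroup v) →ᵇ ℝ,
            Tendsto (fun n : ℕ => ∫ p, f p ∂(normalizedCount d v S n)) atTop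
              (𝓝 (∫ p in okounkovBody v S, f p ∂(lebesgueMeasure b)))) ∧
    -- the Okounkov body of an effective divisor and its volume
    (∀ (k : Type u) [Field k] (X : AlgebraicGeometry.Scheme.{u})
        [X.Over (AlgebraicGeometry.Spec (.of k))] [AlgebraicGeometry.IsIntegral X]
        [AlgebraicGeometry.IsProper (CategoryTheory.over X (AlgebraicGeometry.Spec (.of k)))]
        [AlgebraicGeometry.IsLocallyNoetherian X] [IsNormalScheme X]
        (Γ : Type*) [AddCommGroup Γ] [LinearOrder Γ] [IsOrderedAddMonoid Γ]
        (d : ℕ) (v : AddValuation X.functionField (WithTop Γ)) (D : WeilDivisor X),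
        IsMaximalRank k d v → (IsAlgClosed k ∨ HasResidueField k v) →
        0 ≤ (D : AlgebraicGeometry.AlgebraicCycle X ℤ) →
        IntermediateField.adjoin k
          (⋃ n ≥ 1, (sectionSpace k X (n • D) : Set X.functionField)) = ⊤ →
        IsOkounkovFiltration d (fun n => sectionSpace k X (n • D)) ∧
        Nonempty (Module.Basis (Fin d) ℤ (valueGroup v)) ∧
        ∀ b : Module.Basis (Fin d) ℤ (valueGroup v),
          lebesgueMeasure b (okounkovBody v (fun n => sectionSpace k X (n • D))) =
            divisorVolume k X d D / (d ! : ℝ≥0∞)) ∧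
    -- the volume is positive and is a limit
    (∀ (k : Type u) [Field k] (X : AlgebraicGeometry.Scheme.{u})
        [X.Over (AlgebraicGeometry.Spec (.of k))] [AlgebraicGeometry.IsIntegral X]
        [AlgebraicGeometry.IsProper (CategoryTheory.over X (AlgebraicGeometry.Spec (.of k)))]
        [AlgebraicGeometry.IsLocallyNoetherian X] [IsNormalScheme X]
        (d : ℕ) (D : WeilDivisor X),
        Algebra.trdeg k X.functionField = d →
        Algebra.trdeg k (sectionRatioField k X D) = d →
        (∀ n ≥ 1, Module.Finite k (sectionSpace k X (n • D))) ∧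
        0 < divisorVolume k X d D ∧ divisorVolume k X d D < ⊤ ∧
        Tendsto (fun n : ℕ => (d ! : ℝ≥0∞) *
            ((Module.finrank k (sectionSpace k X (n • D)) : ℝ≥0∞) / (n : ℝ≥0∞) ^ d)) atTop
          (𝓝 (divisorVolume k X d D))) := by
  refine ⟨?_, ?_, ?_⟩
  · intro k K Γ _ _ _ _ _ _ d v S hfg hv hS
    exact okounkovBody_of_filtered_algebra hfg hv hS
  · intro k _ X _ _ _ _ _ Γ _ _ _ d v D hv hres hD hgen
    exact okounkovBody_of_effective_divisor hv hres hD hgen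
  · intro k _ X _ _ _ _ _ d D htr hrat
    exact volume_of_divisor D htr hrat
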